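/- Let $\lambda_p,d,P_t>0$ and $0<R_{\mathrm{tx}}<R_{\mathrm{cs}}$, and let $l$ be a measurable path-loss function with values in $[0,\infty]$. Let $\{(X_i,\theta_i,m_i)\}$ be an independently marked Poisson point process on $\mathbb{R}^2$ of intensity $\lambda_p$: the locations $X_i$ of the potential transmitters form a homogeneous Poisson process, and their marks are all independent of each other and of the locations, the orientations $\theta_i$ uniform on $[0,2\pi]$ and the time stamps $m_i$ uniform on $[0,1]$. The receiver of a transmitter at $x$ with orientation $\theta$ is at $x+(d\cos\theta,d\sin\theta)$, and the exclusion zone of this pair is the union of the disc of radius $R_{\mathrm{cs}}$ around $x$ and the disc of radius $R_{\mathrm{tx}}$ around the receiver. The type II concurrent transmission process $\widetilde\Phi$ consists of the pairs $(X_i,\theta_i)$ such that $m_i<m_j$ for every $j\neq i$ with $X_j$ in the exclusion zone of $(X_i,\theta_i)$. Let $V_o$ be the area of the exclusion zone of a pair, and $V=V(r,\varphi,\theta)$ the area of the union of the exclusion zones of two pairs, one with transmitter at the origin and orientation $0$, the other with transmitter at polar coordinates $(r,\varphi)$ and orientation $\theta$. Then the retained transmitters have intensity $\lambda=(1-e^{-\lambda_pV_o})/V_o$.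 Moreover, the mean interference at a typical receiver, i.e. the expectation under the reduced Palm distribution of $\widetilde\Phi$ at $(o,0)$ (a retained pair with transmitter at the origin $o$ and orientation $0$, this pair itself being removed) of $I_{z_o}=\sum_{(x,\theta)\in\widetilde\Phi}P_t\,l(|x-z_o|)$ with $z_o=(d,0)$, is, as an identity in $[0,\infty]$, $$E^!_{(o,0)}(I_{z_o})=\frac{\lambda_p^2P_t}{2\pi\lambda}\int_0^\infty\!\int_0^{2\pi}\!\int_0^{2\pi} l\big(\sqrt{r^2-2rd\cos\varphi+d^2}\big)\,k(r,\varphi,0,\theta)\,r\,\mathrm{d}\theta\,\mathrm{d}\varphi\,\mathrm{d}r .$$ Here, with $$S_1=\{r\le R_{\mathrm{cs}}\},\quad S_2=\{r^2-2rd\cos\varphi+d^2\le R_{\mathrm{tx}}^2\},\quad S_3=\{r^2+2rd\cos(\varphi-\theta)+d^2\le R_{\mathrm{tx}}^2\},$$ $k(r,\varphi,0,\theta)$ equals $0$ on $S_1\cup(S_2\cap S_3)$, $2\beta(V)$ on $\overline{S_1}\cap\overline{S_2}\cap\overline{S_3}$, and $\beta(V)$ otherwise, where $$\beta(V)=\frac{V_oe^{-\lambda_pV}-Ve^{-\lambda_pV_o}+V-V_o}{\lambda_p^2(V-V_o)VV_o}.$$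 -/

import Mathlib

open MeasureTheory ProbabilityTheory Set
open scoped ENNReal NNReal

noncomputable section

/-- The Euclidean plane. -/
abbrev Plane : Type := EuclideanSpace ℝ (Fin 2)

/-! ### Poisson processes and independently marked Poisson processes -/

/-- The number of points of the family `X` (counted with multiplicity) that lie in `A`. -/
def pointCount {Ω : Type*} (X : ℕ → Ω → Plane) (A : Set Plane) (ω : Ω) : ℕ∞ :=
  {i : ℕ | X i ω ∈ A}.encard

/-- The points `X 0, X 1, …` form a homogeneous Poisson point process of intensity `lamp` in the
plane: the number of points in a Borel set `A` of finite area is Poisson distributed with mean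
`lamp * |A|`, and the numbers of points in disjoint sets are independent. -/
structure IsPoissonProcess {Ω : Type*} [MeasurableSpace Ω] (P : Measure Ω) (lamp : ℝ)
    (X : ℕ → Ω → Plane) : Prop where
  measurable : ∀ i, Measurable (X i)
  count_law : ∀ A : Set Plane, MeasurableSet A → volume A ≠ ∞ → ∀ n : ℕ,
    P {ω | pointCount X A ω = n} = poissonMeasure (Real.toNNReal (lamp * volume.real A)) {n}
  count_indep : ∀ (n : ℕ) (A : Fin n → Set Plane), (∀ k, MeasurableSet (A k)) →
    (∀ k, volume (A k) ≠ ∞) → Pairwise (fun k k' => Disjoint (A k) (A k')) →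
    iIndepFun (fun k ω => pointCount X (A k) ω) P

/-- `(X i, θ i, m i)` is an independently marked Poisson process: the locations `X i` of the
potential transmitters form a Poisson process of intensity `lamp`; the orientations `θ i` are
uniform on `[0, 2π]`, the time stamps `m i` are uniform on `[0, 1]`, and all these marks are
independent of each other and of the locations. -/
structure IsMarkedPoissonProcess {Ω : Type*} [MeasurableSpace Ω] (P : Measure Ω) (lamp : ℝ)
    (X : ℕ → Ω → Plane) (θ m : ℕ → Ω → ℝ) : Prop where
  poisson : IsPoissonProcess P lamp X
  measurable_orientation : ∀ i, Measurable (θ i)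
  measurable_time : ∀ i, Measurable (m i)
  orientation_law : ∀ i, pdf.IsUniform (θ i) (Icc 0 (2 * Real.pi)) P volume
  time_law : ∀ i, pdf.IsUniform (m i) (Icc 0 1) P volume
  indep_orientation_time : ∀ i, IndepFun (θ i) (m i) P
  indep_marks : iIndepFun (fun i ω => (θ i ω, m i ω)) P
  indep_points_marks :
    IndepFun (fun ω (i : ℕ) => X i ω) (fun ω (i : ℕ) => (θ i ω, m i ω)) P

/-! ### The type II RTS/CTS thinning -/

/-- The location of the receiver of a transmitter at `x` with orientation `θ`. -/
def receiver (d : ℝ) (x : Plane) (θ : ℝ) : Plane :=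
  x + !₂[d * Real.cos θ, d * Real.sin θ]

/-- The exclusion zone of a transceiver pair: the disc of radius `Rcs` around the transmitter
together with the disc of radius `Rtx` around the receiver. -/
def exclusionZone (d Rcs Rtx : ℝ) (x : Plane) (θ : ℝ) : Set Plane :=
  Metric.closedBall x Rcs ∪ Metric.closedBall (receiver d x θ) Rtx

/-- The pair `i` is retained (its medium access indicator is `1`): every other transmitter in its
exclusion zone has a larger time stamp. -/
def Retained {Ω : Type*} (d Rcs Rtx : ℝ) (X : ℕ → Ω → Plane) (θ m : ℕ → Ω → ℝ)
    (i : ℕ) (ω : Ω) : Prop :=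
  ∀ j, j ≠ i → X j ω ∈ exclusionZone d Rcs Rtx (X i ω) (θ i ω) → m i ω < m j ω

/-- The type II concurrent transmission process: locations and orientations of retained pairs. -/
def retainedPairs {Ω : Type*} (d Rcs Rtx : ℝ) (X : ℕ → Ω → Plane) (θ m : ℕ → Ω → ℝ)
    (ω : Ω) : Set (Plane × ℝ) :=
  {p | ∃ i, Retained d Rcs Rtx X θ m i ω ∧ p = (X i ω, θ i ω)}

/-- The locations of the retained transmitters. -/
def retainedTransmitters {Ω : Type*} (d Rcs Rtx : ℝ) (X : ℕ → Ω → Plane) (θ m : ℕ → Ω → ℝ)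
    (ω : Ω) : Set Plane :=
  Prod.fst '' retainedPairs d Rcs Rtx X θ m ω

/-! ### Intensity and reduced Palm expectation -/

/-- The expected number of points of a random set of points in `B`. -/
def meanCount {Ω : Type*} [MeasurableSpace Ω] (P : Measure Ω) (Φ : Ω → Set Plane)
    (B : Set Plane) : ℝ≥0∞ :=
  ∫⁻ ω, ((Φ ω ∩ B).encard : ℝ≥0∞) ∂P

/-- The unit square. -/
def unitSquare : Set Plane := {x | ∀ i, x i ∈ Icc (0 : ℝ) 1}

/-- The intensity of a stationary point process: the expected number of points in the unit
square. -/
def intensity {Ω : Type*} [MeasurableSpace Ω] (P : Measure Ω) (Φ : Ω → Set Plane) : ℝ≥0∞ :=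
  meanCount P Φ unitSquare

/-- The rotation of the plane by the angle `a` about the origin. -/
def rotate (a : ℝ) (v : Plane) : Plane :=
  !₂[Real.cos a * v 0 - Real.sin a * v 1, Real.sin a * v 0 + Real.cos a * v 1]

/-- The rigid motion which takes the pair `p` (a location and an orientation) to the pair `(o, 0)`,
applied to the pair `q`; orientations are kept in `[0, 2π)`. -/
def viewFrom (p q : Plane × ℝ) : Plane × ℝ :=
  (rotate (-p.2) (q.1 - p.1), toIcoMod Real.two_pi_pos 0 (q.2 - p.2))

/-- The expectation of `F` under the reduced Palm distribution at `(o, 0)` of a process `Ψ` of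
oriented points in the plane whose law is invariant under rigid motions: the average, over the
points `p` of `Ψ` with location in the window `B` and orientation in the window `L`, of the value
of `F` at the process seen from `p`, with `p` itself taken away. The mean number of such points is
`lam * |B| * |L| / (2 * π)`, where `lam` is the intensity of the locations. -/
def reducedPalmExpectation {Ω : Type*} [MeasurableSpace Ω] (P : Measure Ω)
    (Ψ : Ω → Set (Plane × ℝ)) (B : Set Plane) (L : Set ℝ)
    (F : Set (Plane × ℝ) → ℝ≥0∞) : ℝ≥0∞ :=
  (∫⁻ ω, ∑' p : ↥(Ψ ω ∩ B ×ˢ L), F (viewFrom p '' (Ψ ω \ {(p : Plane × ℝ)})) ∂P) /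
    (intensity P (fun ω => Prod.fst '' Ψ ω) * volume B * (volume L / ENNReal.ofReal (2 * Real.pi)))

/-- The interference received at `z` from the transmitters of the pairs in `ψ`, for the transmit
power `Pt` and the path-loss function `l`. -/
def interference (Pt : ℝ) (l : ℝ → ℝ≥0∞) (z : Plane) (ψ : Set (Plane × ℝ)) : ℝ≥0∞ :=
  ∑' q : ↥ψ, ENNReal.ofReal Pt * l (dist (q : Plane × ℝ).1 z)

/-! ### The geometric quantities of the formula -/

/-- The area of the exclusion zone of a transceiver pair. -/
def zoneArea (d Rcs Rtx : ℝ) : ℝ := volume.real (exclusionZone d Rcs Rtx 0 0)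

/-- The area of the union of the exclusion zones of two pairs: one with transmitter at the origin
and orientation `0`, one with transmitter at polar coordinates `(r, φ)` and orientation `θ`. -/
def unionArea (d Rcs Rtx r φ θ : ℝ) : ℝ :=
  volume.real (exclusionZone d Rcs Rtx 0 0 ∪
    exclusionZone d Rcs Rtx !₂[r * Real.cos φ, r * Real.sin φ] θ)

/-- Triples `(r, φ, θ)`: the two transmitters are in the sensing discs of each other. -/
def S₁ (Rcs : ℝ) : Set (ℝ × ℝ × ℝ) := {p | p.1 ≤ Rcs}

/-- Triples `(r, φ, θ)`: the second transmitter is within `Rtx` of the first receiver. -/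
def S₂ (d Rtx : ℝ) : Set (ℝ × ℝ × ℝ) :=
  {p | p.1 ^ 2 - 2 * p.1 * d * Real.cos p.2.1 + d ^ 2 ≤ Rtx ^ 2}

/-- Triples `(r, φ, θ)`: the first transmitter is within `Rtx` of the second receiver. -/
def S₃ (d Rtx : ℝ) : Set (ℝ × ℝ × ℝ) :=
  {p | p.1 ^ 2 + 2 * p.1 * d * Real.cos (p.2.1 - p.2.2) + d ^ 2 ≤ Rtx ^ 2}

def beta (lamp Vo V : ℝ) : ℝ :=
  (Vo * Real.exp (-lamp * V) - V * Real.exp (-lamp * Vo) + V - Vo) /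
    (lamp ^ 2 * (V - Vo) * V * Vo)

open Classical in
/-- The function `k(r, φ, 0, θ)`. -/
def kFun (lamp d Rcs Rtx r φ θ : ℝ) : ℝ :=
  if (r, φ, θ) ∈ S₁ Rcs ∪ (S₂ d Rtx ∩ S₃ d Rtx) then 0
  else if (r, φ, θ) ∈ (S₁ Rcs)ᶜ ∩ (S₂ d Rtx)ᶜ ∩ (S₃ d Rtx)ᶜ then
    2 * beta lamp (zoneArea d Rcs Rtx) (unionArea d Rcs Rtx r φ θ)
  else beta lamp (zoneArea d Rcs Rtx) (unionArea d Rcs Rtx r φ θ)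

end

/-! Both claims are moment computations for the retained process: first moments give the intensity,
sums over ordered pairs give the Palm expectation. The Mecke formula turns such sums over Poisson
points into integrals over added points, with the original process as background.

Freeze the locations and the marks of the points singled out. A point at `x` with stamp `t` is
retained when every other point of its zone has a larger stamp, which has probability `(1 - t) ^ N`,
where `N` counts those points. Under the Poisson law the mean of this power is `exp (-lamp * t *
Vo)`, and integrating `lamp * exp (-lamp * t * Vo)` over `t` in `[0, 1]` gives `(1 - exp (-lamp *
Vo)) / Vo`.

For two points with stamps `s`, `t`, split the union of the zones into the two one-sided differences
and the intersection; a third point has to beat `s`, `t` or `max s t` accordingly. The zones are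
congruent, so both differences have the same area `a = V - Vo`. For `s < t` the joint probability is
`exp (-lamp * (s * a + t * Vo))`, whose integral over `s < t` is `beta lamp Vo V`. If one point lies
in the zone of the other, only one order of the stamps is possible; if each lies in the zone of the
other, none is; otherwise both are. This gives the values `beta`, `0` and `2 * beta` of `kFun`.

Finally, the pair probability is invariant under rigid motions. Seen from `(x, θ)`, the integral
over the second point depends on neither `x` nor `θ`, so the window contributes only the factor `|B|
* |L| / (2 * π)`, which the Palm normalisation cancels. Polar coordinates give the stated integral.

The Mecke formula itself (`IsPoissonProcess.mecke`, `mecke_two`) is derived from the Poisson laws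
and independence of counts. The other main steps are `lintegral_tsum_retained`,
`lintegral_tsum_retained_pairs`, `lintegral_lintegral_pairLevels`, `pairKernel_polarPoint` and
`lintegral_window_pairKernel`. -/

/-- The counting measure of the points of the sequence `x`, with multiplicity. -/
noncomputable def pointMeasure (x : ℕ → Plane) : Measure Plane :=
  Measure.sum fun i => Measure.dirac (x i)

lemma lintegral_pointMeasure (x : ℕ → Plane) {f : Plane → ℝ≥0∞} (hf : Measurable f) :
    ∫⁻ y, f y ∂pointMeasure x = ∑' i, f (x i) := by
  simp [pointMeasure, lintegral_sum_measure, lintegral_dirac' _ hf]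

lemma pointMeasure_apply (x : ℕ → Plane) {A : Set Plane} (hA : MeasurableSet A) :
    pointMeasure x A = ({i | x i ∈ A}.encard : ℝ≥0∞) := by
  rw [pointMeasure, Measure.sum_apply _ hA, ← ENNReal.tsum_set_one,
    tsum_subtype {i | x i ∈ A} (fun _ => (1 : ℝ≥0∞))]
  refine tsum_congr fun i => ?_
  rw [Measure.dirac_apply' _ hA]
  rfl

lemma pointMeasure_eq_pointCount {Ω : Type*} (X : ℕ → Ω → Plane) (ω : Ω) {A : Set Plane}
    (hA : MeasurableSet A) :
    pointMeasure (fun i => X i ω) A = (pointCount X A ω : ℝ≥0∞) :=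
  pointMeasure_apply _ hA

lemma measurable_pointMeasure : Measurable pointMeasure := by
  refine Measure.measurable_of_measurable_coe _ fun A hA => ?_
  simp only [pointMeasure, Measure.sum_apply _ hA, Measure.dirac_apply' _ hA]
  exact Measurable.tsum fun i =>
    (measurable_const.indicator hA).comp (measurable_pi_apply i)

/-! ### Size-biasing of Poisson counts. -/

section

variable {Ω : Type*} [MeasurableSpace Ω] {P : Measure Ω} {lamp : ℝ} {X : ℕ → Ω → Plane}

namespace IsPoissonProcess

lemma measurable_pointMeasure (hX : IsPoissonProcess P lamp X) :
    Measurable fun ω => pointMeasure fun i => X i ω :=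
  _root_.measurable_pointMeasure.comp (measurable_pi_lambda _ hX.measurable)

lemma measurable_pointCount (hX : IsPoissonProcess P lamp X) {A : Set Plane}
    (hA : MeasurableSet A) : Measurable (pointCount X A) := by
  have h : Measurable fun ω => pointMeasure (fun i => X i ω) A :=
    (Measure.measurable_coe hA).comp hX.measurable_pointMeasure
  refine measurable_to_countable' fun n => ?_
  have : pointCount X A ⁻¹' {n}
      = (fun ω => pointMeasure (fun i => X i ω) A) ⁻¹' {(n : ℝ≥0∞)} := by
    ext ω
    simp [pointMeasure_eq_pointCount X ω hA]
  rw [this]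
  exact h (measurableSet_singleton _)

/-- The Poisson masses of the finite values already sum to one, which leaves none for `⊤`. -/
lemma pointCount_ne_top [IsProbabilityMeasure P] (hX : IsPoissonProcess P lamp X) {A : Set Plane}
    (hA : MeasurableSet A) (hA' : volume A ≠ ∞) : ∀ᵐ ω ∂P, pointCount X A ω ≠ ⊤ := by
  have h1 : P (⋃ n : ℕ, {ω | pointCount X A ω = n}) = 1 := by
    rw [measure_iUnion]
    · rw [tsum_congr (hX.count_law A hA hA')]
      rw [← measure_iUnion (fun i j hij => Set.disjoint_singleton.2 hij)
        (fun n => measurableSet_singleton n), iUnion_of_singleton, measure_univ]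
    · intro i j hij
      refine Set.disjoint_left.2 fun ω hi hj => hij ?_
      have : ((i : ℕ) : ℕ∞) = j := hi.symm.trans hj
      exact_mod_cast this
    · exact fun n => hX.measurable_pointCount hA (MeasurableSet.singleton (n : ℕ∞))
  have h2 : ∀ᵐ ω ∂P, ω ∈ ⋃ n : ℕ, {ω | pointCount X A ω = n} := by
    have hm : MeasurableSet (⋃ n : ℕ, {ω | pointCount X A ω = n}) :=
      MeasurableSet.iUnion fun n =>
        hX.measurable_pointCount hA (MeasurableSet.singleton (n : ℕ∞))
    exact (prob_compl_eq_zero_iff hm).2 h1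
  filter_upwards [h2] with ω hω
  obtain ⟨n, hn⟩ := Set.mem_iUnion.1 hω
  rw [show pointCount X A ω = n from hn]
  exact ENat.natCast_ne_top n

/-- The recursion `k * p k = a * p (k - 1)` of the Poisson weights, written without subtraction:
biasing a Poisson variable by its size amounts to adding one. It is the Mecke formula for a single
set. -/
lemma mul_measure_pointCount_eq [IsProbabilityMeasure P] (hX : IsPoissonProcess P lamp X) (hl : 0 ≤ lamp)
    {A : Set Plane} (hA : MeasurableSet A) (hA' : volume A ≠ ∞) (k : ℕ∞) :
    (k : ℝ≥0∞) * P {ω | pointCount X A ω = k} =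
      ENNReal.ofReal lamp * volume A * P {ω | pointCount X A ω + 1 = k} := by
  have htop : P {ω | pointCount X A ω = ⊤} = 0 := by
    have := hX.pointCount_ne_top hA hA'
    simpa [ae_iff] using this
  induction k using ENat.recTopCoe with
  -- The value `⊤` is a null event, so both sides vanish.
  | top => simp [htop]
  | coe k =>
    cases k with
    | zero => simp
    | succ n =>
      have h2 : {ω | pointCount X A ω + 1 = ((n + 1 : ℕ) : ℕ∞)}
          = {ω | pointCount X A ω = (n : ℕ∞)} := by
        ext ω
        simp only [mem_ofPred_eq]
        push_cast
        induction pointCount X A ω using ENat.recTopCoe with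
        | top => exact iff_of_false (by simpa using (ENat.natCast_ne_top (n + 1)).symm) (by simp)
        | coe m => norm_cast; simp
      have ha : 0 ≤ lamp * volume.real A := by positivity
      rw [h2, hX.count_law A hA hA', hX.count_law A hA hA', poissonMeasure_singleton,
        poissonMeasure_singleton, Real.coe_toNNReal _ ha]
      have hv : volume A = ENNReal.ofReal (volume.real A) := by
        rw [measureReal_def, ENNReal.ofReal_toReal hA']
      rw [hv, ← ENNReal.ofReal_mul hl, ← ENNReal.ofReal_mul ha]
      have : (((n + 1 : ℕ) : ℕ∞) : ℝ≥0∞) = ENNReal.ofReal ((n : ℝ) + 1) := by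
        rw [ENat.toENNReal_coe, ← ENNReal.ofReal_natCast]; push_cast; rfl
      rw [this, ← ENNReal.ofReal_mul (by positivity)]
      congr 1
      rw [Nat.factorial_succ, pow_succ]
      push_cast
      field_simp

lemma measure_forall_pointCount_mem (hX : IsPoissonProcess P lamp X) {J : Type*} [Fintype J]
    (T : J → Set Plane) (hT : ∀ s, MeasurableSet (T s)) (hT' : ∀ s, volume (T s) ≠ ∞)
    (hd : Pairwise fun s s' => Disjoint (T s) (T s')) (S : J → Set ℕ∞) :
    P {ω | ∀ s, pointCount X (T s) ω ∈ S s} = ∏ s, P {ω | pointCount X (T s) ω ∈ S s} := by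
  let e := Fintype.equivFin J
  have h := (hX.count_indep (Fintype.card J) (fun k => T (e.symm k)) (fun k => hT _)
    (fun k => hT' _) (fun k k' hk => hd (fun hh => hk (e.symm.injective hh)))).precomp e.injective
  have := h.meas_iInter (s := fun s => {ω | pointCount X (T s) ω ∈ S s}) (fun s =>
    ⟨S s, trivial, by ext; simp⟩)
  rw [← this]
  congr 1
  ext ω
  simp

/-- By independence, biasing by the count of one cell `T a` leaves the other cells alone and adds
one point to `T a`. The joint law on `J → ℕ∞` is discrete, so it suffices to compare masses of
single vectors. -/
lemma lintegral_pointCount_mul [IsProbabilityMeasure P] (hX : IsPoissonProcess P lamp X) (hl : 0 ≤ lamp) {J : Type*}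
    [Fintype J] [DecidableEq J] (T : J → Set Plane) (hT : ∀ s, MeasurableSet (T s))
    (hT' : ∀ s, volume (T s) ≠ ∞) (hd : Pairwise fun s s' => Disjoint (T s) (T s')) (a : J)
    (g : (J → ℕ∞) → ℝ≥0∞) :
    ∫⁻ ω, (pointCount X (T a) ω : ℝ≥0∞) * g (fun s => pointCount X (T s) ω) ∂P =
      ENNReal.ofReal lamp * volume (T a) *
        ∫⁻ ω, g (fun s => pointCount X (T s) ω + if s = a then 1 else 0) ∂P := by
  have hg : Measurable g := measurable_of_countable g
  have hN : Measurable fun ω s => pointCount X (T s) ω :=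
    measurable_pi_lambda _ fun s => hX.measurable_pointCount (hT s)
  have hN1 : Measurable fun ω s => pointCount X (T s) ω + if s = a then 1 else 0 :=
    measurable_pi_lambda _ fun s =>
      (measurable_of_countable (fun n : ℕ∞ => n + if s = a then 1 else 0)).comp
        (hX.measurable_pointCount (hT s))
  have hD : Measurable fun ω => (pointCount X (T a) ω : ℝ≥0∞) :=
    (measurable_of_countable (fun n : ℕ∞ => (n : ℝ≥0∞))).comp (hX.measurable_pointCount (hT a))
  have key : (P.withDensity fun ω => (pointCount X (T a) ω : ℝ≥0∞)).map
        (fun ω s => pointCount X (T s) ω) =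
      (ENNReal.ofReal lamp * volume (T a)) •
        P.map (fun ω s => pointCount X (T s) ω + if s = a then 1 else 0) := by
    refine Measure.ext_of_singleton fun v => ?_
    rw [Measure.smul_apply, Measure.map_apply hN (measurableSet_singleton v),
      Measure.map_apply hN1 (measurableSet_singleton v),
      withDensity_apply _ (hN (measurableSet_singleton v))]
    have e1 : (fun ω s => pointCount X (T s) ω) ⁻¹' {v}
        = {ω | ∀ s, pointCount X (T s) ω ∈ ({v s} : Set ℕ∞)} := by
      ext ω; simp [funext_iff]
    have e2 : (fun ω s => pointCount X (T s) ω + if s = a then 1 else 0) ⁻¹' {v}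
        = {ω | ∀ s, pointCount X (T s) ω ∈ {k : ℕ∞ | k + (if s = a then 1 else 0) = v s}} := by
      ext ω; simp [funext_iff]
    have e3 : ∫⁻ ω in (fun ω s => pointCount X (T s) ω) ⁻¹' {v}, (pointCount X (T a) ω : ℝ≥0∞) ∂P
        = ∫⁻ ω in (fun ω s => pointCount X (T s) ω) ⁻¹' {v}, (v a : ℝ≥0∞) ∂P := by
      refine setLIntegral_congr_fun (hN (measurableSet_singleton v)) fun ω hω => ?_
      have : (fun s => pointCount X (T s) ω) = v := hω
      simp [← this]
    rw [e3, setLIntegral_const, e1, e2, hX.measure_forall_pointCount_mem T hT hT' hd,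
      hX.measure_forall_pointCount_mem T hT hT' hd, ← Finset.mul_prod_erase _ _ (Finset.mem_univ a),
      ← Finset.mul_prod_erase _ _ (Finset.mem_univ a), ← mul_assoc, smul_eq_mul, ← mul_assoc]
    congr 1
    · simpa using hX.mul_measure_pointCount_eq hl (hT a) (hT' a) (v a)
    · refine Finset.prod_congr rfl fun s hs => ?_
      simp [(Finset.mem_erase.1 hs).1]
  have := congrArg (fun m => ∫⁻ v, g v ∂m) key
  rwa [lintegral_map hg hN, lintegral_smul_measure, lintegral_map hg hN1,
    lintegral_withDensity_eq_lintegral_mul P hD (g := fun ω => g fun s => pointCount X (T s) ω)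
      (hg.comp hN), smul_eq_mul] at this

end IsPoissonProcess
end

/-! ### Mecke formula for events of configurations. -/

section

variable {Ω : Type*} [MeasurableSpace Ω] {P : Measure Ω} {lamp : ℝ} {X : ℕ → Ω → Plane}

namespace IsPoissonProcess

-- The sets `A k` may overlap, while the size-bias identity needs disjoint cells. The atoms of the
-- finite algebra generated by the `A k` are disjoint, and every count is a sum of counts of atoms.
open Classical in
lemma lintegral_pointMeasure_mul_finite_family [IsProbabilityMeasure P]
    (hX : IsPoissonProcess P lamp X) (hl : 0 ≤ lamp) {ι : Type*} [Fintype ι]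
    (A : ι → Set Plane) (hA : ∀ k, MeasurableSet (A k)) (hA' : ∀ k, volume (A k) ≠ ∞) (a : ι)
    (g : (ι → ℝ≥0∞) → ℝ≥0∞) :
    ∫⁻ ω, pointMeasure (fun i => X i ω) (A a) *
        g (fun k => pointMeasure (fun i => X i ω) (A k)) ∂P =
      ENNReal.ofReal lamp * ∫⁻ x in A a, ∫⁻ ω,
        g (fun k => (pointMeasure (fun i => X i ω) + Measure.dirac x) (A k)) ∂P := by
  -- The atom of the empty index set lies outside all `A k` and has infinite area; no `A k` needs
  -- it.
  let J := {s : Finset ι // s.Nonempty}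
  let T : J → Set Plane := fun s => {x | ∀ k, x ∈ A k ↔ k ∈ s.1}
  have hT : ∀ s, MeasurableSet (T s) := fun s => by
    have : T s = ⋂ k, {x | x ∈ A k ↔ k ∈ s.1} := by ext; simp [T]
    rw [this]
    refine MeasurableSet.iInter fun k => ?_
    by_cases hk : k ∈ s.1
    · simpa [hk] using hA k
    · simp only [hk, iff_false]
      exact (hA k).compl
  have hTA : ∀ (s : J) k, k ∈ s.1 → T s ⊆ A k := fun s k hk x hx => (hx k).2 hk
  have hT' : ∀ s, volume (T s) ≠ ∞ := fun s => by
    obtain ⟨k, hk⟩ := s.2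
    exact measure_ne_top_of_subset (hTA s k hk) (hA' k)
  have hd : Pairwise fun s s' => Disjoint (T s) (T s') := fun s s' hss' =>
    Set.disjoint_left.2 fun x hx hx' => hss' (Subtype.ext (Finset.ext fun k =>
      (hx k).symm.trans (hx' k)))
  have hAT : ∀ k, A k = ⋃ s ∈ Finset.univ.filter (fun s : J => k ∈ s.1), T s := fun k => by
    ext x
    simp only [Finset.mem_filter, Finset.mem_univ, true_and, mem_iUnion]
    refine ⟨fun hx => ⟨⟨Finset.univ.filter fun j => x ∈ A j, ⟨k, by simpa using hx⟩⟩, by simpa using hx, fun j => by simp⟩, ?_⟩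
    rintro ⟨s, hs, hx⟩
    exact hTA s k hs hx
  have hdk : ∀ k, (↑(Finset.univ.filter (fun s : J => k ∈ s.1)) : Set J).PairwiseDisjoint T :=
    fun k s _ s' _ h => hd h
  have hNA : ∀ (μ : Measure Plane) k, μ (A k) = ∑ s : J, if k ∈ s.1 then μ (T s) else 0 :=
    fun μ k => by
      rw [hAT k, measure_biUnion_finset (hdk k) (fun s _ => hT s), Finset.sum_filter]
  let g' : (J → ℕ∞) → ℝ≥0∞ := fun v => g fun k => ∑ s : J, if k ∈ s.1 then (v s : ℝ≥0∞) else 0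
  have hg' : ∀ ω, g (fun k => pointMeasure (fun i => X i ω) (A k))
      = g' (fun s => pointCount X (T s) ω) := fun ω => by
    simp only [g']
    congr 1
    funext k
    rw [hNA]
    simp only [pointMeasure_eq_pointCount X ω (hT _)]
  have hmeas : ∀ s, Measurable fun ω =>
      (pointCount X (T s) ω : ℝ≥0∞) * g' (fun s => pointCount X (T s) ω) := fun s =>
    (measurable_of_countable fun v : J → ℕ∞ => (v s : ℝ≥0∞) * g' v).comp
      (measurable_pi_lambda _ fun s => hX.measurable_pointCount (hT s))
  calc _ = ∫⁻ ω, ∑ s ∈ Finset.univ.filter (fun s : J => a ∈ s.1),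
        (pointCount X (T s) ω : ℝ≥0∞) * g' (fun s => pointCount X (T s) ω) ∂P := by
        refine lintegral_congr fun ω => ?_
        rw [hg', hNA, ← Finset.sum_filter, Finset.sum_mul]
        simp only [pointMeasure_eq_pointCount X ω (hT _)]
    _ = ∑ s ∈ Finset.univ.filter (fun s : J => a ∈ s.1), ENNReal.ofReal lamp * volume (T s) *
          ∫⁻ ω, g' (fun s' => pointCount X (T s') ω + if s' = s then 1 else 0) ∂P := by
        rw [lintegral_finsetSum _ fun s _ => hmeas s]
        exact Finset.sum_congr rfl fun s _ => hX.lintegral_pointCount_mul hl T hT hT' hd s g'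
    _ = _ := by
        rw [hAT a, lintegral_biUnion_finset (hdk a) (fun s _ => hT s), Finset.mul_sum]
        refine Finset.sum_congr rfl fun s _ => ?_
        rw [mul_assoc, mul_comm (volume (T s)), ← setLIntegral_const]
        congr 1
        refine setLIntegral_congr_fun (hT s) fun x hx => ?_
        refine lintegral_congr fun ω => ?_
        simp only [g']
        congr 1
        funext k
        -- A point added in the atom of `s` raises the counts of exactly those `A k` with `k ∈ s`.
        have hdx : Measure.dirac x (A k) = if k ∈ s.1 then 1 else 0 := by
          rw [Measure.dirac_apply' _ (hA k)]
          simp [Set.indicator, hx k]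
        rw [Measure.add_apply, hdx, hNA]
        simp only [pointMeasure_eq_pointCount X ω (hT _)]
        have : ∀ s' : J, (if k ∈ s'.1 then
            ((pointCount X (T s') ω + if s' = s then 1 else 0 : ℕ∞) : ℝ≥0∞) else 0)
            = (if k ∈ s'.1 then (pointCount X (T s') ω : ℝ≥0∞) else 0) +
              if s' = s then (if k ∈ s.1 then 1 else 0) else 0 := fun s' => by
          by_cases h : s' = s
          · subst h; by_cases h2 : k ∈ s'.1 <;> simp [h2]
          · simp [h]
        simp only [this, Finset.sum_add_distrib]
        congr 1
        rw [Finset.sum_eq_single s (fun b _ h => if_neg h) (by simp), if_pos rfl]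

end IsPoissonProcess

/-- The σ-algebra on measures on the plane is generated by evaluations at sets of finite area. -/
lemma measurableSpace_measure_eq_iSup :
    (Measure.instMeasurableSpace : MeasurableSpace (Measure Plane)) =
      ⨆ A : {A : Set Plane // MeasurableSet A ∧ volume A ≠ ∞},
        (borel ℝ≥0∞).comap fun μ => μ A.1 := by
  refine le_antisymm ?_ ?_
  · refine iSup₂_le fun A hA => ?_
    rw [← measurable_iff_comap_le]
    have h : ∀ μ : Measure Plane, μ A = ⨆ n, μ (A ∩ spanningSets volume n) := fun μ => by
      rw [← Monotone.measure_iUnion, ← inter_iUnion, iUnion_spanningSets, inter_univ]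
      exact fun m n hmn => inter_subset_inter_right _ (monotone_spanningSets _ hmn)
    simp only [h]
    refine Measurable.iSup fun n => ?_
    rw [measurable_iff_comap_le]
    exact le_iSup_of_le (ι := {A : Set Plane // MeasurableSet A ∧ volume A ≠ ∞})
      ⟨A ∩ spanningSets volume n, hA.inter (measurableSet_spanningSets _ n),
        measure_ne_top_of_subset inter_subset_right (measure_spanningSets_lt_top _ n).ne⟩
      le_rfl
  · refine iSup_le fun A => ?_
    exact le_iSup₂_of_le A.1 A.2.1 le_rfl

lemma measurable_add_dirac :
    Measurable fun p : Plane × Measure Plane => p.2 + Measure.dirac p.1 := by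
  refine Measure.measurable_of_measurable_coe _ fun A hA => ?_
  simp only [Measure.add_apply, Measure.dirac_apply' _ hA]
  exact ((Measure.measurable_coe hA).comp measurable_snd).add
    ((measurable_const.indicator hA).comp measurable_fst)

namespace IsPoissonProcess

/-- As functions of `E`, both sides are measures, finite because `A` has finite area. The preceding
identity makes them agree on cylinder events depending on finitely many counts, a π-system
generating the σ-algebra. -/
lemma lintegral_pointMeasure_mul_indicator [IsProbabilityMeasure P]
    (hX : IsPoissonProcess P lamp X) (hl : 0 ≤ lamp) {A : Set Plane} (hA : MeasurableSet A)
    (hA' : volume A ≠ ∞) {E : Set (Measure Plane)} (hE : MeasurableSet E) :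
    ∫⁻ ω, pointMeasure (fun i => X i ω) A * E.indicator 1 (pointMeasure fun i => X i ω) ∂P =
      ENNReal.ofReal lamp * ∫⁻ x in A, ∫⁻ ω,
        E.indicator 1 (pointMeasure (fun i => X i ω) + Measure.dirac x) ∂P := by
  have hN := hX.measurable_pointMeasure
  have hNA : Measurable fun ω => pointMeasure (fun i => X i ω) A :=
    (Measure.measurable_coe hA).comp hN
  have hadd : Measurable fun p : Plane × Ω =>
      pointMeasure (fun i => X i p.2) + Measure.dirac p.1 :=
    measurable_add_dirac.comp (measurable_fst.prodMk (hN.comp measurable_snd))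
  let m1 : Measure (Measure Plane) :=
    (P.withDensity fun ω => pointMeasure (fun i => X i ω) A).map
      (fun ω => pointMeasure fun i => X i ω)
  let m2 : Measure (Measure Plane) := ENNReal.ofReal lamp •
    ((volume.restrict A).prod P).map
      (fun p => pointMeasure (fun i => X i p.2) + Measure.dirac p.1)
  have h1 : ∀ E, MeasurableSet E → m1 E = ∫⁻ ω, pointMeasure (fun i => X i ω) A *
      E.indicator 1 (pointMeasure fun i => X i ω) ∂P := fun E hE => by
    rw [Measure.map_apply hN hE, withDensity_apply _ (hN hE), ← lintegral_indicator (hN hE)]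
    refine lintegral_congr fun ω => ?_
    by_cases h : (pointMeasure fun i => X i ω) ∈ E <;> simp [Set.indicator, h]
  have h2 : ∀ E, MeasurableSet E → m2 E = ENNReal.ofReal lamp * ∫⁻ x in A, ∫⁻ ω,
      E.indicator 1 (pointMeasure (fun i => X i ω) + Measure.dirac x) ∂P := fun E hE => by
    rw [Measure.smul_apply, smul_eq_mul, Measure.map_apply hadd hE,
      Measure.prod_apply (hadd hE)]
    congr 1
    refine lintegral_congr fun x => ?_
    rw [← lintegral_indicator_one (measurable_prodMk_left (hadd hE))]
    rfl
  rw [← h1 E hE, ← h2 E hE]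
  let π : {A : Set Plane // MeasurableSet A ∧ volume A ≠ ∞} → Set (Set (Measure Plane)) :=
    fun A => {t | MeasurableSet[(borel ℝ≥0∞).comap fun μ : Measure Plane => μ A.1] t}
  have hgen : (Measure.instMeasurableSpace : MeasurableSpace (Measure Plane)) =
      MeasurableSpace.generateFrom (piiUnionInter π univ) := by
    rw [measurableSpace_measure_eq_iSup]
    refine Eq.trans ?_ (generateFrom_piiUnionInter_measurableSet
      (fun A : {A : Set Plane // MeasurableSet A ∧ volume A ≠ ∞} =>
        (borel ℝ≥0∞).comap fun μ : Measure Plane => μ A.1) univ).symm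
    simp
  have hpi : IsPiSystem (piiUnionInter π univ) :=
    isPiSystem_piiUnionInter _ (fun A : {A : Set Plane // MeasurableSet A ∧ volume A ≠ ∞} => @MeasurableSpace.isPiSystem_measurableSet _
      ((borel ℝ≥0∞).comap fun μ : Measure Plane => μ A.1)) _
  have hC : ∀ E ∈ piiUnionInter π univ, m1 E = m2 E := by
    rintro E hE
    have hEm : MeasurableSet E := by
      rw [hgen]; exact MeasurableSpace.measurableSet_generateFrom hE
    obtain ⟨t, -, f, hf, rfl⟩ := hE
    rw [h1 _ hEm, h2 _ hEm]
    have hS : ∀ B : {B // B ∈ t}, ∃ S : Set ℝ≥0∞, (fun μ : Measure Plane => μ B.1.1) ⁻¹' S = f B.1 :=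
      fun B => by
        obtain ⟨S, -, hS⟩ := hf B.1 B.2
        exact ⟨S, hS⟩
    choose S hS using hS
    -- The index `none` carries the biasing set `A`; the indices `some B` carry the counts that
    -- define the cylinder.
    have := hX.lintegral_pointMeasure_mul_finite_family hl
      (fun k : Option {B // B ∈ t} => k.elim A fun B => B.1.1)
      (by rintro (_ | B); exacts [hA, B.1.2.1])
      (by rintro (_ | B); exacts [hA', B.1.2.2]) none
      (fun v => ∏ B : {B // B ∈ t}, (S B).indicator 1 (v (some B)))
    have hind : ∀ μ : Measure Plane, (⋂ B ∈ t, f B).indicator (1 : Measure Plane → ℝ≥0∞) μ =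
        ∏ B : {B // B ∈ t}, (S B).indicator 1 (μ B.1.1) := fun μ => by
      by_cases h : ∀ B : {B // B ∈ t}, μ B.1.1 ∈ S B
      · have h' : μ ∈ ⋂ B ∈ t, f B := mem_iInter₂.2 fun B hB => by
          rw [← hS ⟨B, hB⟩]; exact h ⟨B, hB⟩
        simp [Set.indicator, h, h']
      · have h' : μ ∉ ⋂ B ∈ t, f B := fun hh => h fun B => by
          have := mem_iInter₂.1 hh B.1 B.2
          rwa [← hS B] at this
        push Not at h
        obtain ⟨B, hB⟩ := h
        rw [Set.indicator_of_notMem h', Finset.prod_eq_zero (Finset.mem_univ B)]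
        simp [hB]
    simpa only [hind, Option.elim] using this
  have huniv : m1 univ = m2 univ := hC _ ⟨∅, by simp, fun _ => univ, by simp, by simp⟩
  have hfin : m2 univ ≠ ∞ := by
    rw [h2 _ MeasurableSet.univ]
    simpa using ENNReal.mul_ne_top ENNReal.ofReal_ne_top hA'
  have : IsFiniteMeasure m1 := ⟨by rw [huniv]; exact hfin.lt_top⟩
  rw [ext_of_generate_finite _ hgen hpi hC huniv]

end IsPoissonProcess
end

/-! ### Mecke formulas of first and second order. -/

section

variable {Ω : Type*} [MeasurableSpace Ω] {P : Measure Ω} {lamp : ℝ} {X : ℕ → Ω → Plane}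

/-- The Mecke formula for Poisson processes. -/
theorem IsPoissonProcess.mecke [IsProbabilityMeasure P] (hX : IsPoissonProcess P lamp X)
    (hl : 0 ≤ lamp) {F : Plane → Measure Plane → ℝ≥0∞} (hF : Measurable (Function.uncurry F)) :
    ∫⁻ ω, ∑' i, F (X i ω) (pointMeasure fun i => X i ω) ∂P =
      ENNReal.ofReal lamp * ∫⁻ x, ∫⁻ ω,
        F x (pointMeasure (fun i => X i ω) + Measure.dirac x) ∂P := by
  have hN := hX.measurable_pointMeasure
  have hXN : ∀ i, Measurable fun ω => (X i ω, pointMeasure fun i => X i ω) := fun i =>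
    (hX.measurable i).prodMk hN
  have hadd : Measurable fun p : Plane × Ω =>
      (p.1, pointMeasure (fun i => X i p.2) + Measure.dirac p.1) :=
    measurable_fst.prodMk
      (measurable_add_dirac.comp (measurable_fst.prodMk (hN.comp measurable_snd)))
  -- The two sides are integrals of `F` against two measures on pairs (point, configuration); the
  -- first is the Campbell measure. It is enough to compare them on rectangles.
  let m1 : Measure (Plane × Measure Plane) :=
    Measure.sum fun i => P.map fun ω => (X i ω, pointMeasure fun i => X i ω)
  let m2 : Measure (Plane × Measure Plane) := ENNReal.ofReal lamp •
    ((volume : Measure Plane).prod P).map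
      fun p => (p.1, pointMeasure (fun i => X i p.2) + Measure.dirac p.1)
  have h1 : ∀ F : Plane × Measure Plane → ℝ≥0∞, Measurable F → ∫⁻ q, F q ∂m1 =
      ∫⁻ ω, ∑' i, F (X i ω, pointMeasure fun i => X i ω) ∂P := fun F hF => by
    rw [lintegral_sum_measure,
      lintegral_tsum (f := fun i ω => F (X i ω, pointMeasure fun i => X i ω))
        fun i => (hF.comp (hXN i)).aemeasurable]
    exact tsum_congr fun i => lintegral_map hF (hXN i)
  have h2 : ∀ F : Plane × Measure Plane → ℝ≥0∞, Measurable F → ∫⁻ q, F q ∂m2 =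
      ENNReal.ofReal lamp * ∫⁻ x, ∫⁻ ω,
        F (x, pointMeasure (fun i => X i ω) + Measure.dirac x) ∂P := fun F hF => by
    rw [lintegral_smul_measure, lintegral_map hF hadd, smul_eq_mul,
      lintegral_prod (fun p => F (p.1, pointMeasure (fun i => X i p.2) + Measure.dirac p.1))
        (hF.comp hadd).aemeasurable]
  have hrect : ∀ (A : Set Plane) (E : Set (Measure Plane)), MeasurableSet A → volume A ≠ ∞ →
      MeasurableSet E → m1 (A ×ˢ E) = m2 (A ×ˢ E) := fun A E hA hA' hE => by
    have hAE : MeasurableSet (A ×ˢ E) := hA.prod hE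
    rw [← lintegral_indicator_one hAE, ← lintegral_indicator_one hAE,
      h1 _ (measurable_one.indicator hAE), h2 _ (measurable_one.indicator hAE)]
    have hi : ∀ x μ, (A ×ˢ E).indicator (1 : Plane × Measure Plane → ℝ≥0∞) (x, μ)
        = A.indicator 1 x * E.indicator 1 μ := fun x μ => by
      by_cases hx : x ∈ A <;> by_cases hμ : μ ∈ E <;> simp [Set.indicator, hx, hμ]
    simp only [hi]
    have := hX.lintegral_pointMeasure_mul_indicator hl hA hA' hE
    have e1 : ∀ ω, ∑' i, A.indicator 1 (X i ω) * E.indicator 1 (pointMeasure fun i => X i ω)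
        = pointMeasure (fun i => X i ω) A * E.indicator (1 : Measure Plane → ℝ≥0∞)
            (pointMeasure fun i => X i ω) := fun ω => by
      rw [ENNReal.tsum_mul_right, ← lintegral_pointMeasure _ (measurable_one.indicator hA),
        lintegral_indicator_one hA]
    simp only [e1, this]
    rw [← lintegral_indicator hA]
    congr 1
    refine lintegral_congr fun x => ?_
    by_cases hx : x ∈ A <;> simp [hx]
  -- The generating π-system also contains rectangles over sets of infinite area; these are reached
  -- by exhaustion.
  have hrect' : ∀ (A : Set Plane) (E : Set (Measure Plane)), MeasurableSet A →
      MeasurableSet E → m1 (A ×ˢ E) = m2 (A ×ˢ E) := fun A E hA hE => by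
    have hU : A ×ˢ E = ⋃ n, (A ∩ spanningSets volume n) ×ˢ E := by
      rw [← iUnion_prod_const, ← inter_iUnion, iUnion_spanningSets, inter_univ]
    have hmono : Monotone fun n => (A ∩ spanningSets (volume : Measure Plane) n) ×ˢ E :=
      fun m n hmn => prod_mono (inter_subset_inter_right _ (monotone_spanningSets _ hmn)) le_rfl
    rw [hU, hmono.measure_iUnion, hmono.measure_iUnion]
    exact iSup_congr fun n => hrect _ _ (hA.inter (measurableSet_spanningSets _ n))
      (measure_ne_top_of_subset inter_subset_right (measure_spanningSets_lt_top _ n).ne) hE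
  have hm : m1 = m2 := by
    refine Measure.ext_of_generateFrom_of_iUnion _
      (fun n => spanningSets (volume : Measure Plane) n ×ˢ (univ : Set (Measure Plane)))
      generateFrom_prod.symm isPiSystem_prod ?_ (fun n => ?_) (fun n => ?_) ?_
    · rw [← iUnion_prod_const, iUnion_spanningSets, univ_prod_univ]
    · exact ⟨_, by simpa using measurableSet_spanningSets (volume : Measure Plane) n, univ,
        by simp, rfl⟩
    · have hS := measurableSet_spanningSets (volume : Measure Plane) n
      rw [hrect' _ _ hS MeasurableSet.univ,
        ← lintegral_indicator_one (hS.prod MeasurableSet.univ),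
        h2 _ (measurable_one.indicator (hS.prod MeasurableSet.univ))]
      refine ENNReal.mul_ne_top ENNReal.ofReal_ne_top ?_
      have : ∀ x, ∫⁻ ω, (spanningSets (volume : Measure Plane) n ×ˢ
          (univ : Set (Measure Plane))).indicator 1
            (x, pointMeasure (fun i => X i ω) + Measure.dirac x) ∂P
          = (spanningSets (volume : Measure Plane) n).indicator 1 x := fun x => by
        by_cases hx : x ∈ spanningSets (volume : Measure Plane) n <;> simp [Set.indicator, hx]
      simp only [this]
      rw [lintegral_indicator_one hS]
      exact (measure_spanningSets_lt_top _ n).ne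
    · rintro _ ⟨A, hA, E, hE, rfl⟩
      exact hrect' A E hA hE
  have := h2 _ hF
  rw [← hm, h1 _ hF] at this
  exact this

/-! ### Locally finite measures with integer values -/

/-- The disjoint bounded cells on which the points of a configuration are counted. -/
noncomputable def cell (n : ℕ) : Set Plane := disjointed (spanningSets volume) n

lemma measurableSet_cell (n : ℕ) : MeasurableSet (cell n) :=
  MeasurableSet.disjointed (measurableSet_spanningSets _) n

lemma volume_cell_ne_top (n : ℕ) : volume (cell n) ≠ ∞ :=
  measure_ne_top_of_subset (disjointed_subset _ n) (measure_spanningSets_lt_top _ n).ne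

lemma iUnion_cell : ⋃ n, cell n = univ := by
  simp only [cell, iUnion_disjointed, iUnion_spanningSets]

lemma pairwise_disjoint_cell : Pairwise fun m n => Disjoint (cell m) (cell n) :=
  disjoint_disjointed _

/-- A configuration with finitely many points in each cell. -/
def IsConfiguration (μ : Measure Plane) : Prop := ∀ n, ∃ k : ℕ, μ (cell n) = k

lemma IsConfiguration.add_dirac {μ : Measure Plane} (hμ : IsConfiguration μ) (x : Plane) :
    IsConfiguration (μ + Measure.dirac x) := fun n => by
  obtain ⟨k, hk⟩ := hμ n
  rw [Measure.add_apply, hk, Measure.dirac_apply' _ (measurableSet_cell n)]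
  by_cases hx : x ∈ cell n
  · exact ⟨k + 1, by simp [hx]⟩
  · exact ⟨k, by simp [hx]⟩

open Classical in
/-- The measures on a cell with a given mass, as a finite kernel. -/
noncomputable def cellKernel (p : ℕ × ℕ) : Kernel (Measure Plane) Plane where
  toFun μ := if μ (cell p.1) = p.2 then μ.restrict (cell p.1) else 0
  measurable' := by
    refine Measurable.ite (Measure.measurable_coe (measurableSet_cell p.1)
      (measurableSet_singleton _)) ?_ measurable_const
    refine Measure.measurable_of_measurable_coe _ fun A hA => ?_
    simp only [Measure.restrict_apply hA]
    exact Measure.measurable_coe (hA.inter (measurableSet_cell p.1))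

lemma cellKernel_apply (p : ℕ × ℕ) (μ : Measure Plane) [Decidable (μ (cell p.1) = p.2)] :
    cellKernel p μ = if μ (cell p.1) = p.2 then μ.restrict (cell p.1) else 0 := by
  simp only [cellKernel, Kernel.coe_mk]
  congr

instance (p : ℕ × ℕ) : IsFiniteKernel (cellKernel p) :=
  ⟨⟨p.2, ENNReal.natCast_lt_top _, fun μ => by
    classical
    rw [cellKernel_apply]
    split_ifs with h
    · simp [h]
    · simp⟩⟩

/-- The s-finite kernel which takes a configuration to itself. -/
noncomputable def configurationKernel : Kernel (Measure Plane) Plane :=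
  Kernel.sum cellKernel

instance : IsSFiniteKernel configurationKernel :=
  inferInstanceAs (IsSFiniteKernel (Kernel.sum cellKernel))

/-- Measurability of `μ ↦ ∫ F y μ ∂μ` is available for s-finite kernels, and the identity on all
measures is not one. Cutting it down to measures with finite integer mass on each cell makes it
s-finite and changes nothing on configurations. -/
lemma IsConfiguration.kernel_apply {μ : Measure Plane} (hμ : IsConfiguration μ) :
    configurationKernel μ = μ := by
  classical
  ext A hA
  rw [configurationKernel, Kernel.sum_apply, Measure.sum_apply _ hA]
  rw [ENNReal.tsum_prod (f := fun m n => cellKernel (m, n) μ A)]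
  have h : ∀ m, ∑' n, cellKernel (m, n) μ A = μ (A ∩ cell m) := fun m => by
    obtain ⟨k, hk⟩ := hμ m
    rw [tsum_eq_single k]
    · rw [cellKernel_apply, if_pos hk, Measure.restrict_apply hA]
    · intro n hn
      rw [cellKernel_apply, if_neg]
      · simp
      · rw [hk]; exact_mod_cast hn.symm
  simp only [h]
  rw [← measure_iUnion, ← inter_iUnion, iUnion_cell, inter_univ]
  · exact fun i j hij => (pairwise_disjoint_cell hij).mono inter_subset_right inter_subset_right
  · exact fun i => hA.inter (measurableSet_cell i)

namespace IsPoissonProcess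

variable [IsProbabilityMeasure P]

lemma ae_isConfiguration (hX : IsPoissonProcess P lamp X) :
    ∀ᵐ ω ∂P, IsConfiguration (pointMeasure fun i => X i ω) := by
  have h : ∀ᵐ ω ∂P, ∀ n, pointCount X (cell n) ω ≠ ⊤ :=
    ae_all_iff.2 fun n => hX.pointCount_ne_top (measurableSet_cell n) (volume_cell_ne_top n)
  filter_upwards [h] with ω hω n
  obtain ⟨k, hk⟩ := ENat.ne_top_iff_exists.1 (hω n)
  exact ⟨k, by rw [pointMeasure_eq_pointCount X ω (measurableSet_cell n), ← hk]; rfl⟩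

/-- The second-order Mecke formula for Poisson processes. -/
theorem mecke_two (hX : IsPoissonProcess P lamp X) (hl : 0 ≤ lamp)
    {F : Plane → Plane → Measure Plane → ℝ≥0∞}
    (hF : Measurable fun p : Plane × Plane × Measure Plane => F p.1 p.2.1 p.2.2)
    (hF0 : ∀ x μ, F x x μ = 0) :
    ∫⁻ ω, ∑' i, ∑' j, F (X i ω) (X j ω) (pointMeasure fun i => X i ω) ∂P =
      ENNReal.ofReal lamp ^ 2 * ∫⁻ x, ∫⁻ y, ∫⁻ ω,
        F x y (pointMeasure (fun i => X i ω) + Measure.dirac x + Measure.dirac y) ∂P := by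
  -- The inner sum over the configuration becomes a kernel integral, so the first-order formula can
  -- be applied to it and then once more for each added point `x`.
  have hG : Measurable (Function.uncurry fun x μ => ∫⁻ y, F x y μ ∂configurationKernel μ) := by
    have := Measurable.lintegral_kernel_prod_right'
      (κ := configurationKernel.comap (Prod.snd : Plane × Measure Plane → _) measurable_snd)
      (f := fun q => F q.1.1 q.2 q.1.2)
      (hF.comp (measurable_fst.fst.prodMk (measurable_snd.prodMk measurable_fst.snd)))
    simpa [Function.uncurry_def, Kernel.comap_apply] using this
  have hFm : ∀ x μ, Measurable fun y => F x y μ := fun x μ =>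
    hF.comp (measurable_const.prodMk (measurable_id.prodMk measurable_const))
  have h1 := hX.mecke hl hG
  have e1 : ∫⁻ ω, ∑' i, ∫⁻ y, F (X i ω) y (pointMeasure fun i => X i ω)
        ∂configurationKernel (pointMeasure fun i => X i ω) ∂P
      = ∫⁻ ω, ∑' i, ∑' j, F (X i ω) (X j ω) (pointMeasure fun i => X i ω) ∂P := by
    refine lintegral_congr_ae ?_
    filter_upwards [hX.ae_isConfiguration] with ω hω
    refine tsum_congr fun i => ?_
    rw [hω.kernel_apply, lintegral_pointMeasure _ (hFm _ _)]
  have e2 : ∀ x, ∫⁻ ω, ∫⁻ y, F x y (pointMeasure (fun i => X i ω) + Measure.dirac x)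
        ∂configurationKernel (pointMeasure (fun i => X i ω) + Measure.dirac x) ∂P
      = ENNReal.ofReal lamp * ∫⁻ y, ∫⁻ ω,
        F x y (pointMeasure (fun i => X i ω) + Measure.dirac x + Measure.dirac y) ∂P := fun x => by
    have h2 := hX.mecke hl (F := fun y μ => F x y (μ + Measure.dirac x))
      (hF.comp (measurable_const.prodMk (measurable_fst.prodMk
        (measurable_add_dirac.comp (measurable_const.prodMk measurable_snd)))))
    refine Eq.trans (lintegral_congr_ae ?_) (h2.trans ?_)
    -- After the first application the inner integral also sees the added point `x` itself; this
    -- diagonal term is zero by `hF0`.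
    · filter_upwards [hX.ae_isConfiguration] with ω hω
      rw [(hω.add_dirac x).kernel_apply, lintegral_add_measure,
        lintegral_pointMeasure _ (hFm _ _), lintegral_dirac' _ (hFm _ _), hF0, add_zero]
    · simp only [add_assoc, add_comm (Measure.dirac x)]
  rw [← e1]
  refine h1.trans ?_
  simp only [e2]
  rw [lintegral_const_mul' _ _ ENNReal.ofReal_ne_top, ← mul_assoc, sq]

/-- The points of a Poisson process are almost surely distinct. -/
lemma ae_injective (hX : IsPoissonProcess P lamp X) (hl : 0 ≤ lamp) :
    ∀ᵐ ω ∂P, Function.Injective fun i => X i ω := by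
  have hs : MeasurableSet {q : (Plane × Measure Plane) × Plane | q.2 = q.1.1} :=
    measurableSet_eq_fun measurable_snd measurable_fst.fst
  have hK : Measurable fun q : Plane × Measure Plane => configurationKernel q.2 {q.1} := by
    have := Kernel.measurable_kernel_prodMk_left
      (κ := configurationKernel.comap (Prod.snd : Plane × Measure Plane → _) measurable_snd) hs
    simpa [Kernel.comap_apply] using this
  -- `φ` detects a multiplicity other than one. By the Mecke formula, the expected number of indices
  -- with such a multiplicity is an integral over added points `x`; the original process almost
  -- surely misses `x`, so the multiplicity there is one and the integral vanishes.
  obtain ⟨φ, hφ, hφ1, hφ2⟩ : ∃ φ : ℝ≥0∞ → ℝ≥0∞, Measurable φ ∧ φ 1 = 0 ∧ ∀ k, φ k = 0 → k = 1 :=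
    ⟨({1}ᶜ : Set ℝ≥0∞).indicator 1, measurable_one.indicator (measurableSet_singleton _).compl,
      by simp, fun k hk => by by_contra h; simp [h] at hk⟩
  have hm := hX.mecke hl (F := fun x μ => φ (configurationKernel μ {x})) (hφ.comp hK)
  have h0 : ∀ x, ∀ᵐ ω ∂P, pointMeasure (fun i => X i ω) {x} = 0 := fun x => by
    have h1 := hX.count_law {x} (measurableSet_singleton x) (by simp) 0
    have h2 : P {ω | pointCount X {x} ω = (0 : ℕ)} = 1 := by
      rw [h1, poissonMeasure_singleton]; simp [measureReal_def]
    have h3 : ∀ᵐ ω ∂P, pointCount X {x} ω = (0 : ℕ) :=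
      (prob_compl_eq_zero_iff (hX.measurable_pointCount (measurableSet_singleton x)
        (MeasurableSet.singleton _))).2 h2
    filter_upwards [h3] with ω hω
    rw [pointMeasure_eq_pointCount X ω (measurableSet_singleton x), hω]
    simp
  have hr : ∀ x, ∫⁻ ω, φ (configurationKernel
      (pointMeasure (fun i => X i ω) + Measure.dirac x) {x}) ∂P = 0 := fun x => by
    refine (lintegral_congr_ae ?_).trans lintegral_zero
    filter_upwards [hX.ae_isConfiguration, h0 x] with ω hω hω0
    rw [(hω.add_dirac x).kernel_apply, Measure.add_apply, hω0]
    simp [hφ1]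
  simp only [hr, lintegral_zero, mul_zero] at hm
  rw [lintegral_eq_zero_iff] at hm
  · filter_upwards [hX.ae_isConfiguration, hm] with ω hω hω'
    have h := ENNReal.tsum_eq_zero.1 hω'
    intro i j hij
    have hi : pointMeasure (fun i => X i ω) {X i ω} = 1 := by
      have := h i
      rw [hω.kernel_apply] at this
      exact hφ2 _ this
    rw [pointMeasure_apply _ (measurableSet_singleton _)] at hi
    have hi' : {j | X j ω ∈ ({X i ω} : Set Plane)}.encard = 1 := by exact_mod_cast hi
    obtain ⟨a, ha⟩ := Set.encard_eq_one.1 hi'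
    have h1 : i ∈ ({a} : Set ℕ) := by rw [← ha]; simp
    have h2 : j ∈ ({a} : Set ℕ) := by rw [← ha]; simpa using hij.symm
    exact h1.trans h2.symm
  · refine Measurable.tsum fun i => ?_
    have hXN := (hX.measurable i).prodMk hX.measurable_pointMeasure
    have h1 : Measurable fun ω => configurationKernel (pointMeasure fun k => X k ω) {X i ω} := by
      have h := hK.comp hXN
      simp only [Function.comp_def] at h
      exact h
    exact hφ.comp h1

end IsPoissonProcess
end

/-! ### Generating functions of Poisson counts. -/

section

variable {Ω : Type*} [MeasurableSpace Ω] {P : Measure Ω} {lamp : ℝ} {X : ℕ → Ω → Plane}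

/-- The exponential series sums the generating function. The exponent is real because later counts
appear as `toReal` of measure values. -/
lemma lintegral_rpow_poissonMeasure (r : ℝ≥0) {s : ℝ} (hs : s ≤ 1) :
    ∫⁻ n, ENNReal.ofReal (1 - s) ^ (n : ℝ) ∂poissonMeasure r =
      ENNReal.ofReal (Real.exp (-(s * r))) := by
  have h0 : 0 ≤ 1 - s := by linarith
  have hsum : HasSum (fun n : ℕ => Real.exp (-r) * ((((1 - s) * r) ^ n) / n.factorial))
      (Real.exp (-r) * Real.exp ((1 - s) * r)) := by
    refine HasSum.mul_left _ ?_
    have := NormedSpace.expSeries_div_hasSum_exp (𝔸 := ℝ) ((1 - s) * r)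
    rwa [← Real.exp_eq_exp_ℝ] at this
  rw [lintegral_countable']
  have : ∀ n : ℕ, ENNReal.ofReal (1 - s) ^ (n : ℝ) * poissonMeasure r {n} =
      ENNReal.ofReal (Real.exp (-r) * ((((1 - s) * r) ^ n) / n.factorial)) := fun n => by
    rw [poissonMeasure_singleton, ENNReal.rpow_natCast, ← ENNReal.ofReal_pow h0,
      ← ENNReal.ofReal_mul (by positivity)]
    congr 1
    rw [mul_pow]
    ring
  rw [tsum_congr this, ← ENNReal.ofReal_tsum_of_nonneg (fun n => by positivity) hsum.summable,
    hsum.tsum_eq, ← Real.exp_add]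
  congr 2
  ring

namespace IsPoissonProcess

variable [IsProbabilityMeasure P]

lemma lintegral_comp_pointCount (hX : IsPoissonProcess P lamp X) {A : Set Plane}
    (hA : MeasurableSet A) (hA' : volume A ≠ ∞) (f : ℕ∞ → ℝ≥0∞) :
    ∫⁻ ω, f (pointCount X A ω) ∂P =
      ∫⁻ n : ℕ, f n ∂poissonMeasure (Real.toNNReal (lamp * volume.real A)) := by
  have hm := hX.measurable_pointCount hA
  have hc : Measurable fun n : ℕ => (n : ℕ∞) := measurable_of_countable _
  have h : P.map (pointCount X A) =
      (poissonMeasure (Real.toNNReal (lamp * volume.real A))).map fun n : ℕ => (n : ℕ∞) := by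
    refine Measure.ext_of_singleton fun k => ?_
    rw [Measure.map_apply hm (measurableSet_singleton k),
      Measure.map_apply hc (measurableSet_singleton k)]
    induction k using ENat.recTopCoe with
    | top =>
      have h1 : P (pointCount X A ⁻¹' {⊤}) = 0 := by
        have := hX.pointCount_ne_top hA hA'
        rw [ae_iff] at this
        refine nonpos_iff_eq_zero.1 ((measure_mono fun ω hω => ?_).trans this.le)
        simpa using hω
      rw [h1]
      have : (fun n : ℕ => (n : ℕ∞)) ⁻¹' {⊤} = ∅ := by ext; simp
      rw [this, measure_empty]
    | coe n =>
      have : (fun n : ℕ => (n : ℕ∞)) ⁻¹' {(n : ℕ∞)} = {n} := by ext; simp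
      rw [this]
      exact hX.count_law A hA hA' n
  rw [← lintegral_map (measurable_of_countable f) hm, h,
    lintegral_map (measurable_of_countable f) hc]

/-- If each point of `A` independently meets its requirement with probability `1 - s`, this is the
probability that all do. -/
lemma lintegral_rpow_pointMeasure (hX : IsPoissonProcess P lamp X) (hl : 0 ≤ lamp)
    {A : Set Plane} (hA : MeasurableSet A) (hA' : volume A ≠ ∞) {s : ℝ} (hs : s ≤ 1) :
    ∫⁻ ω, ENNReal.ofReal (1 - s) ^ (pointMeasure (fun i => X i ω) A).toReal ∂P =
      ENNReal.ofReal (Real.exp (-lamp * (s * volume.real A))) := by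
  simp only [pointMeasure_eq_pointCount X _ hA]
  rw [hX.lintegral_comp_pointCount hA hA'
    fun n => ENNReal.ofReal (1 - s) ^ ((n : ℝ≥0∞)).toReal]
  simp only [ENat.toENNReal_coe, ENNReal.toReal_natCast]
  rw [lintegral_rpow_poissonMeasure _ hs, Real.coe_toNNReal _ (by positivity)]
  congr 2
  ring

lemma lintegral_prod_rpow_pointMeasure (hX : IsPoissonProcess P lamp X) (hl : 0 ≤ lamp)
    {n : ℕ} (T : Fin n → Set Plane) (hT : ∀ k, MeasurableSet (T k)) (hT' : ∀ k, volume (T k) ≠ ∞)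
    (hd : Pairwise fun k k' => Disjoint (T k) (T k')) {s : Fin n → ℝ} (hs : ∀ k, s k ≤ 1) :
    ∫⁻ ω, ∏ k, ENNReal.ofReal (1 - s k) ^ (pointMeasure (fun i => X i ω) (T k)).toReal ∂P =
      ENNReal.ofReal (Real.exp (-lamp * ∑ k, s k * volume.real (T k))) := by
  have hind : iIndepFun (fun k ω =>
      ENNReal.ofReal (1 - s k) ^ (pointMeasure (fun i => X i ω) (T k)).toReal) P := by
    have := (hX.count_indep n T hT hT' hd).comp
      (fun k (m : ℕ∞) => ENNReal.ofReal (1 - s k) ^ (m : ℝ≥0∞).toReal)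
      (fun k => measurable_of_countable _)
    simpa only [pointMeasure_eq_pointCount X _ (hT _), Function.comp_def] using this
  rw [lintegral_prod_eq_prod_lintegral_of_indepFun Finset.univ _ hind fun k => by
    have := (Measure.measurable_coe (hT k)).comp hX.measurable_pointMeasure
    exact measurable_const.pow this.ennreal_toReal]
  simp only [hX.lintegral_rpow_pointMeasure hl (hT _) (hT' _) (hs _)]
  rw [← ENNReal.ofReal_prod_of_nonneg fun _ _ => (Real.exp_pos _).le, ← Real.exp_sum,
    Finset.mul_sum]

end IsPoissonProcess
end

/-! ### Integrating out the time stamps of the other points. -/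

section

variable {Ω : Type*} [MeasurableSpace Ω] {P : Measure Ω}

lemma measure_lt_of_isUniform [IsProbabilityMeasure P] {Y : Ω → ℝ} (hY : Measurable Y)
    (hY' : pdf.IsUniform Y (Icc 0 1) P volume) {c : ℝ} (hc : 0 ≤ c) :
    P {ω | c < Y ω} = ENNReal.ofReal (1 - c) := by
  have h : P {ω | c < Y ω} = P.map Y (Ioi c) := (Measure.map_apply hY measurableSet_Ioi).symm
  rw [h, hY', cond_apply measurableSet_Icc]
  have : Icc 0 1 ∩ Ioi c = Ioc c 1 := by
    ext y; simp only [mem_inter_iff, mem_Icc, mem_Ioi, mem_Ioc]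
    constructor
    · rintro ⟨⟨_, h⟩, h'⟩; exact ⟨h', h⟩
    · rintro ⟨h, h'⟩; exact ⟨⟨by linarith, h'⟩, h⟩
  rw [this]
  simp

/-- Integrating out independent uniform time stamps which have to exceed given thresholds. -/
lemma lintegral_mul_prod_threshold [IsProbabilityMeasure P] {β : Type*} [MeasurableSpace β]
    {U : Ω → β} (hU : Measurable U) {m : ℕ → Ω → ℝ} (hm : ∀ k, Measurable (m k))
    (hm' : ∀ k, pdf.IsUniform (m k) (Icc 0 1) P volume) (hind : iIndepFun m P) (S : Finset ℕ)
    (hUS : IndepFun U (fun ω (k : S) => m k ω) P) {H : β → ℝ≥0∞} (hH : Measurable H)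
    {τ : β → ℕ → ℝ} (hτ : ∀ k, Measurable fun b => τ b k) (hτ0 : ∀ᵐ ω ∂P, ∀ k, 0 ≤ τ (U ω) k) :
    ∫⁻ ω, H (U ω) * (if ∀ k ∈ S, τ (U ω) k < m k ω then 1 else 0) ∂P =
      ∫⁻ ω, H (U ω) * ∏ k ∈ S, ENNReal.ofReal (1 - τ (U ω) k) ∂P := by
  have hmS : Measurable fun ω (k : S) => m k ω := measurable_pi_lambda _ fun k => hm k
  -- The event is written as a product of indicators, one per stamp, so that independence factorises
  -- the integral once `U` is frozen.
  let G : β × (S → ℝ) → ℝ≥0∞ := fun q => H q.1 * ∏ k : S, if τ q.1 k < q.2 k then 1 else 0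
  have hG : Measurable G := by
    refine (hH.comp measurable_fst).mul (Finset.measurable_prod _ fun k _ => ?_)
    refine Measurable.ite (measurableSet_lt ((hτ k).comp measurable_fst)
      ((measurable_pi_apply k).comp measurable_snd)) measurable_const measurable_const
  have h1 : ∀ ω, H (U ω) * (if ∀ k ∈ S, τ (U ω) k < m k ω then 1 else 0)
      = G (U ω, fun k => m k ω) := fun ω => by
    simp only [G]
    rw [Finset.prod_coe_sort S (fun k => if τ (U ω) k < m k ω then (1 : ℝ≥0∞) else 0),
      Finset.prod_ite_zero]
    simp
  simp only [h1]
  rw [← lintegral_map hG (hU.prodMk hmS),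
    (indepFun_iff_map_prod_eq_prod_map_map hU.aemeasurable hmS.aemeasurable).1 hUS]
  have : IsProbabilityMeasure (P.map U) := Measure.isProbabilityMeasure_map hU.aemeasurable
  have : IsProbabilityMeasure (P.map fun ω (k : S) => m k ω) :=
    Measure.isProbabilityMeasure_map hmS.aemeasurable
  rw [lintegral_prod _ hG.aemeasurable, lintegral_map hG.lintegral_prod_right' hU]
  refine lintegral_congr_ae (hτ0.mono fun ω hω => ?_)
  simp only
  rw [lintegral_map (f := fun y => G (U ω, y)) (hG.comp measurable_prodMk_left) hmS]
  simp only [G]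
  have hpm : ∀ k : ℕ, Measurable fun y : ℝ => if τ (U ω) k < y then (1 : ℝ≥0∞) else 0 := fun k =>
    Measurable.ite measurableSet_Ioi measurable_const measurable_const
  have e1 : ∀ ω', ∏ k : S, (if τ (U ω) k < m k ω' then (1 : ℝ≥0∞) else 0)
      = ∏ k ∈ S, if τ (U ω) k < m k ω' then (1 : ℝ≥0∞) else 0 := fun ω' =>
    Finset.prod_coe_sort S (fun k => if τ (U ω) k < m k ω' then (1 : ℝ≥0∞) else 0)
  simp only [e1]
  have hpm' : Measurable fun a => ∏ k ∈ S, if τ (U ω) k < m k a then (1 : ℝ≥0∞) else 0 :=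
    Finset.measurable_prod _ fun k _ => (hpm k).comp (hm k)
  rw [lintegral_const_mul _ hpm',
    lintegral_prod_eq_prod_lintegral_of_indepFun S
      (fun k ω' => if τ (U ω) k < m k ω' then (1 : ℝ≥0∞) else 0)
      (hind.comp (fun k y => if τ (U ω) k < y then (1 : ℝ≥0∞) else 0) hpm)
      (fun k => (hpm k).comp (hm k))]
  congr 1
  refine Finset.prod_congr rfl fun k _ => ?_
  rw [← measure_lt_of_isUniform (hm k) (hm' k) (hω k), ← lintegral_indicator_one
    (measurableSet_lt measurable_const (hm k))]
  rfl

end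

/-- Translates a product over indices into a function of the counting measure, the form required by
the Mecke formula. -/
lemma prod_ite_mem_eq_rpow (x : ℕ → Plane) {A : Set Plane} [∀ k, Decidable (x k ∈ A)]
    (hA : MeasurableSet A) (S : Finset ℕ)
    (hS : ∀ k, x k ∈ A → k ∈ S) (c : ℝ≥0∞) :
    ∏ k ∈ S, (if x k ∈ A then c else 1) = c ^ (pointMeasure x A).toReal := by
  have h : {k | x k ∈ A} = ↑(S.filter fun k => x k ∈ A) := by
    ext k
    simp only [mem_ofPred_eq, Finset.coe_filter]
    exact ⟨fun h => ⟨hS k h, h⟩, fun h => h.2⟩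
  rw [pointMeasure_apply x hA, h, Set.encard_coe_eq_coe_finsetCard, Finset.prod_ite]
  simp

/-! ### Measurability of the zones -/

section

variable {d Rcs Rtx : ℝ}

lemma continuous_receiver : Continuous fun q : Plane × ℝ => receiver d q.1 q.2 := by
  unfold receiver
  refine continuous_fst.add ((PiLp.continuous_toLp 2 _).comp (continuous_pi fun i => ?_))
  fin_cases i
  · exact continuous_const.mul (Real.continuous_cos.comp continuous_snd)
  · exact continuous_const.mul (Real.continuous_sin.comp continuous_snd)

lemma isClosed_exclusionZone (x : Plane) (θ : ℝ) : IsClosed (exclusionZone d Rcs Rtx x θ) :=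
  Metric.isClosed_closedBall.union Metric.isClosed_closedBall

lemma measurableSet_exclusionZone (x : Plane) (θ : ℝ) :
    MeasurableSet (exclusionZone d Rcs Rtx x θ) :=
  (isClosed_exclusionZone x θ).measurableSet

lemma measurableSet_mem_exclusionZone {γ : Type*} [MeasurableSpace γ] {x y : γ → Plane}
    {θ : γ → ℝ} (hx : Measurable x) (hθ : Measurable θ) (hy : Measurable y) :
    MeasurableSet {c | y c ∈ exclusionZone d Rcs Rtx (x c) (θ c)} := by
  have h1 : MeasurableSet {c | dist (y c) (x c) ≤ Rcs} :=
    measurableSet_le (hy.dist hx) measurable_const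
  have h2 : MeasurableSet {c | dist (y c) (receiver d (x c) (θ c)) ≤ Rtx} :=
    measurableSet_le (hy.dist (continuous_receiver.measurable.comp (hx.prodMk hθ)))
      measurable_const
  exact h1.union h2

lemma dist_receiver (hd : 0 ≤ d) (x : Plane) (θ : ℝ) : dist (receiver d x θ) x = d := by
  rw [receiver, dist_eq_norm, add_sub_cancel_left, EuclideanSpace.norm_eq]
  simp only [Fin.sum_univ_two, Real.norm_eq_abs, sq_abs]
  simp only [Matrix.cons_val_zero, Matrix.cons_val_one]
  rw [mul_pow, mul_pow, ← mul_add, Real.cos_sq_add_sin_sq, mul_one, Real.sqrt_sq hd]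

lemma exclusionZone_subset_closedBall (hd : 0 ≤ d) (hR : Rtx ≤ Rcs) (x : Plane) (θ : ℝ) :
    exclusionZone d Rcs Rtx x θ ⊆ Metric.closedBall x (Rcs + d) := by
  refine union_subset (Metric.closedBall_subset_closedBall (by linarith)) fun y hy => ?_
  have h1 : dist y (receiver d x θ) ≤ Rtx := hy
  have h2 := dist_triangle y (receiver d x θ) x
  rw [dist_receiver hd] at h2
  exact Metric.mem_closedBall.2 (by linarith)

lemma volume_exclusionZone_ne_top (hd : 0 ≤ d) (hR : Rtx ≤ Rcs) (x : Plane) (θ : ℝ) :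
    volume (exclusionZone d Rcs Rtx x θ) ≠ ∞ :=
  measure_ne_top_of_subset (exclusionZone_subset_closedBall hd hR x θ)
    Metric.isBounded_closedBall.measure_lt_top.ne

end

lemma measurable_pointMeasure_section {γ : Type*} [MeasurableSpace γ] (x : ℕ → γ → Plane)
    {A : γ → Set Plane} (hA : ∀ c, MeasurableSet (A c))
    (hA' : ∀ k, MeasurableSet {c | x k c ∈ A c}) :
    Measurable fun c => pointMeasure (fun k => x k c) (A c) := by
  have : ∀ c, pointMeasure (fun k => x k c) (A c)
      = ∑' k, {c | x k c ∈ A c}.indicator 1 c := fun c => by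
    rw [pointMeasure, Measure.sum_apply _ (hA c)]
    refine tsum_congr fun k => ?_
    rw [Measure.dirac_apply' _ (hA c)]
    rfl
  simp only [this]
  exact Measurable.tsum fun k => measurable_one.indicator (hA' k)

lemma measurable_configurationKernel_section {γ : Type*} [MeasurableSpace γ]
    {s : Set (γ × Plane)} (hs : MeasurableSet s) :
    Measurable fun q : γ × Measure Plane => configurationKernel q.2 {z | (q.1, z) ∈ s} := by
  have hs' : MeasurableSet {q : (γ × Measure Plane) × Plane | (q.1.1, q.2) ∈ s} :=
    (measurable_fst.fst.prodMk measurable_snd) hs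
  have := Kernel.measurable_kernel_prodMk_left
    (κ := configurationKernel.comap (Prod.snd : γ × Measure Plane → _) measurable_snd) hs'
  simpa [Kernel.comap_apply] using this

/-! ### Retention probabilities for fixed locations. -/

/-- The transmitter `i` of the configuration `x` with orientations `θ` and time stamps `m` is
retained. -/
def RetainedAt (d Rcs Rtx : ℝ) (x : ℕ → Plane) (θ m : ℕ → ℝ) (i : ℕ) : Prop :=
  ∀ j, j ≠ i → x j ∈ exclusionZone d Rcs Rtx (x i) (θ i) → m i < m j

/-- The partition of the union of two exclusion zones into the part of the first zone only, the
part of the second zone only, and the common part. -/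
def pairRegions (d Rcs Rtx : ℝ) (x : Plane) (θ : ℝ) (y : Plane) (θ' : ℝ) : Fin 3 → Set Plane :=
  ![exclusionZone d Rcs Rtx x θ \ exclusionZone d Rcs Rtx y θ',
    exclusionZone d Rcs Rtx y θ' \ exclusionZone d Rcs Rtx x θ,
    exclusionZone d Rcs Rtx x θ ∩ exclusionZone d Rcs Rtx y θ']

/-- The time which the time stamps of the points in each of the `pairRegions` have to exceed. -/
def pairLevels (s t : ℝ) : Fin 3 → ℝ := ![s, t, max s t]

/-- The time stamps `u.2`, `v.2` allow the transmitters at `x`, `y` with orientations `u.1`, `v.1`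
to be retained together. -/
def Compatible (d Rcs Rtx : ℝ) (x : Plane) (u : ℝ × ℝ) (y : Plane) (v : ℝ × ℝ) : Prop :=
  (y ∈ exclusionZone d Rcs Rtx x u.1 → u.2 < v.2) ∧
    (x ∈ exclusionZone d Rcs Rtx y v.1 → v.2 < u.2)

section

variable {d Rcs Rtx : ℝ}

lemma measurableSet_pairRegions (x : Plane) (θ : ℝ) (y : Plane) (θ' : ℝ) (k : Fin 3) :
    MeasurableSet (pairRegions d Rcs Rtx x θ y θ' k) := by
  have h1 := measurableSet_exclusionZone (d := d) (Rcs := Rcs) (Rtx := Rtx) x θ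
  have h2 := measurableSet_exclusionZone (d := d) (Rcs := Rcs) (Rtx := Rtx) y θ'
  fin_cases k
  · exact h1.diff h2
  · exact h2.diff h1
  · exact h1.inter h2

lemma pairRegions_subset (x : Plane) (θ : ℝ) (y : Plane) (θ' : ℝ) (k : Fin 3) :
    pairRegions d Rcs Rtx x θ y θ' k ⊆
      exclusionZone d Rcs Rtx x θ ∪ exclusionZone d Rcs Rtx y θ' := by
  fin_cases k
  · exact fun z hz => Or.inl hz.1
  · exact fun z hz => Or.inr hz.1
  · exact fun z hz => Or.inl hz.1

lemma measurableSet_compatible {γ : Type*} [MeasurableSpace γ] {x y : γ → Plane}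
    {u v : γ → ℝ × ℝ} (hx : Measurable x) (hu : Measurable u) (hy : Measurable y)
    (hv : Measurable v) :
    MeasurableSet {c | Compatible d Rcs Rtx (x c) (u c) (y c) (v c)} := by
  have h1 : MeasurableSet {c | y c ∈ exclusionZone d Rcs Rtx (x c) (u c).1} :=
    measurableSet_mem_exclusionZone hx hu.fst hy
  have h2 : MeasurableSet {c | x c ∈ exclusionZone d Rcs Rtx (y c) (v c).1} :=
    measurableSet_mem_exclusionZone hy hv.fst hx
  have h3 : MeasurableSet {c | (u c).2 < (v c).2} := measurableSet_lt hu.snd hv.snd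
  have h4 : MeasurableSet {c | (v c).2 < (u c).2} := measurableSet_lt hv.snd hu.snd
  have : {c | Compatible d Rcs Rtx (x c) (u c) (y c) (v c)} =
      ({c | y c ∈ exclusionZone d Rcs Rtx (x c) (u c).1}ᶜ ∪ {c | (u c).2 < (v c).2}) ∩
      ({c | x c ∈ exclusionZone d Rcs Rtx (y c) (v c).1}ᶜ ∪ {c | (v c).2 < (u c).2}) := by
    ext c
    simp only [Compatible, mem_ofPred_eq, mem_inter_iff, mem_union, mem_compl_iff, imp_iff_not_or]
  rw [this]
  exact (h1.compl.union h3).inter (h2.compl.union h4)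

variable {Ω : Type*} [MeasurableSpace Ω] {P : Measure Ω} {lamp : ℝ}
  {X : ℕ → Ω → Plane} {θ m : ℕ → Ω → ℝ}

namespace IsMarkedPoissonProcess

lemma iIndepFun_time (hX : IsMarkedPoissonProcess P lamp X θ m) : iIndepFun m P :=
  hX.indep_marks.comp (fun _ => Prod.snd) fun _ => measurable_snd

lemma ae_time_pos [IsProbabilityMeasure P] (hX : IsMarkedPoissonProcess P lamp X θ m) : ∀ᵐ ω ∂P, ∀ k, 0 < m k ω := by
  refine ae_all_iff.2 fun k => ?_
  have h := measure_lt_of_isUniform (hX.measurable_time k) (hX.time_law k) le_rfl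
  rw [sub_zero, ENNReal.ofReal_one] at h
  exact (prob_compl_eq_zero_iff (measurableSet_lt measurable_const (hX.measurable_time k))).2 h

-- Given the mark of `i`, the other stamps are independent and uniform, so each other point of the
-- zone permits retention with probability `1 - m i ω`. Local finiteness makes the product finite.
open Classical in
lemma lintegral_retainedAt [IsProbabilityMeasure P] (hX : IsMarkedPoissonProcess P lamp X θ m) (hd : 0 ≤ d)
    (hR : Rtx ≤ Rcs) {x : ℕ → Plane} (hx : Function.Injective x)
    (hfin : ∀ r, {k | x k ∈ Metric.closedBall (0 : Plane) r}.Finite) (i : ℕ) {f : ℝ → ℝ≥0∞}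
    (hf : Measurable f) :
    ∫⁻ ω, f (θ i ω) * (if RetainedAt d Rcs Rtx x (θ · ω) (m · ω) i then 1 else 0) ∂P =
      ∫⁻ ω, f (θ i ω) * ENNReal.ofReal (1 - m i ω) ^
        (pointMeasure x (exclusionZone d Rcs Rtx (x i) (θ i ω) \ {x i})).toReal ∂P := by
  have hfin' : {k | k ≠ i ∧ x k ∈ Metric.closedBall (x i) (Rcs + d)}.Finite := by
    refine (hfin (‖x i‖ + (Rcs + d))).subset fun k hk => ?_
    exact Metric.closedBall_subset_closedBall' (by rw [dist_zero_right]; linarith) hk.2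
  let S : Finset ℕ := hfin'.toFinset
  have hS : ∀ k, k ∈ S ↔ k ≠ i ∧ x k ∈ Metric.closedBall (x i) (Rcs + d) := fun k => by simp [S]
  -- Outside the zone the threshold is `0`, which a stamp exceeds almost surely. This allows the
  -- index set `S` not to depend on the orientation.
  let τ : ℝ × ℝ → ℕ → ℝ := fun b k => if x k ∈ exclusionZone d Rcs Rtx (x i) b.1 then b.2 else 0
  have hτ : ∀ k, Measurable fun b => τ b k := fun k =>
    Measurable.ite (measurableSet_mem_exclusionZone measurable_const measurable_fst
      measurable_const) measurable_snd measurable_const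
  have hUm := fun i => (hX.measurable_orientation i).prodMk (hX.measurable_time i)
  have hind : IndepFun (fun ω => (θ i ω, m i ω)) (fun ω (k : S) => m k ω) P := by
    have hφ : Measurable fun p : ({i} : Finset ℕ) → ℝ × ℝ => p ⟨i, by simp⟩ :=
      measurable_pi_apply _
    have hψ : Measurable fun (p : S → ℝ × ℝ) k => (p k).2 :=
      measurable_pi_lambda _ fun k => (measurable_pi_apply k).snd
    exact (hX.indep_marks.indepFun_finset {i} S (by simp [hS]) hUm).comp hφ hψ
  have h := lintegral_mul_prod_threshold (hUm i) hX.measurable_time hX.time_law hX.iIndepFun_time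
    S hind (hf.comp measurable_fst) hτ (by
      filter_upwards [hX.ae_time_pos] with ω hω k
      simp only [τ]
      split_ifs
      exacts [(hω i).le, le_rfl])
  refine Eq.trans (lintegral_congr_ae ?_) (h.trans (lintegral_congr fun ω => ?_))
  · filter_upwards [hX.ae_time_pos] with ω hω
    simp only [Function.comp_apply]
    congr 1
    refine if_congr ?_ rfl rfl
    refine ⟨fun hr k hk => ?_, fun hr j hj hz => ?_⟩
    · by_cases hz : x k ∈ exclusionZone d Rcs Rtx (x i) (θ i ω)
      · simpa only [τ, if_pos hz] using hr k ((hS k).1 hk).1 hz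
      · simpa only [τ, if_neg hz] using hω k
    · have := hr j ((hS j).2 ⟨hj, exclusionZone_subset_closedBall hd hR _ _ hz⟩)
      simpa only [τ, if_pos hz] using this
  · simp only [Function.comp_apply]
    congr 1
    rw [← prod_ite_mem_eq_rpow x
      ((measurableSet_exclusionZone _ _).diff (measurableSet_singleton _)) S fun k hk =>
        (hS k).2 ⟨fun h => hk.2 (by simp [h]), exclusionZone_subset_closedBall hd hR _ _ hk.1⟩]
    refine Finset.prod_congr rfl fun k hk => ?_
    have hki : x k ∉ ({x i} : Set Plane) := fun h => ((hS k).1 hk).1 (hx h)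
    simp only [τ, mem_sdiff, hki, not_false_eq_true, and_true]
    split_ifs <;> simp

-- `Compatible` records what the two points demand of each other. Every third point must beat the
-- stamp of each of the two whose zone contains it, hence a level depending only on its region.
open Classical in
lemma lintegral_retainedAt_pair [IsProbabilityMeasure P]
    (hX : IsMarkedPoissonProcess P lamp X θ m) (hd : 0 ≤ d)
    (hR : Rtx ≤ Rcs) {x : ℕ → Plane} (hx : Function.Injective x)
    (hfin : ∀ r, {k | x k ∈ Metric.closedBall (0 : Plane) r}.Finite) {i j : ℕ} (hij : i ≠ j)
    {f : ℝ → ℝ≥0∞} (hf : Measurable f) :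
    ∫⁻ ω, f (θ i ω) * (if RetainedAt d Rcs Rtx x (θ · ω) (m · ω) i ∧
        RetainedAt d Rcs Rtx x (θ · ω) (m · ω) j then 1 else 0) ∂P =
      ∫⁻ ω, f (θ i ω) *
        (if Compatible d Rcs Rtx (x i) (θ i ω, m i ω) (x j) (θ j ω, m j ω) then 1 else 0) *
        ∏ k, ENNReal.ofReal (1 - pairLevels (m i ω) (m j ω) k) ^
          (pointMeasure x (pairRegions d Rcs Rtx (x i) (θ i ω) (x j) (θ j ω) k \
            {x i, x j})).toReal ∂P := by
  have hfin' : {k | k ≠ i ∧ k ≠ j ∧ (x k ∈ Metric.closedBall (x i) (Rcs + d) ∨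
      x k ∈ Metric.closedBall (x j) (Rcs + d))}.Finite := by
    refine ((hfin (‖x i‖ + (Rcs + d))).union (hfin (‖x j‖ + (Rcs + d)))).subset fun k hk => ?_
    exact hk.2.2.imp
      (fun h => Metric.closedBall_subset_closedBall' (by rw [dist_zero_right]; linarith) h)
      (fun h => Metric.closedBall_subset_closedBall' (by rw [dist_zero_right]; linarith) h)
  let S : Finset ℕ := hfin'.toFinset
  have hS : ∀ k, k ∈ S ↔ k ≠ i ∧ k ≠ j ∧ (x k ∈ Metric.closedBall (x i) (Rcs + d) ∨
      x k ∈ Metric.closedBall (x j) (Rcs + d)) := fun k => by simp [S]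
  let Z : Plane → ℝ → Set Plane := exclusionZone d Rcs Rtx
  have hZ : ∀ y θ, Z y θ ⊆ Metric.closedBall y (Rcs + d) :=
    exclusionZone_subset_closedBall hd hR
  -- A point in both zones has to beat both stamps, hence the maximum; the default `0` is again
  -- harmless.
  let τ : (ℝ × ℝ) × (ℝ × ℝ) → ℕ → ℝ := fun b k =>
    max (if x k ∈ Z (x i) b.1.1 then b.1.2 else 0) (if x k ∈ Z (x j) b.2.1 then b.2.2 else 0)
  have hτ : ∀ k, Measurable fun b => τ b k := fun k =>
    (Measurable.ite (measurableSet_mem_exclusionZone measurable_const measurable_fst.fst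
      measurable_const) measurable_fst.snd measurable_const).max
    (Measurable.ite (measurableSet_mem_exclusionZone measurable_const measurable_snd.fst
      measurable_const) measurable_snd.snd measurable_const)
  have hUm := fun i => (hX.measurable_orientation i).prodMk (hX.measurable_time i)
  have hind : IndepFun (fun ω => ((θ i ω, m i ω), (θ j ω, m j ω))) (fun ω (k : S) => m k ω) P := by
    have hφ : Measurable fun p : ({i, j} : Finset ℕ) → ℝ × ℝ =>
        (p ⟨i, by simp⟩, p ⟨j, by simp⟩) :=
      (measurable_pi_apply _).prodMk (measurable_pi_apply _)
    have hψ : Measurable fun (p : S → ℝ × ℝ) k => (p k).2 :=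
      measurable_pi_lambda _ fun k => (measurable_pi_apply k).snd
    exact (hX.indep_marks.indepFun_finset {i, j} S (by simp [hS]) hUm).comp hφ hψ
  let H : (ℝ × ℝ) × (ℝ × ℝ) → ℝ≥0∞ := fun b =>
    f b.1.1 * if Compatible d Rcs Rtx (x i) b.1 (x j) b.2 then 1 else 0
  have hH : Measurable H := (hf.comp measurable_fst.fst).mul
    (Measurable.ite (measurableSet_compatible measurable_const measurable_fst measurable_const
      measurable_snd) measurable_const measurable_const)
  have h := lintegral_mul_prod_threshold ((hUm i).prodMk (hUm j)) hX.measurable_time hX.time_law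
    hX.iIndepFun_time S hind hH hτ (by
      filter_upwards [hX.ae_time_pos] with ω hω k
      refine le_max_of_le_left ?_
      split_ifs
      exacts [(hω i).le, le_rfl])
  refine Eq.trans (lintegral_congr_ae ?_) (h.trans (lintegral_congr_ae ?_))
  · filter_upwards [hX.ae_time_pos] with ω hω
    simp only [H]
    rw [mul_assoc]
    congr 1
    rw [ite_zero_mul_ite_zero, mul_one]
    refine if_congr ?_ rfl rfl
    constructor
    · rintro ⟨hi, hj⟩
      refine ⟨⟨fun hz => hi j hij.symm hz, fun hz => hj i hij hz⟩, fun k hk => ?_⟩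
      obtain ⟨hki, hkj, -⟩ := (hS k).1 hk
      refine max_lt ?_ ?_
      · split_ifs with hz
        exacts [hi k hki hz, hω k]
      · split_ifs with hz
        exacts [hj k hkj hz, hω k]
    · rintro ⟨⟨h1, h2⟩, h3⟩
      refine ⟨fun k hk hz => ?_, fun k hk hz => ?_⟩
      · by_cases hkj : k = j
        · subst hkj; exact h1 hz
        · have := (le_max_left _ _).trans_lt (h3 k ((hS k).2 ⟨hk, hkj, Or.inl (hZ _ _ hz)⟩))
          rwa [if_pos (show x k ∈ Z (x i) (θ i ω) from hz)] at this
      · by_cases hki : k = i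
        · subst hki; exact h2 hz
        · have := (le_max_right _ _).trans_lt (h3 k ((hS k).2 ⟨hki, hk, Or.inr (hZ _ _ hz)⟩))
          rwa [if_pos (show x k ∈ Z (x j) (θ j ω) from hz)] at this
  · filter_upwards [hX.ae_time_pos] with ω hω
    simp only [H]
    congr 1
    have hA : ∀ l, ENNReal.ofReal (1 - pairLevels (m i ω) (m j ω) l) ^
          (pointMeasure x (pairRegions d Rcs Rtx (x i) (θ i ω) (x j) (θ j ω) l \
            {x i, x j})).toReal =
        ∏ k ∈ S, if x k ∈ pairRegions d Rcs Rtx (x i) (θ i ω) (x j) (θ j ω) l \ {x i, x j}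
          then ENNReal.ofReal (1 - pairLevels (m i ω) (m j ω) l) else 1 := fun l => by
      refine (prod_ite_mem_eq_rpow x ((measurableSet_pairRegions _ _ _ _ l).diff
        ((measurableSet_singleton _).insert _)) S (fun k hk => (hS k).2 ⟨?_, ?_, ?_⟩) _).symm
      · rintro rfl; exact hk.2 (by simp)
      · rintro rfl; exact hk.2 (by simp)
      · exact (pairRegions_subset _ _ _ _ l hk.1).imp (fun h => hZ _ _ h) (fun h => hZ _ _ h)
    simp only [hA]
    rw [Finset.prod_comm]
    refine Finset.prod_congr rfl fun k hk => ?_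
    obtain ⟨hki, hkj, -⟩ := (hS k).1 hk
    have hkij : x k ∉ ({x i, x j} : Set Plane) := by
      rintro (h | h)
      exacts [hki (hx h), hkj (hx h)]
    have hi := (hω i).le
    have hj := (hω j).le
    simp only [τ, Z, Fin.prod_univ_three, pairRegions, pairLevels, mem_sdiff, hkij,
      not_false_eq_true, and_true, Matrix.cons_val_zero, Matrix.cons_val_one, Matrix.cons_val]
    by_cases h1 : x k ∈ exclusionZone d Rcs Rtx (x i) (θ i ω) <;>
      by_cases h2 : x k ∈ exclusionZone d Rcs Rtx (x j) (θ j ω) <;>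
      simp [h1, h2, hi, hj]

end IsMarkedPoissonProcess
end

/-! ### Averaging over the locations. -/

lemma tsum_lintegral_lintegral_swap {ι α β : Type*} [Countable ι] [MeasurableSpace α]
    [MeasurableSpace β] (μ : Measure α) (ν : Measure β) [SFinite μ] [SFinite ν]
    {K : ι → α → β → ℝ≥0∞} (hK : ∀ i, Measurable (Function.uncurry (K i))) :
    ∑' i, ∫⁻ a, ∫⁻ b, K i a b ∂ν ∂μ = ∫⁻ b, ∫⁻ a, ∑' i, K i a b ∂μ ∂ν := by
  have h : ∀ b, ∫⁻ a, ∑' i, K i a b ∂μ = ∑' i, ∫⁻ a, K i a b ∂μ := fun b =>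
    lintegral_tsum fun i => ((hK i).comp measurable_prodMk_right).aemeasurable
  simp only [h]
  rw [lintegral_tsum fun i => ((hK i).lintegral_prod_left' (f := fun p => K i p.1 p.2)).aemeasurable]
  exact tsum_congr fun i => lintegral_lintegral_swap (hK i).aemeasurable

/-- Fubini for independent variables: the locations can be frozen while the marks are integrated. -/
lemma ProbabilityTheory.IndepFun.lintegral_comp_eq {Ω α β : Type*} [MeasurableSpace Ω]
    [MeasurableSpace α] [MeasurableSpace β] {P : Measure Ω} [IsProbabilityMeasure P] {Y : Ω → α}
    {Z : Ω → β} (h : IndepFun Y Z P) (hY : Measurable Y) (hZ : Measurable Z)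
    {G : α → β → ℝ≥0∞} (hG : Measurable (Function.uncurry G)) :
    ∫⁻ ω, G (Y ω) (Z ω) ∂P = ∫⁻ ω, ∫⁻ ω', G (Y ω) (Z ω') ∂P ∂P := by
  have : IsProbabilityMeasure (P.map Y) := Measure.isProbabilityMeasure_map hY.aemeasurable
  have : IsProbabilityMeasure (P.map Z) := Measure.isProbabilityMeasure_map hZ.aemeasurable
  have h1 : ∫⁻ ω, G (Y ω) (Z ω) ∂P = ∫⁻ q, Function.uncurry G q ∂(P.map fun ω => (Y ω, Z ω)) :=
    (lintegral_map hG (hY.prodMk hZ)).symm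
  rw [h1, (indepFun_iff_map_prod_eq_prod_map_map hY.aemeasurable hZ.aemeasurable).1 h,
    lintegral_prod _ hG.aemeasurable, lintegral_map hG.lintegral_prod_right' hY]
  refine lintegral_congr fun ω => ?_
  exact lintegral_map (hG.comp measurable_prodMk_left) hZ

/-- The uniform distribution on `[0, 2π]`. -/
noncomputable def angleLaw : Measure ℝ :=
  ProbabilityTheory.cond volume (Icc 0 (2 * Real.pi))

instance : IsProbabilityMeasure angleLaw :=
  cond_isProbabilityMeasure_of_finite (by simp [Real.pi_pos])
    (by rw [Real.volume_Icc]; exact ENNReal.ofReal_ne_top)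

/-- The law of the mark of a transmitter: an orientation uniform on `[0, 2π]` and an independent
time stamp uniform on `[0, 1]`. -/
noncomputable def markLaw : Measure (ℝ × ℝ) :=
  angleLaw.prod (volume.restrict (Icc 0 1))

lemma cond_Icc_zero_one :
    ProbabilityTheory.cond volume (Icc (0 : ℝ) 1) = volume.restrict (Icc 0 1) := by
  simp [ProbabilityTheory.cond]

instance : IsProbabilityMeasure ((volume : Measure ℝ).restrict (Icc 0 1)) :=
  ⟨by simp⟩

instance : IsProbabilityMeasure markLaw :=
  inferInstanceAs (IsProbabilityMeasure (angleLaw.prod (volume.restrict (Icc 0 1))))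

lemma ae_markLaw_snd_le_one : ∀ᵐ u ∂markLaw, u.2 ≤ 1 := by
  have h : ∀ᵐ t ∂(volume : Measure ℝ).restrict (Icc 0 1), t ≤ 1 :=
    (ae_restrict_mem measurableSet_Icc).mono fun t ht => ht.2
  exact Measure.quasiMeasurePreserving_snd.ae h

section

variable {d Rcs Rtx : ℝ} {Ω : Type*} [MeasurableSpace Ω] {P : Measure Ω} {lamp : ℝ}
  {X : ℕ → Ω → Plane} {θ m : ℕ → Ω → ℝ}

lemma IsPoissonProcess.ae_finite_closedBall [IsProbabilityMeasure P]
    (hX : IsPoissonProcess P lamp X) :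
    ∀ᵐ ω ∂P, ∀ r, {k | X k ω ∈ Metric.closedBall (0 : Plane) r}.Finite := by
  have h : ∀ᵐ ω ∂P, ∀ n : ℕ, pointCount X (Metric.closedBall 0 n) ω ≠ ⊤ :=
    ae_all_iff.2 fun n => hX.pointCount_ne_top Metric.isClosed_closedBall.measurableSet
      Metric.isBounded_closedBall.measure_lt_top.ne
  filter_upwards [h] with ω hω r
  obtain ⟨n, hn⟩ := exists_nat_ge r
  exact (Set.encard_ne_top_iff.1 (hω n)).subset fun k hk =>
    Metric.closedBall_subset_closedBall hn hk

lemma measurableSet_retainedAt (i : ℕ) :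
    MeasurableSet {q : (ℕ → Plane) × (ℕ → ℝ × ℝ) |
      RetainedAt d Rcs Rtx q.1 (fun k => (q.2 k).1) (fun k => (q.2 k).2) i} := by
  have hx : ∀ k, Measurable fun q : (ℕ → Plane) × (ℕ → ℝ × ℝ) => q.1 k := fun k =>
    (measurable_pi_apply k).comp measurable_fst
  have hM : ∀ k, Measurable fun q : (ℕ → Plane) × (ℕ → ℝ × ℝ) => q.2 k := fun k =>
    (measurable_pi_apply k).comp measurable_snd
  have : {q : (ℕ → Plane) × (ℕ → ℝ × ℝ) |
      RetainedAt d Rcs Rtx q.1 (fun k => (q.2 k).1) (fun k => (q.2 k).2) i} =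
      ⋂ j ∈ {j | j ≠ i}, ({q | q.1 j ∈ exclusionZone d Rcs Rtx (q.1 i) (q.2 i).1}ᶜ ∪
        {q | (q.2 i).2 < (q.2 j).2}) := by
    ext q
    simp only [RetainedAt, mem_ofPred_eq, mem_iInter, mem_union, mem_compl_iff, imp_iff_not_or]
  rw [this]
  refine MeasurableSet.biInter (to_countable _) fun j _ => MeasurableSet.union ?_ ?_
  · exact (measurableSet_mem_exclusionZone (hx i) (hM i).fst (hx j)).compl
  · exact measurableSet_lt (hM i).snd (hM j).snd

namespace IsMarkedPoissonProcess

lemma measurable_mark (hX : IsMarkedPoissonProcess P lamp X θ m) (i : ℕ) :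
    Measurable fun ω => (θ i ω, m i ω) :=
  (hX.measurable_orientation i).prodMk (hX.measurable_time i)

lemma map_mark [IsProbabilityMeasure P] (hX : IsMarkedPoissonProcess P lamp X θ m) (i : ℕ) :
    P.map (fun ω => (θ i ω, m i ω)) = markLaw := by
  rw [(indepFun_iff_map_prod_eq_prod_map_map (hX.measurable_orientation i).aemeasurable
    (hX.measurable_time i).aemeasurable).1 (hX.indep_orientation_time i),
    hX.orientation_law i, hX.time_law i, cond_Icc_zero_one]
  rfl

lemma map_mark_pair [IsProbabilityMeasure P] (hX : IsMarkedPoissonProcess P lamp X θ m)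
    {i j : ℕ} (hij : i ≠ j) :
    P.map (fun ω => ((θ i ω, m i ω), (θ j ω, m j ω))) = markLaw.prod markLaw := by
  rw [(indepFun_iff_map_prod_eq_prod_map_map (hX.measurable_mark i).aemeasurable
    (hX.measurable_mark j).aemeasurable).1 (hX.indep_marks.indepFun hij),
    hX.map_mark i, hX.map_mark j]

open Classical in
/-- The mean of a sum over the retained transmitters. -/
theorem lintegral_tsum_retained [IsProbabilityMeasure P]
    (hX : IsMarkedPoissonProcess P lamp X θ m) (hl : 0 ≤ lamp) (hd : 0 ≤ d) (hR : Rtx ≤ Rcs)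
    {g : Plane → ℝ≥0∞} (hg : Measurable g) :
    ∫⁻ ω, ∑' i, g (X i ω) * (if Retained d Rcs Rtx X θ m i ω then 1 else 0) ∂P =
      ∫⁻ u, (ENNReal.ofReal lamp * ∫⁻ x, g x * ENNReal.ofReal (Real.exp
        (-lamp * (u.2 * volume.real (exclusionZone d Rcs Rtx x u.1))))) ∂markLaw := by
  have hXm := hX.poisson.measurable
  have hXs : Measurable fun ω (i : ℕ) => X i ω := measurable_pi_lambda _ hXm
  have hMs : Measurable fun ω (i : ℕ) => (θ i ω, m i ω) :=
    measurable_pi_lambda _ hX.measurable_mark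
  let Z : Plane → ℝ → Set Plane := exclusionZone d Rcs Rtx
  have hZ : ∀ x θ, MeasurableSet (Z x θ) := measurableSet_exclusionZone
  have hZm : ∀ x θ, MeasurableSet (Z x θ \ {x}) := fun x θ =>
    (hZ x θ).diff (measurableSet_singleton x)
  let K : ℕ → Ω → ℝ × ℝ → ℝ≥0∞ := fun i ω u => g (X i ω) * ENNReal.ofReal (1 - u.2) ^
    (pointMeasure (fun k => X k ω) (Z (X i ω) u.1 \ {X i ω})).toReal
  have hK : ∀ i, Measurable (Function.uncurry (K i)) := fun i => by
    refine (hg.comp ((hXm i).comp measurable_fst)).mul (Measurable.pow ?_ ?_)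
    · exact (measurable_const.sub measurable_snd.snd).ennreal_ofReal
    · refine (measurable_pointMeasure_section (γ := Ω × (ℝ × ℝ)) (fun k q => X k q.1)
        (fun q => hZm _ _) fun k => ?_).ennreal_toReal
      exact (measurableSet_mem_exclusionZone ((hXm i).comp measurable_fst) measurable_snd.fst
        ((hXm k).comp measurable_fst)).diff
        (measurableSet_eq_fun ((hXm k).comp measurable_fst) ((hXm i).comp measurable_fst))
  have hGm : ∀ i, Measurable (Function.uncurry fun (x : ℕ → Plane) (M : ℕ → ℝ × ℝ) => g (x i) *
      (if RetainedAt d Rcs Rtx x (fun k => (M k).1) (fun k => (M k).2) i then (1 : ℝ≥0∞) else 0)) :=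
    fun i => (hg.comp ((measurable_pi_apply i).comp measurable_fst)).mul
      (Measurable.ite (measurableSet_retainedAt i) measurable_const measurable_const)
  have h1 : ∀ i, ∫⁻ ω, g (X i ω) * (if Retained d Rcs Rtx X θ m i ω then 1 else 0) ∂P =
      ∫⁻ ω, ∫⁻ u, K i ω u ∂markLaw ∂P := fun i => by
    refine (hX.indep_points_marks.lintegral_comp_eq hXs hMs (hGm i)).trans
      (lintegral_congr_ae ?_)
    filter_upwards [hX.poisson.ae_injective hl, hX.poisson.ae_finite_closedBall] with ω hω hω'
    refine (hX.lintegral_retainedAt hd hR hω hω' i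
      (measurable_const (a := g (X i ω)))).trans ?_
    rw [← hX.map_mark i]
    exact (lintegral_map ((hK i).comp measurable_prodMk_left) (hX.measurable_mark i)).symm
  have hR' : ∀ i, Measurable fun ω =>
      g (X i ω) * (if Retained d Rcs Rtx X θ m i ω then (1 : ℝ≥0∞) else 0) := fun i =>
    (hGm i).comp (hXs.prodMk hMs)
  -- The mark law is the same for every index, so it can be moved outside the sum. For a fixed mark,
  -- what remains is a sum over Poisson points.
  rw [lintegral_tsum fun i => (hR' i).aemeasurable, tsum_congr h1,
    tsum_lintegral_lintegral_swap _ _ hK]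
  refine lintegral_congr_ae (ae_markLaw_snd_le_one.mono fun u hu => ?_)
  let F : Plane → Measure Plane → ℝ≥0∞ := fun x μ => g x * ENNReal.ofReal (1 - u.2) ^
    (configurationKernel μ (Z x u.1 \ {x})).toReal
  have hF : Measurable (Function.uncurry F) := by
    refine (hg.comp measurable_fst).mul (measurable_const.pow (Measurable.ennreal_toReal ?_))
    refine measurable_configurationKernel_section (γ := Plane)
      (s := {q | q.2 ∈ Z q.1 u.1 \ {q.1}}) ?_
    exact (measurableSet_mem_exclusionZone measurable_fst measurable_const measurable_snd).diff
      (measurableSet_eq_fun measurable_snd measurable_fst)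
  refine Eq.trans (lintegral_congr_ae ?_) ((hX.poisson.mecke hl hF).trans ?_)
  · filter_upwards [hX.poisson.ae_isConfiguration] with ω hω
    simp only [F, hω.kernel_apply]
    rfl
  · congr 1
    refine lintegral_congr fun x => ?_
    have hvx : volume (Z x u.1 \ {x}) = volume (Z x u.1) :=
      measure_sdiff_null (measure_singleton x)
    rw [← measureReal_congr (sdiff_null_ae_eq_self (measure_singleton x)),
      ← hX.poisson.lintegral_rpow_pointMeasure hl (hZm x u.1)
        (by rw [hvx]; exact volume_exclusionZone_ne_top hd hR x u.1) hu,
      ← lintegral_const_mul]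
    · refine lintegral_congr_ae ?_
      filter_upwards [hX.poisson.ae_isConfiguration] with ω hω
      -- The zone was punctured at `x`, so the added Dirac mass is not counted.
      simp only [F, (hω.add_dirac x).kernel_apply, Measure.add_apply,
        Measure.dirac_apply' _ (hZm x u.1)]
      simp
    · exact measurable_const.pow ((Measure.measurable_coe (hZm x u.1)).comp
        hX.poisson.measurable_pointMeasure).ennreal_toReal

end IsMarkedPoissonProcess
end

lemma pairRegions_disjoint {d Rcs Rtx : ℝ} (x : Plane) (θ : ℝ) (y : Plane) (θ' : ℝ) :
    Pairwise fun k k' => Disjoint (pairRegions d Rcs Rtx x θ y θ' k)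
      (pairRegions d Rcs Rtx x θ y θ' k') := by
  intro k k' hk
  rw [Set.disjoint_left]
  fin_cases k <;> fin_cases k' <;> simp_all [pairRegions]

lemma measurableSet_mem_pairRegions {d Rcs Rtx : ℝ} {γ : Type*} [MeasurableSpace γ]
    {x y z : γ → Plane} {θ θ' : γ → ℝ} (hx : Measurable x) (hθ : Measurable θ) (hy : Measurable y)
    (hθ' : Measurable θ') (hz : Measurable z) (k : Fin 3) :
    MeasurableSet {c | z c ∈ pairRegions d Rcs Rtx (x c) (θ c) (y c) (θ' c) k \ {x c, y c}} := by
  have h1 : MeasurableSet {c | z c ∈ exclusionZone d Rcs Rtx (x c) (θ c)} :=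
    measurableSet_mem_exclusionZone hx hθ hz
  have h2 : MeasurableSet {c | z c ∈ exclusionZone d Rcs Rtx (y c) (θ' c)} :=
    measurableSet_mem_exclusionZone hy hθ' hz
  have h3 : MeasurableSet {c | z c = x c ∨ z c = y c} :=
    (measurableSet_eq_fun hz hx).union (measurableSet_eq_fun hz hy)
  fin_cases k
  exacts [(h1.diff h2).diff h3, (h2.diff h1).diff h3, (h1.inter h2).diff h3]

lemma measurable_pairLevels (k : Fin 3) :
    Measurable fun q : ℝ × ℝ => pairLevels q.1 q.2 k := by
  fin_cases k
  exacts [measurable_fst, measurable_snd, measurable_fst.max measurable_snd]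

lemma pairLevels_le_one {s t : ℝ} (hs : s ≤ 1) (ht : t ≤ 1) (k : Fin 3) :
    pairLevels s t k ≤ 1 := by
  fin_cases k
  exacts [hs, ht, max_le hs ht]

/-! ### Averages over pairs of retained transmitters. -/

section

variable {d Rcs Rtx : ℝ} {Ω : Type*} [MeasurableSpace Ω] {P : Measure Ω} {lamp : ℝ}
  {X : ℕ → Ω → Plane} {θ m : ℕ → Ω → ℝ}

namespace IsMarkedPoissonProcess

open Classical in
/-- The mean of a sum over the pairs of distinct retained transmitters. -/
theorem lintegral_tsum_retained_pairs [IsProbabilityMeasure P]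
    (hX : IsMarkedPoissonProcess P lamp X θ m) (hl : 0 ≤ lamp) (hd : 0 ≤ d) (hR : Rtx ≤ Rcs)
    {f : Plane → ℝ → Plane → ℝ≥0∞} (hf : Measurable fun q : Plane × ℝ × Plane => f q.1 q.2.1 q.2.2) :
    ∫⁻ ω, ∑' i, ∑' j, (if i ≠ j ∧ Retained d Rcs Rtx X θ m i ω ∧ Retained d Rcs Rtx X θ m j ω
        then f (X i ω) (θ i ω) (X j ω) else 0) ∂P =
      ∫⁻ w, (ENNReal.ofReal lamp ^ 2 * ∫⁻ x, ∫⁻ y, f x w.1.1 y *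
        (if Compatible d Rcs Rtx x w.1 y w.2 then 1 else 0) * ENNReal.ofReal (Real.exp
          (-lamp * ∑ k, pairLevels w.1.2 w.2.2 k *
            volume.real (pairRegions d Rcs Rtx x w.1.1 y w.2.1 k)))) ∂(markLaw.prod markLaw) := by
  have hXm := hX.poisson.measurable
  have hXs : Measurable fun ω (i : ℕ) => X i ω := measurable_pi_lambda _ hXm
  have hMs : Measurable fun ω (i : ℕ) => (θ i ω, m i ω) :=
    measurable_pi_lambda _ hX.measurable_mark
  have hAm : ∀ x θ y θ' k, MeasurableSet (pairRegions d Rcs Rtx x θ y θ' k \ {x, y}) :=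
    fun x θ y θ' k =>
      (measurableSet_pairRegions x θ y θ' k).diff ((measurableSet_singleton _).insert _)
  let K : ℕ × ℕ → Ω → (ℝ × ℝ) × (ℝ × ℝ) → ℝ≥0∞ := fun p ω w => if p.1 = p.2 then 0 else
    f (X p.1 ω) w.1.1 (X p.2 ω) *
      (if Compatible d Rcs Rtx (X p.1 ω) w.1 (X p.2 ω) w.2 then 1 else 0) *
      ∏ k, ENNReal.ofReal (1 - pairLevels w.1.2 w.2.2 k) ^ (pointMeasure (fun l => X l ω)
        (pairRegions d Rcs Rtx (X p.1 ω) w.1.1 (X p.2 ω) w.2.1 k \ {X p.1 ω, X p.2 ω})).toReal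
  have hK : ∀ p, Measurable (Function.uncurry (K p)) := fun p => by
    by_cases hp : p.1 = p.2
    · simp only [K, hp, if_true, Function.uncurry_def]
      exact measurable_const
    simp only [K, hp, if_false, Function.uncurry_def]
    have hx : Measurable fun q : Ω × ((ℝ × ℝ) × (ℝ × ℝ)) => X p.1 q.1 :=
      (hXm p.1).comp measurable_fst
    have hy : Measurable fun q : Ω × ((ℝ × ℝ) × (ℝ × ℝ)) => X p.2 q.1 :=
      (hXm p.2).comp measurable_fst
    refine ((hf.comp (hx.prodMk (measurable_snd.fst.fst.prodMk hy))).mul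
      (Measurable.ite (measurableSet_compatible hx measurable_snd.fst hy measurable_snd.snd)
        measurable_const measurable_const)).mul
      (Finset.measurable_prod _ fun k _ => Measurable.pow ?_ ?_)
    · exact (measurable_const.sub ((measurable_pairLevels k).comp
        (measurable_snd.fst.snd.prodMk measurable_snd.snd.snd))).ennreal_ofReal
    · refine (measurable_pointMeasure_section (γ := Ω × ((ℝ × ℝ) × (ℝ × ℝ)))
        (fun l q => X l q.1) (fun q => hAm _ _ _ _ k) fun l => ?_).ennreal_toReal
      exact measurableSet_mem_pairRegions hx measurable_snd.fst.fst hy measurable_snd.snd.fst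
        ((hXm l).comp measurable_fst) k
  let G : ℕ × ℕ → (ℕ → Plane) → (ℕ → ℝ × ℝ) → ℝ≥0∞ := fun p x M =>
    if p.1 = p.2 then 0 else f (x p.1) (M p.1).1 (x p.2) *
      (if RetainedAt d Rcs Rtx x (fun k => (M k).1) (fun k => (M k).2) p.1 ∧
        RetainedAt d Rcs Rtx x (fun k => (M k).1) (fun k => (M k).2) p.2 then 1 else 0)
  have hG : ∀ p, Measurable (Function.uncurry (G p)) := fun p => by
    by_cases hp : p.1 = p.2
    · simp only [G, hp, if_true, Function.uncurry_def]
      exact measurable_const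
    simp only [G, hp, if_false, Function.uncurry_def]
    have hx : ∀ k, Measurable fun q : (ℕ → Plane) × (ℕ → ℝ × ℝ) => q.1 k := fun k =>
      (measurable_pi_apply k).comp measurable_fst
    have hM : ∀ k, Measurable fun q : (ℕ → Plane) × (ℕ → ℝ × ℝ) => q.2 k := fun k =>
      (measurable_pi_apply k).comp measurable_snd
    exact (hf.comp ((hx p.1).prodMk ((hM p.1).fst.prodMk (hx p.2)))).mul
      (Measurable.ite ((measurableSet_retainedAt p.1).inter (measurableSet_retainedAt p.2))
        measurable_const measurable_const)
  have h1 : ∀ p, ∫⁻ ω, G p (fun i => X i ω) (fun i => (θ i ω, m i ω)) ∂P =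
      ∫⁻ ω, ∫⁻ w, K p ω w ∂(markLaw.prod markLaw) ∂P := fun p => by
    by_cases hp : p.1 = p.2
    · simp [G, K, hp]
    refine (hX.indep_points_marks.lintegral_comp_eq hXs hMs (hG p)).trans
      (lintegral_congr_ae ?_)
    filter_upwards [hX.poisson.ae_injective hl, hX.poisson.ae_finite_closedBall] with ω hω hω'
    have := hX.lintegral_retainedAt_pair hd hR hω hω' hp
      (f := fun t => f (X p.1 ω) t (X p.2 ω))
      (hf.comp (measurable_const.prodMk (measurable_id.prodMk measurable_const)))
    simp only [G, hp, if_false]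
    refine this.trans ?_
    rw [← hX.map_mark_pair hp]
    refine Eq.trans ?_ (lintegral_map ((hK p).comp measurable_prodMk_left)
      ((hX.measurable_mark p.1).prodMk (hX.measurable_mark p.2))).symm
    simp only [K, hp, if_false, Function.comp_def, Function.uncurry_def]
  have h2 : ∀ ω, ∑' i, ∑' j, (if i ≠ j ∧ Retained d Rcs Rtx X θ m i ω ∧
      Retained d Rcs Rtx X θ m j ω then f (X i ω) (θ i ω) (X j ω) else 0) =
      ∑' p, G p (fun i => X i ω) (fun i => (θ i ω, m i ω)) := fun ω => by
    rw [ENNReal.tsum_prod']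
    refine tsum_congr fun i => tsum_congr fun j => ?_
    by_cases hij : i = j
    · simp [G, hij]
    · simp only [G, hij, if_false, ne_eq, not_false_eq_true, true_and, mul_ite, mul_one, mul_zero]
      rfl
  simp only [h2]
  rw [lintegral_tsum (f := fun p ω => G p (fun i => X i ω) (fun i => (θ i ω, m i ω)))
    fun p => ((hG p).comp (hXs.prodMk hMs)).aemeasurable, tsum_congr h1,
    tsum_lintegral_lintegral_swap _ _ hK]
  have hw : ∀ᵐ w ∂markLaw.prod markLaw, w.1.2 ≤ 1 ∧ w.2.2 ≤ 1 :=
    (Measure.quasiMeasurePreserving_fst.ae ae_markLaw_snd_le_one).and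
      (Measure.quasiMeasurePreserving_snd.ae ae_markLaw_snd_le_one)
  refine lintegral_congr_ae (hw.mono fun w hw => ?_)
  -- Vanishing on the diagonal encodes `i ≠ j`, since the points are almost surely distinct, and it
  -- is what `mecke_two` requires.
  let F : Plane → Plane → Measure Plane → ℝ≥0∞ := fun x y μ => if x = y then 0 else
    f x w.1.1 y * (if Compatible d Rcs Rtx x w.1 y w.2 then 1 else 0) *
      ∏ k, ENNReal.ofReal (1 - pairLevels w.1.2 w.2.2 k) ^ (configurationKernel μ
        (pairRegions d Rcs Rtx x w.1.1 y w.2.1 k \ {x, y})).toReal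
  have hF : Measurable fun p : Plane × Plane × Measure Plane => F p.1 p.2.1 p.2.2 := by
    refine Measurable.ite (measurableSet_eq_fun measurable_fst measurable_snd.fst)
      measurable_const ?_
    refine ((hf.comp (measurable_fst.prodMk (measurable_const.prodMk measurable_snd.fst))).mul
      (Measurable.ite (measurableSet_compatible measurable_fst measurable_const measurable_snd.fst
        measurable_const) measurable_const measurable_const)).mul
      (Finset.measurable_prod _ fun k _ => measurable_const.pow (Measurable.ennreal_toReal ?_))
    have hs := measurable_configurationKernel_section (γ := Plane × Plane)
      (s := {q | q.2 ∈ pairRegions d Rcs Rtx q.1.1 w.1.1 q.1.2 w.2.1 k \ {q.1.1, q.1.2}})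
      (measurableSet_mem_pairRegions measurable_fst.fst measurable_const measurable_fst.snd
        measurable_const measurable_snd k)
    have hc : Measurable fun q : Plane × Plane × Measure Plane => ((q.1, q.2.1), q.2.2) :=
      (measurable_fst.prodMk measurable_snd.fst).prodMk measurable_snd.snd
    have h := hs.comp hc
    simp only [Function.comp_def] at h
    exact h
  refine Eq.trans (lintegral_congr_ae ?_)
    ((hX.poisson.mecke_two hl hF fun x μ => by simp [F]).trans ?_)
  · filter_upwards [hX.poisson.ae_isConfiguration, hX.poisson.ae_injective hl] with ω hω hinj
    rw [ENNReal.tsum_prod']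
    refine tsum_congr fun i => tsum_congr fun j => ?_
    simp only [F, K, hω.kernel_apply, hinj.eq_iff]
  · congr 1
    refine lintegral_congr fun x => lintegral_congr_ae ?_
    have hne : ∀ᵐ y : Plane, y ≠ x := by
      simp [ae_iff]
    filter_upwards [hne] with y hy
    have hvol : ∀ k, volume (pairRegions d Rcs Rtx x w.1.1 y w.2.1 k \ {x, y}) =
        volume (pairRegions d Rcs Rtx x w.1.1 y w.2.1 k) := fun k =>
      measure_sdiff_null (((countable_singleton y).insert x).measure_zero volume)
    have hfin : ∀ k, volume (pairRegions d Rcs Rtx x w.1.1 y w.2.1 k \ {x, y}) ≠ ∞ := fun k => by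
      rw [hvol]
      refine measure_ne_top_of_subset (pairRegions_subset _ _ _ _ k) (measure_union_ne_top
        (volume_exclusionZone_ne_top hd hR _ _) (volume_exclusionZone_ne_top hd hR _ _))
    have hexp := hX.poisson.lintegral_prod_rpow_pointMeasure hl
      (fun k => pairRegions d Rcs Rtx x w.1.1 y w.2.1 k \ {x, y}) (fun k => hAm _ _ _ _ k) hfin
      (fun k k' hk => (pairRegions_disjoint x w.1.1 y w.2.1 hk).mono sdiff_subset sdiff_subset)
      (pairLevels_le_one hw.1 hw.2)
    simp only [measureReal_def, hvol] at hexp ⊢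
    rw [← hexp, ← lintegral_const_mul]
    · refine lintegral_congr_ae ?_
      filter_upwards [hX.poisson.ae_isConfiguration] with ω hω
      simp only [F, ((hω.add_dirac x).add_dirac y).kernel_apply, Measure.add_apply,
        Measure.dirac_apply' _ (hAm _ _ _ _ _), if_neg hy.symm]
      simp
    · exact Finset.measurable_prod _ fun k _ => measurable_const.pow
        ((Measure.measurable_coe (hAm _ _ _ _ k)).comp
          hX.poisson.measurable_pointMeasure).ennreal_toReal

end IsMarkedPoissonProcess
end

/-! ### Integrals over the time stamps. -/

lemma setLIntegral_exp_neg_mul {c : ℝ} (hc : 0 < c) {b : ℝ} (hb : 0 ≤ b) :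
    ∫⁻ x in Icc 0 b, ENNReal.ofReal (Real.exp (-(c * x))) =
      ENNReal.ofReal ((1 - Real.exp (-(c * b))) / c) := by
  have hcont : Continuous fun x : ℝ => Real.exp (-(c * x)) := by fun_prop
  rw [← ofReal_integral_eq_lintegral_ofReal
    (hcont.continuousOn.integrableOn_compact isCompact_Icc)
    (Filter.Eventually.of_forall fun x => (Real.exp_pos _).le),
    integral_Icc_eq_integral_Ioc, ← intervalIntegral.integral_of_le hb]
  congr 1
  have hderiv : ∀ x ∈ uIcc 0 b,
      HasDerivAt (fun x => -Real.exp (-(c * x)) / c) (Real.exp (-(c * x))) x := fun x _ => by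
    have h : HasDerivAt (fun x => -(c * x)) (-c) x := by
      simpa [neg_mul] using (hasDerivAt_id' x).const_mul (-c)
    refine (h.exp.fun_neg.div_const c).congr_deriv ?_
    rw [mul_neg, neg_neg, mul_div_cancel_right₀ _ hc.ne']
  rw [intervalIntegral.integral_eq_sub_of_hasDerivAt hderiv (hcont.intervalIntegrable _ _)]
  simp
  ring

section

variable {lamp a Vo : ℝ}

/-- The integral over `s < t` leaves a difference of two exponentials in `t`, with rates `lamp * Vo`
and `lamp * (Vo + a)`. Integrating these gives `beta` at `V = Vo + a`; `a > 0` keeps its denominator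
from vanishing. -/
lemma lintegral_lintegral_lt_eq_beta (hl : 0 < lamp) (ha : 0 < a) (hV : 0 < Vo) :
    ∫⁻ t in Icc (0 : ℝ) 1, ∫⁻ s in Icc (0 : ℝ) 1, (if s < t then
        ENNReal.ofReal (Real.exp (-lamp * (s * a + t * Vo))) else 0) =
      ENNReal.ofReal (_root_.beta lamp Vo (Vo + a)) := by
  have h1 : ∀ t ∈ Icc (0 : ℝ) 1, ∫⁻ s in Icc (0 : ℝ) 1, (if s < t then
        ENNReal.ofReal (Real.exp (-lamp * (s * a + t * Vo))) else 0) =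
      ENNReal.ofReal (Real.exp (-(lamp * Vo * t))) *
        ENNReal.ofReal ((1 - Real.exp (-(lamp * a * t))) / (lamp * a)) := fun t ht => by
    rw [← setLIntegral_exp_neg_mul (mul_pos hl ha) ht.1, ← lintegral_const_mul _ (by fun_prop),
      ← restrict_Ico_eq_restrict_Icc, ← restrict_Ico_eq_restrict_Icc,
      ← lintegral_indicator measurableSet_Ico, ← lintegral_indicator measurableSet_Ico]
    refine lintegral_congr fun s => ?_
    simp only [indicator, mem_Ico]
    have ht1 := ht.2
    by_cases h : 0 ≤ s ∧ s < t
    · rw [if_pos ⟨h.1, h.2.trans_le ht1⟩, if_pos h.2, if_pos h,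
        ← ENNReal.ofReal_mul (Real.exp_pos _).le, ← Real.exp_add]
      congr 2
      ring
    · rw [if_neg h]
      split_ifs with h3 h4
      · exact absurd ⟨h3.1, h4⟩ h
      · rfl
      · rfl
  rw [setLIntegral_congr_fun measurableSet_Icc h1]
  have hc1 : 0 < lamp * Vo := mul_pos hl hV
  have hc2 : 0 < lamp * (Vo + a) := mul_pos hl (by linarith)
  have h2 : ∀ t ∈ Icc (0 : ℝ) 1, ENNReal.ofReal (Real.exp (-(lamp * Vo * t))) *
        ENNReal.ofReal ((1 - Real.exp (-(lamp * a * t))) / (lamp * a)) =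
      ENNReal.ofReal (1 / (lamp * a)) * (ENNReal.ofReal (Real.exp (-(lamp * Vo * t))) -
        ENNReal.ofReal (Real.exp (-(lamp * (Vo + a) * t)))) := fun t _ => by
    rw [← ENNReal.ofReal_sub _ (Real.exp_pos _).le, ← ENNReal.ofReal_mul (Real.exp_pos _).le,
      ← ENNReal.ofReal_mul (by positivity)]
    congr 1
    rw [show -(lamp * (Vo + a) * t) = -(lamp * Vo * t) + -(lamp * a * t) by ring, Real.exp_add]
    ring
  have h3 : ∫⁻ t in Icc (0 : ℝ) 1, ENNReal.ofReal (Real.exp (-(lamp * (Vo + a) * t))) ≠ ∞ := by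
    rw [setLIntegral_exp_neg_mul hc2 zero_le_one]
    exact ENNReal.ofReal_ne_top
  rw [setLIntegral_congr_fun measurableSet_Icc h2, lintegral_const_mul _ (by fun_prop),
    lintegral_sub (by fun_prop) h3, setLIntegral_exp_neg_mul hc1 zero_le_one,
    setLIntegral_exp_neg_mul hc2 zero_le_one, ← ENNReal.ofReal_sub, ← ENNReal.ofReal_mul (by positivity)]
  · congr 1
    rw [_root_.beta, show -(lamp * Vo * 1) = -lamp * Vo by ring,
      show -(lamp * (Vo + a) * 1) = -lamp * (Vo + a) by ring]
    have : Vo + a ≠ 0 := by positivity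
    rw [show Vo + a - Vo = a by ring]
    field_simp
    ring
  · refine div_nonneg (sub_nonneg.2 (Real.exp_le_one_iff.2 ?_)) hc2.le
    linarith
  · refine (ae_restrict_iff' measurableSet_Icc).2 (Filter.Eventually.of_forall fun t ht => ?_)
    refine ENNReal.ofReal_le_ofReal (Real.exp_le_exp.2 ?_)
    have := mul_nonneg (mul_nonneg hl.le ha.le) ht.1
    nlinarith

open Classical in
/-- The probability that two transmitters are both retained, integrated over the time stamps. Here
`p` (resp. `q`) says that the second (resp. first) transmitter is in the exclusion zone of the
first (resp. second) one. -/
lemma lintegral_lintegral_pairLevels (hl : 0 < lamp) (ha : 0 < a) (hV : 0 < Vo) (p q : Prop)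
    {A : Fin 3 → ℝ} (hA0 : A 0 = a) (hA1 : A 1 = a) (hA2 : A 2 = Vo - a) :
    ∫⁻ s in Icc (0 : ℝ) 1, ∫⁻ t in Icc (0 : ℝ) 1, (if (p → s < t) ∧ (q → t < s) then 1 else 0) *
        ENNReal.ofReal (Real.exp (-lamp * ∑ k, pairLevels s t k * A k)) =
      if p ∧ q then 0 else if ¬p ∧ ¬q then ENNReal.ofReal (2 * _root_.beta lamp Vo (Vo + a))
        else ENNReal.ofReal (_root_.beta lamp Vo (Vo + a)) := by
  -- For `s < t` the sum equals `s * a + t * Vo`, and symmetrically for `t < s`.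
  have hsum : ∀ s t, ∑ k, pairLevels s t k * A k = s * a + t * a + max s t * (Vo - a) :=
    fun s t => by
      simp [Fin.sum_univ_three, pairLevels, hA0, hA1, hA2]
  simp only [hsum]
  have hm1 : Measurable fun w : ℝ × ℝ => if w.1 < w.2 then
      ENNReal.ofReal (Real.exp (-lamp * (w.1 * a + w.2 * Vo))) else 0 :=
    Measurable.ite (measurableSet_lt measurable_fst measurable_snd) (by fun_prop) measurable_const
  have hlt : ∫⁻ s in Icc (0 : ℝ) 1, ∫⁻ t in Icc (0 : ℝ) 1, (if s < t then
      ENNReal.ofReal (Real.exp (-lamp * (s * a + t * a + max s t * (Vo - a)))) else 0) =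
      ENNReal.ofReal (_root_.beta lamp Vo (Vo + a)) := by
    rw [← lintegral_lintegral_lt_eq_beta hl ha hV, lintegral_lintegral_swap]
    · refine lintegral_congr fun t => lintegral_congr fun s => ?_
      split_ifs with h
      · rw [max_eq_right h.le]; congr 3; ring
      · rfl
    · refine Measurable.aemeasurable (Measurable.ite (measurableSet_lt measurable_fst
        measurable_snd) (by fun_prop) measurable_const)
  have hgt : ∫⁻ s in Icc (0 : ℝ) 1, ∫⁻ t in Icc (0 : ℝ) 1, (if t < s then
      ENNReal.ofReal (Real.exp (-lamp * (s * a + t * a + max s t * (Vo - a)))) else 0) =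
      ENNReal.ofReal (_root_.beta lamp Vo (Vo + a)) := by
    rw [← lintegral_lintegral_lt_eq_beta hl ha hV]
    refine lintegral_congr fun t => lintegral_congr fun s => ?_
    split_ifs with h
    · rw [max_eq_left h.le]; congr 3; ring
    · rfl
  by_cases hp : p <;> by_cases hq : q
  · have : ∀ s t : ℝ, ¬(s < t ∧ t < s) := fun s t h => lt_asymm h.1 h.2
    simp [hp, hq, this]
  · simpa [hp, hq] using hlt
  · simpa [hp, hq] using hgt
  -- Without mutual constraints both orders contribute; the tie `s = t` is null.
  · have hb : ENNReal.ofReal (2 * _root_.beta lamp Vo (Vo + a)) =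
        ENNReal.ofReal (_root_.beta lamp Vo (Vo + a)) + ENNReal.ofReal (_root_.beta lamp Vo (Vo + a)) := by
      rw [ENNReal.ofReal_mul zero_le_two, ENNReal.ofReal_ofNat, two_mul]
    have hmm : Measurable fun w : ℝ × ℝ => if w.1 < w.2 then ENNReal.ofReal
        (Real.exp (-lamp * (w.1 * a + w.2 * a + max w.1 w.2 * (Vo - a)))) else 0 :=
      Measurable.ite (measurableSet_lt measurable_fst measurable_snd) (by fun_prop) measurable_const
    simp only [hp, hq, IsEmpty.forall_iff, and_self, if_true, one_mul, not_false_eq_true, if_false]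
    rw [hb]
    nth_rw 1 [← hlt]
    rw [← hgt, ← lintegral_add_left hmm.lintegral_prod_right']
    refine lintegral_congr fun s => ?_
    rw [← lintegral_add_left (f := fun t => if s < t then ENNReal.ofReal
      (Real.exp (-lamp * (s * a + t * a + max s t * (Vo - a)))) else 0)
      (hmm.comp measurable_prodMk_left)]
    have hne : ∀ᵐ t : ℝ ∂volume.restrict (Icc 0 1), t ≠ s :=
      ae_restrict_of_ae (by simp [ae_iff])
    refine lintegral_congr_ae (hne.mono fun t ht => ?_)
    rcases lt_or_gt_of_ne ht with h | h
    · simp [h, h.not_gt]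
    · simp [h, h.not_gt]

end

/-! ### Rigid motions and the geometry of the zones. -/

lemma Plane.dist_sq (v w : Plane) : dist v w ^ 2 = (v 0 - w 0) ^ 2 + (v 1 - w 1) ^ 2 := by
  rw [EuclideanSpace.dist_eq, Real.sq_sqrt (by positivity), Fin.sum_univ_two, Real.dist_eq,
    Real.dist_eq, sq_abs, sq_abs]

lemma Plane.ext_coord {v w : Plane} (h0 : v 0 = w 0) (h1 : v 1 = w 1) : v = w := by
  ext i
  fin_cases i
  exacts [h0, h1]

section Rotation

@[simp] lemma rotate_apply_zero (a : ℝ) (v : Plane) :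
    rotate a v 0 = Real.cos a * v 0 - Real.sin a * v 1 := rfl

@[simp] lemma rotate_apply_one (a : ℝ) (v : Plane) :
    rotate a v 1 = Real.sin a * v 0 + Real.cos a * v 1 := rfl

@[simp] lemma receiver_apply_zero (d : ℝ) (x : Plane) (θ : ℝ) :
    receiver d x θ 0 = x 0 + d * Real.cos θ := rfl

@[simp] lemma receiver_apply_one (d : ℝ) (x : Plane) (θ : ℝ) :
    receiver d x θ 1 = x 1 + d * Real.sin θ := rfl

lemma dist_rotate (a : ℝ) (v w : Plane) : dist (rotate a v) (rotate a w) = dist v w := by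
  refine (sq_eq_sq₀ dist_nonneg dist_nonneg).1 ?_
  rw [Plane.dist_sq, Plane.dist_sq]
  simp only [rotate_apply_zero, rotate_apply_one]
  linear_combination ((v 0 - w 0) ^ 2 + (v 1 - w 1) ^ 2) * Real.sin_sq_add_cos_sq a

lemma rotate_rotate (a b : ℝ) (v : Plane) : rotate a (rotate b v) = rotate (a + b) v := by
  refine Plane.ext_coord ?_ ?_ <;>
    simp only [rotate_apply_zero, rotate_apply_one, Real.cos_add, Real.sin_add] <;> ring

lemma rotate_zero (v : Plane) : rotate 0 v = v := by
  refine Plane.ext_coord ?_ ?_ <;> simp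

lemma rotate_neg_rotate (a : ℝ) (v : Plane) : rotate (-a) (rotate a v) = v := by
  rw [rotate_rotate, neg_add_cancel, rotate_zero]

lemma rotate_rotate_neg (a : ℝ) (v : Plane) : rotate a (rotate (-a) v) = v := by
  rw [rotate_rotate, add_neg_cancel, rotate_zero]

/-- The rigid motion which takes the origin with orientation `0` to `x` with orientation `θ`. -/
noncomputable def rigidMotion (x : Plane) (θ : ℝ) : Plane ≃ᵢ Plane where
  toFun v := x + rotate θ v
  invFun y := rotate (-θ) (y - x)
  left_inv v := by simp [rotate_neg_rotate]
  right_inv y := by simp [rotate_rotate_neg]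
  isometry_toFun := Isometry.of_dist_eq fun v w => by simp [dist_rotate]

lemma rigidMotion_apply (x : Plane) (θ : ℝ) (v : Plane) :
    rigidMotion x θ v = x + rotate θ v := rfl

lemma rigidMotion_zero (x : Plane) (θ : ℝ) : rigidMotion x θ 0 = x := by
  refine Plane.ext_coord ?_ ?_ <;> simp [rigidMotion_apply]

/-- An isometry preserves the two-dimensional Hausdorff measure, which in its Euclidean
normalisation is the area. -/
lemma measurePreserving_rigidMotion (x : Plane) (θ : ℝ) :
    MeasurePreserving (rigidMotion x θ) := by
  have h := (rigidMotion x θ).measurePreserving_euclideanHausdorffMeasure 2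
  rwa [EuclideanSpace.euclideanHausdorffMeasure_eq_volume 2] at h

end Rotation

section Zones

variable {d Rcs Rtx : ℝ}

lemma receiver_rigidMotion (x : Plane) (θ : ℝ) (y : Plane) (ϑ : ℝ) :
    receiver d (rigidMotion x θ y) (θ + ϑ) = rigidMotion x θ (receiver d y ϑ) := by
  refine Plane.ext_coord ?_ ?_ <;>
    simp only [receiver_apply_zero, receiver_apply_one, rigidMotion_apply, PiLp.add_apply,
      rotate_apply_zero, rotate_apply_one, Real.cos_add, Real.sin_add] <;> ring

lemma rigidMotion_mem_exclusionZone (x : Plane) (θ : ℝ) (v y : Plane) (ϑ : ℝ) :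
    rigidMotion x θ v ∈ exclusionZone d Rcs Rtx (rigidMotion x θ y) (θ + ϑ) ↔
      v ∈ exclusionZone d Rcs Rtx y ϑ := by
  simp only [exclusionZone, receiver_rigidMotion, mem_union, Metric.mem_closedBall,
    (rigidMotion x θ).isometry.dist_eq]

lemma rigidMotion_preimage_pairRegions (x : Plane) (θ : ℝ) (y : Plane) (ϑ : ℝ) (y' : Plane)
    (ϑ' : ℝ) (k : Fin 3) :
    rigidMotion x θ ⁻¹' pairRegions d Rcs Rtx (rigidMotion x θ y) (θ + ϑ)
      (rigidMotion x θ y') (θ + ϑ') k = pairRegions d Rcs Rtx y ϑ y' ϑ' k := by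
  have h : ∀ y ϑ, rigidMotion x θ ⁻¹' exclusionZone d Rcs Rtx (rigidMotion x θ y) (θ + ϑ) =
      exclusionZone d Rcs Rtx y ϑ := fun y ϑ =>
    Set.ext fun v => rigidMotion_mem_exclusionZone x θ v y ϑ
  fin_cases k <;> simp [pairRegions, preimage_sdiff, preimage_inter, h]

lemma volume_real_exclusionZone (x : Plane) (θ : ℝ) :
    volume.real (exclusionZone d Rcs Rtx x θ) = zoneArea d Rcs Rtx := by
  rw [zoneArea, ← (measurePreserving_rigidMotion x θ).measureReal_preimage
    (measurableSet_exclusionZone x θ).nullMeasurableSet]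
  congr 1
  ext v
  have := rigidMotion_mem_exclusionZone (d := d) (Rcs := Rcs) (Rtx := Rtx) x θ v 0 0
  rwa [rigidMotion_zero, add_zero] at this

lemma receiver_add_two_pi (x : Plane) (θ : ℝ) :
    receiver d x (θ + 2 * Real.pi) = receiver d x θ := by
  simp [receiver]

lemma exclusionZone_add_two_pi (x : Plane) (θ : ℝ) :
    exclusionZone d Rcs Rtx x (θ + 2 * Real.pi) = exclusionZone d Rcs Rtx x θ := by
  simp only [exclusionZone, receiver_add_two_pi]

lemma zoneArea_pos (hd : 0 ≤ d) (hR : Rtx ≤ Rcs) (hRcs : 0 < Rcs) : 0 < zoneArea d Rcs Rtx := by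
  refine ENNReal.toReal_pos ?_ (volume_exclusionZone_ne_top hd hR 0 0)
  exact ((Metric.measure_closedBall_pos volume (0 : Plane) hRcs).trans_le
    (measure_mono subset_union_left)).ne'

/-- A zone is not contained in the zone of a transmitter outside its sensing disc. -/
lemma volume_exclusionZone_sdiff_pos (hRcs : 0 < Rcs) (hR : Rtx < Rcs) {x y : Plane}
    (hxy : Rcs < dist y x) (θ θ' : ℝ) :
    0 < volume (exclusionZone d Rcs Rtx y θ' \ exclusionZone d Rcs Rtx x θ) := by
  have hr : 0 < dist y x := hRcs.trans hxy
  have hr2 := Plane.dist_sq y x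
  -- `v` is perpendicular to `y - x` and has length `Rcs`. The points `y ± v` lie on the sensing
  -- circle of `y` and, by Pythagoras, outside that of `x`.
  let v : Plane := !₂[-(Rcs / dist y x * (y 1 - x 1)), Rcs / dist y x * (y 0 - x 0)]
  have hv0 : v 0 = -(Rcs / dist y x * (y 1 - x 1)) := rfl
  have hv1 : v 1 = Rcs / dist y x * (y 0 - x 0) := rfl
  have hvv : v 0 ^ 2 + v 1 ^ 2 = Rcs ^ 2 := by
    rw [hv0, hv1]
    calc _ = (Rcs / dist y x) ^ 2 * ((y 0 - x 0) ^ 2 + (y 1 - x 1) ^ 2) := by ring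
      _ = Rcs ^ 2 := by rw [← hr2]; field_simp
  have horth : (y 0 - x 0) * v 0 + (y 1 - x 1) * v 1 = 0 := by rw [hv0, hv1]; ring
  have hfar : ∀ w : Plane, (w = y + v ∨ w = y - v) → Rcs < dist w x := fun w hw => by
    refine lt_of_pow_lt_pow_left₀ 2 dist_nonneg ?_
    have h2 : Rcs ^ 2 < dist y x ^ 2 := by gcongr
    rw [Plane.dist_sq]
    rcases hw with rfl | rfl <;>
      simp only [PiLp.add_apply, PiLp.sub_apply] <;> nlinarith
  have hclose : ∀ w : Plane, (w = y + v ∨ w = y - v) → w ∈ closure (Metric.ball y Rcs) :=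
    fun w hw => by
      rw [closure_ball y hRcs.ne', Metric.mem_closedBall]
      refine le_of_sq_le_sq ?_ hRcs.le
      rw [Plane.dist_sq]
      rcases hw with rfl | rfl <;>
        simp only [PiLp.add_apply, PiLp.sub_apply] <;> nlinarith
  -- The points `y ± v` are `2 * Rcs` apart, so a disc of radius `Rtx < Rcs` cannot contain both.
  -- The one it misses has a neighbourhood outside the zone of `x`, and this meets the open sensing
  -- disc of `y`.
  have hex : ∃ w : Plane, (w = y + v ∨ w = y - v) ∧ w ∉ exclusionZone d Rcs Rtx x θ := by
    by_contra! h
    have h1 : dist (y + v) (receiver d x θ) ≤ Rtx :=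
      (h (y + v) (Or.inl rfl)).resolve_left fun h' => (hfar _ (Or.inl rfl)).not_ge h'
    have h2 : dist (y - v) (receiver d x θ) ≤ Rtx :=
      (h (y - v) (Or.inr rfl)).resolve_left fun h' => (hfar _ (Or.inr rfl)).not_ge h'
    have h3 := dist_triangle_right (y + v) (y - v) (receiver d x θ)
    have h4 : dist (y + v) (y - v) ^ 2 = (2 * Rcs) ^ 2 := by
      rw [Plane.dist_sq]
      simp only [PiLp.add_apply, PiLp.sub_apply]
      linear_combination 4 * hvv
    have h5 : dist (y + v) (y - v) = 2 * Rcs :=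
      (sq_eq_sq₀ dist_nonneg (by positivity)).1 h4
    linarith
  obtain ⟨w, hw, hwZ⟩ := hex
  have hopen : IsOpen (exclusionZone d Rcs Rtx x θ)ᶜ := (isClosed_exclusionZone x θ).isOpen_compl
  have hne := mem_closure_iff.1 (hclose w hw) _ hopen hwZ
  refine ((hopen.inter Metric.isOpen_ball).measure_pos volume hne).trans_le
    (measure_mono fun z hz => ⟨Or.inl (Metric.ball_subset_closedBall hz.2), hz.1⟩)

/-- The point with polar coordinates `(r, φ)`. -/
noncomputable def polarPoint (r φ : ℝ) : Plane := !₂[r * Real.cos φ, r * Real.sin φ]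

lemma polarPoint_apply_zero (r φ : ℝ) : polarPoint r φ 0 = r * Real.cos φ := rfl

lemma polarPoint_apply_one (r φ : ℝ) : polarPoint r φ 1 = r * Real.sin φ := rfl

lemma dist_polarPoint_zero {r : ℝ} (hr : 0 ≤ r) (φ : ℝ) : dist (polarPoint r φ) 0 = r := by
  refine (sq_eq_sq₀ dist_nonneg hr).1 ?_
  rw [Plane.dist_sq, polarPoint_apply_zero, polarPoint_apply_one]
  simp only [PiLp.zero_apply]
  linear_combination r ^ 2 * Real.sin_sq_add_cos_sq φ

lemma dist_polarPoint_receiver (r φ : ℝ) :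
    dist (polarPoint r φ) (receiver d 0 0) ^ 2 = r ^ 2 - 2 * r * d * Real.cos φ + d ^ 2 := by
  rw [Plane.dist_sq, polarPoint_apply_zero, polarPoint_apply_one]
  simp only [receiver_apply_zero, receiver_apply_one, PiLp.zero_apply, Real.cos_zero,
    Real.sin_zero]
  linear_combination r ^ 2 * Real.sin_sq_add_cos_sq φ

lemma dist_zero_receiver_polarPoint (r φ ϑ : ℝ) :
    dist 0 (receiver d (polarPoint r φ) ϑ) ^ 2 =
      r ^ 2 + 2 * r * d * Real.cos (φ - ϑ) + d ^ 2 := by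
  rw [Plane.dist_sq]
  simp only [receiver_apply_zero, receiver_apply_one, polarPoint_apply_zero, polarPoint_apply_one,
    PiLp.zero_apply, Real.cos_sub]
  linear_combination r ^ 2 * Real.sin_sq_add_cos_sq φ + d ^ 2 * Real.sin_sq_add_cos_sq ϑ

lemma polarPoint_mem_exclusionZone_iff (hRtx : 0 ≤ Rtx) {r : ℝ} (hr : 0 ≤ r) (φ ϑ : ℝ) :
    polarPoint r φ ∈ exclusionZone d Rcs Rtx 0 0 ↔
      (r, φ, ϑ) ∈ S₁ Rcs ∨ (r, φ, ϑ) ∈ S₂ d Rtx := by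
  have h : polarPoint r φ ∈ exclusionZone d Rcs Rtx 0 0 ↔ dist (polarPoint r φ) 0 ≤ Rcs ∨
    dist (polarPoint r φ) (receiver d 0 0) ≤ Rtx := Iff.rfl
  rw [h, dist_polarPoint_zero hr, ← sq_le_sq₀ dist_nonneg hRtx, dist_polarPoint_receiver]
  rfl

lemma zero_mem_exclusionZone_polarPoint_iff (hRtx : 0 ≤ Rtx) {r : ℝ} (hr : 0 ≤ r) (φ ϑ : ℝ) :
    (0 : Plane) ∈ exclusionZone d Rcs Rtx (polarPoint r φ) ϑ ↔
      (r, φ, ϑ) ∈ S₁ Rcs ∨ (r, φ, ϑ) ∈ S₃ d Rtx := by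
  have h : (0 : Plane) ∈ exclusionZone d Rcs Rtx (polarPoint r φ) ϑ ↔
    dist 0 (polarPoint r φ) ≤ Rcs ∨ dist 0 (receiver d (polarPoint r φ) ϑ) ≤ Rtx := Iff.rfl
  rw [h, dist_comm, dist_polarPoint_zero hr, ← sq_le_sq₀ dist_nonneg hRtx,
    dist_zero_receiver_polarPoint]
  rfl

end Zones

/-! ### Periodic integrals and polar coordinates. -/

/-- Half-open intervals of length `T` are fundamental domains for the translations by multiples of
`T`. -/
lemma setLIntegral_Ioc_eq_of_periodic {T : ℝ} (hT : 0 < T) {f : ℝ → ℝ≥0∞}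
    (hf : Function.Periodic f T) (a b : ℝ) :
    ∫⁻ x in Ioc a (a + T), f x = ∫⁻ x in Ioc b (b + T), f x := by
  refine (isAddFundamentalDomain_Ioc hT a volume).setLIntegral_eq
    (isAddFundamentalDomain_Ioc hT b volume) f ?_
  rintro ⟨g, hg⟩ x
  obtain ⟨n, rfl⟩ := AddSubgroup.mem_zmultiples_iff.1 hg
  rw [AddSubgroup.vadd_def, vadd_eq_add, add_comm]
  exact hf.zsmul n x

lemma setLIntegral_Icc_sub_of_periodic {T : ℝ} (hT : 0 < T) {f : ℝ → ℝ≥0∞}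
    (hf : Function.Periodic f T) (a : ℝ) :
    ∫⁻ x in Icc 0 T, f (x - a) = ∫⁻ x in Icc 0 T, f x := by
  rw [← restrict_Ioc_eq_restrict_Icc]
  have h := setLIntegral_Ioc_eq_of_periodic hT hf 0 (-a)
  rw [zero_add] at h
  rw [h, ← (measurePreserving_sub_right volume a).setLIntegral_comp_preimage_emb
    (MeasurableEquiv.subRight a).measurableEmbedding f]
  congr 2
  ext x
  simp only [mem_preimage, mem_Ioc]
  constructor <;> rintro ⟨h1, h2⟩ <;> constructor <;> linarith

lemma lintegral_plane_eq_polar {f : Plane → ℝ≥0∞} (hf : Measurable f) :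
    ∫⁻ v, f v = ∫⁻ r in Ioi (0 : ℝ), ∫⁻ φ in Icc (0 : ℝ) (2 * Real.pi),
      f (polarPoint r φ) * ENNReal.ofReal r := by
  have hmp : MeasurePreserving (fun p : ℝ × ℝ => (!₂[p.1, p.2] : Plane)) :=
    (PiLp.volume_preserving_toLp (Fin 2)).comp (volume_preserving_finTwoArrow ℝ).symm
  have hpol : Measurable fun p : ℝ × ℝ => polarPoint p.1 p.2 :=
    hmp.measurable.comp (f := fun p : ℝ × ℝ => (p.1 * Real.cos p.2, p.1 * Real.sin p.2))
      (by fun_prop)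
  rw [← hmp.lintegral_comp hf, ← lintegral_comp_polarCoord_symm]
  have ht : polarCoord.target = Ioi (0 : ℝ) ×ˢ Ioo (-Real.pi) Real.pi := rfl
  have hs : ∀ p : ℝ × ℝ, (!₂[(polarCoord.symm p).1, (polarCoord.symm p).2] : Plane)
      = polarPoint p.1 p.2 := fun p => rfl
  simp only [hs]
  rw [ht, Measure.volume_eq_prod, ← Measure.prod_restrict, lintegral_prod
    (fun p : ℝ × ℝ => ENNReal.ofReal p.1 • f (polarPoint p.1 p.2))
    (measurable_fst.ennreal_ofReal.smul (hf.comp hpol)).aemeasurable]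
  refine lintegral_congr fun r => ?_
  have hper : Function.Periodic (fun φ => f (polarPoint r φ) * ENNReal.ofReal r)
      (2 * Real.pi) := fun φ => by simp [polarPoint]
  have h := setLIntegral_Ioc_eq_of_periodic Real.two_pi_pos hper 0 (-Real.pi)
  rw [zero_add, show -Real.pi + 2 * Real.pi = Real.pi by ring] at h
  rw [← restrict_Ioc_eq_restrict_Icc, h, restrict_Ioo_eq_restrict_Ioc]
  exact lintegral_congr fun φ => mul_comm _ _

/-! ### The pair kernel and its invariance. -/

section

variable {lamp d Rcs Rtx : ℝ}

open Classical in
/-- The conditional probability that two transmitters with given marks are both retained. -/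
noncomputable def pairIntegrand (lamp d Rcs Rtx : ℝ) (x : Plane) (u : ℝ × ℝ) (y : Plane)
    (v : ℝ × ℝ) : ℝ≥0∞ :=
  (if Compatible d Rcs Rtx x u y v then 1 else 0) * ENNReal.ofReal (Real.exp
    (-lamp * ∑ k, pairLevels u.2 v.2 k * volume.real (pairRegions d Rcs Rtx x u.1 y v.1 k)))

/-- The probability that two transmitters with given orientations are both retained. -/
noncomputable def pairKernel (lamp d Rcs Rtx : ℝ) (x : Plane) (θ : ℝ) (y : Plane) (θ' : ℝ) :
    ℝ≥0∞ :=
  ∫⁻ s in Icc (0 : ℝ) 1, ∫⁻ t in Icc (0 : ℝ) 1, pairIntegrand lamp d Rcs Rtx x (θ, s) y (θ', t)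

lemma measurable_pairIntegrand {γ : Type*} [MeasurableSpace γ] {x y : γ → Plane}
    {u v : γ → ℝ × ℝ} (hx : Measurable x) (hu : Measurable u) (hy : Measurable y)
    (hv : Measurable v) :
    Measurable fun c => pairIntegrand lamp d Rcs Rtx (x c) (u c) (y c) (v c) := by
  refine (Measurable.ite (measurableSet_compatible hx hu hy hv) measurable_const
    measurable_const).mul (Measurable.ennreal_ofReal (Real.measurable_exp.comp
      (measurable_const.mul (Finset.measurable_sum _ fun k _ => Measurable.mul ?_ ?_))))
  · exact (measurable_pairLevels k).comp (hu.snd.prodMk hv.snd)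
  · refine Measurable.ennreal_toReal ?_
    have hs := measurableSet_mem_pairRegions (d := d) (Rcs := Rcs) (Rtx := Rtx)
      (γ := γ × Plane) (hx.comp measurable_fst) (hu.fst.comp measurable_fst)
      (hy.comp measurable_fst) (hv.fst.comp measurable_fst) measurable_snd k
    have h := measurable_measure_prodMk_left (ν := (volume : Measure Plane)) hs
    -- Removing two points changes no area and gives the sets whose joint measurability is known.
    have e : ∀ c, volume (pairRegions d Rcs Rtx (x c) (u c).1 (y c) (v c).1 k) =
        volume (pairRegions d Rcs Rtx (x c) (u c).1 (y c) (v c).1 k \ {x c, y c}) := fun c =>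
      (measure_sdiff_null (((countable_singleton (y c)).insert (x c)).measure_zero volume)).symm
    simp only [e]
    exact h

lemma measurable_pairKernel {γ : Type*} [MeasurableSpace γ] {x y : γ → Plane}
    {θ θ' : γ → ℝ} (hx : Measurable x) (hθ : Measurable θ) (hy : Measurable y)
    (hθ' : Measurable θ') :
    Measurable fun c => pairKernel lamp d Rcs Rtx (x c) (θ c) (y c) (θ' c) := by
  refine Measurable.lintegral_prod_right (f := fun c s => ∫⁻ t in Icc (0 : ℝ) 1,
    pairIntegrand lamp d Rcs Rtx (x c) (θ c, s) (y c) (θ' c, t)) ?_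
  refine Measurable.lintegral_prod_right (f := fun (q : γ × ℝ) t =>
    pairIntegrand lamp d Rcs Rtx (x q.1) (θ q.1, q.2) (y q.1) (θ' q.1, t)) ?_
  exact measurable_pairIntegrand (hx.comp measurable_fst.fst)
    ((hθ.comp measurable_fst.fst).prodMk measurable_fst.snd) (hy.comp measurable_fst.fst)
    ((hθ'.comp measurable_fst.fst).prodMk measurable_snd)

/-- A common rigid motion preserves both mutual memberships and the areas of the three regions, the
only data the kernel depends on. -/
lemma pairKernel_rigidMotion (x : Plane) (θ : ℝ) (y : Plane) (ϑ : ℝ) (y' : Plane) (ϑ' : ℝ) :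
    pairKernel lamp d Rcs Rtx (rigidMotion x θ y) (θ + ϑ) (rigidMotion x θ y') (θ + ϑ') =
      pairKernel lamp d Rcs Rtx y ϑ y' ϑ' := by
  have hv : ∀ k, volume.real (pairRegions d Rcs Rtx (rigidMotion x θ y) (θ + ϑ)
      (rigidMotion x θ y') (θ + ϑ') k) = volume.real (pairRegions d Rcs Rtx y ϑ y' ϑ' k) :=
    fun k => by
      rw [← (measurePreserving_rigidMotion x θ).measureReal_preimage
        (measurableSet_pairRegions _ _ _ _ k).nullMeasurableSet,
        rigidMotion_preimage_pairRegions]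
  classical
  refine lintegral_congr fun s => lintegral_congr fun t => ?_
  simp only [pairIntegrand, hv]
  congr 1
  exact if_congr (and_congr (imp_congr (rigidMotion_mem_exclusionZone _ _ _ _ _) Iff.rfl)
    (imp_congr (rigidMotion_mem_exclusionZone _ _ _ _ _) Iff.rfl)) rfl rfl

lemma pairKernel_periodic (x : Plane) (θ : ℝ) (y : Plane) :
    Function.Periodic (pairKernel lamp d Rcs Rtx x θ y) (2 * Real.pi) := fun θ' => by
  classical
  refine lintegral_congr fun s => lintegral_congr fun t => ?_
  simp only [pairIntegrand, pairRegions, exclusionZone_add_two_pi]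
  congr 1
  exact if_congr (and_congr Iff.rfl (by simp only [exclusionZone_add_two_pi])) rfl rfl

lemma unionArea_eq (hd : 0 ≤ d) (hR : Rtx ≤ Rcs) (r φ ϑ : ℝ) :
    unionArea d Rcs Rtx r φ ϑ = zoneArea d Rcs Rtx +
      volume.real (exclusionZone d Rcs Rtx (polarPoint r φ) ϑ \ exclusionZone d Rcs Rtx 0 0) := by
  rw [unionArea, zoneArea, ← measureReal_union disjoint_sdiff_right
    ((measurableSet_exclusionZone _ _).diff (measurableSet_exclusionZone _ _))
    (volume_exclusionZone_ne_top hd hR _ _)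
    (measure_ne_top_of_subset sdiff_subset (volume_exclusionZone_ne_top hd hR _ _)),
    union_sdiff_self]
  rfl

/-- Inside `S₁` the points suppress each other in both directions. Outside it, the law of cosines
turns the two memberships into `S₂` and `S₃`, and the integral over the stamps applies with `a = V -
Vo`. -/
lemma pairKernel_polarPoint (hl : 0 < lamp) (hd : 0 ≤ d) (hRtx : 0 ≤ Rtx) (hR : Rtx < Rcs)
    {r : ℝ} (hr : 0 ≤ r) (φ ϑ : ℝ) :
    pairKernel lamp d Rcs Rtx 0 0 (polarPoint r φ) ϑ =
      ENNReal.ofReal (kFun lamp d Rcs Rtx r φ ϑ) := by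
  classical
  have hRcs : 0 < Rcs := hRtx.trans_lt hR
  have hp := polarPoint_mem_exclusionZone_iff (d := d) (Rcs := Rcs) hRtx hr φ ϑ
  have hq := zero_mem_exclusionZone_polarPoint_iff (d := d) (Rcs := Rcs) hRtx hr φ ϑ
  by_cases h1 : (r, φ, ϑ) ∈ S₁ Rcs
  · have hp' := hp.2 (Or.inl h1)
    have hq' := hq.2 (Or.inl h1)
    have : ∀ s t : ℝ, ¬(s < t ∧ t < s) := fun s t h => lt_asymm h.1 h.2
    rw [kFun, if_pos (show (r, φ, ϑ) ∈ S₁ Rcs ∪ (S₂ d Rtx ∩ S₃ d Rtx) from Or.inl h1), ENNReal.ofReal_zero]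
    simp [pairKernel, pairIntegrand, Compatible, hp', hq', this]
  · have hr' : Rcs < dist (polarPoint r φ) 0 := by
      rw [dist_polarPoint_zero hr]; exact not_le.1 h1
    set Z : Plane → ℝ → Set Plane := exclusionZone d Rcs Rtx with hZ
    have hm : ∀ x θ, MeasurableSet (Z x θ) := measurableSet_exclusionZone
    have hfin : ∀ x θ, volume (Z x θ) ≠ ∞ := volume_exclusionZone_ne_top hd hR.le
    have hvol : ∀ x θ, volume.real (Z x θ) = zoneArea d Rcs Rtx := volume_real_exclusionZone
    set a := volume.real (Z (polarPoint r φ) ϑ \ Z 0 0) with ha_def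
    -- This needs the point to be outside the sensing disc; it excludes the degenerate value `V =
    -- Vo` of `beta`.
    have ha : 0 < a := ENNReal.toReal_pos (volume_exclusionZone_sdiff_pos hRcs hR hr' 0 ϑ).ne'
      (measure_ne_top_of_subset sdiff_subset (hfin _ _))
    have hi1 := measureReal_inter_add_sdiff (μ := volume) (s := Z (polarPoint r φ) ϑ)
      (hm 0 0) (hfin _ _)
    have hi2 := measureReal_inter_add_sdiff (μ := volume) (s := Z 0 0)
      (hm (polarPoint r φ) ϑ) (hfin _ _)
    rw [inter_comm] at hi1
    rw [hvol] at hi1 hi2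
    -- Since the zones have equal area and a common intersection, the two one-sided differences have
    -- equal area as well.
    have h := lintegral_lintegral_pairLevels hl ha (zoneArea_pos hd hR.le hRcs)
      (polarPoint r φ ∈ Z 0 0) (0 ∈ Z (polarPoint r φ) ϑ)
      (A := fun k => volume.real (pairRegions d Rcs Rtx 0 0 (polarPoint r φ) ϑ k))
      (by change volume.real (Z 0 0 \ Z (polarPoint r φ) ϑ) = a; linarith)
      rfl
      (by change volume.real (Z 0 0 ∩ Z (polarPoint r φ) ϑ) = _; linarith)
    refine Eq.trans (lintegral_congr fun s => lintegral_congr fun t => ?_) (h.trans ?_)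
    · simp only [pairIntegrand]
      congr 1
      exact if_congr Iff.rfl rfl rfl
    · have hun : unionArea d Rcs Rtx r φ ϑ = zoneArea d Rcs Rtx + a :=
        unionArea_eq hd hR.le r φ ϑ
      rw [kFun, hun, hp, hq]
      by_cases h2 : (r, φ, ϑ) ∈ S₂ d Rtx <;> by_cases h3 : (r, φ, ϑ) ∈ S₃ d Rtx <;>
        simp [h1, h2, h3]

end

/-! ### Integration over orientations and over the window. -/

lemma lintegral_angleLaw (f : ℝ → ℝ≥0∞) :
    ∫⁻ θ, f θ ∂angleLaw =
      (ENNReal.ofReal (2 * Real.pi))⁻¹ * ∫⁻ θ in Icc 0 (2 * Real.pi), f θ := by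
  rw [angleLaw, ProbabilityTheory.cond, lintegral_smul_measure, smul_eq_mul, Real.volume_Icc, sub_zero]

lemma continuous_rotate : Continuous fun q : ℝ × Plane => rotate q.1 q.2 := by
  unfold rotate
  have h0 : Continuous fun q : ℝ × Plane => q.2 0 := (PiLp.continuous_apply 2 _ 0).comp continuous_snd
  have h1 : Continuous fun q : ℝ × Plane => q.2 1 := (PiLp.continuous_apply 2 _ 1).comp continuous_snd
  have hc := Real.continuous_cos.comp (continuous_fst (X := ℝ) (Y := Plane))
  have hs := Real.continuous_sin.comp (continuous_fst (X := ℝ) (Y := Plane))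
  refine (PiLp.continuous_toLp 2 _).comp (continuous_pi fun i => ?_)
  fin_cases i
  exacts [(hc.mul h0).sub (hs.mul h1), (hs.mul h0).add (hc.mul h1)]

lemma Measurable.rotate {α : Type*} [MeasurableSpace α] {f : α → ℝ} {g : α → Plane}
    (hf : Measurable f) (hg : Measurable g) : Measurable fun a => rotate (f a) (g a) := by
  have h := continuous_rotate.measurable.comp (hf.prodMk hg)
  simp only [Function.comp_def] at h
  exact h

section

variable {lamp d Rcs Rtx : ℝ}

lemma lintegral_pairIntegrand (x y : Plane) {g : ℝ → ℝ≥0∞} (hg : Measurable g) :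
    ∫⁻ w, g w.1.1 * pairIntegrand lamp d Rcs Rtx x w.1 y w.2 ∂(markLaw.prod markLaw) =
      ∫⁻ θ, ∫⁻ θ', g θ * pairKernel lamp d Rcs Rtx x θ y θ'
        ∂angleLaw ∂angleLaw := by
  have hm : Measurable fun w : (ℝ × ℝ) × (ℝ × ℝ) =>
      g w.1.1 * pairIntegrand lamp d Rcs Rtx x w.1 y w.2 :=
    (hg.comp measurable_fst.fst).mul
      (measurable_pairIntegrand measurable_const measurable_fst measurable_const measurable_snd)
  rw [lintegral_prod _ hm.aemeasurable]
  unfold markLaw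
  rw [lintegral_prod _ hm.lintegral_prod_right'.aemeasurable]
  refine lintegral_congr fun θ => ?_
  have hs : ∀ s, ∫⁻ v, g θ * pairIntegrand lamp d Rcs Rtx x (θ, s) y v
        ∂angleLaw.prod (volume.restrict (Icc 0 1)) =
      ∫⁻ θ', ∫⁻ t, g θ * pairIntegrand lamp d Rcs Rtx x (θ, s) y (θ', t)
        ∂volume.restrict (Icc 0 1) ∂angleLaw := fun s =>
    lintegral_prod (fun v => g θ * pairIntegrand lamp d Rcs Rtx x (θ, s) y v)
      (hm.comp (measurable_prodMk_left (x := (θ, s)))).aemeasurable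
  simp only [hs]
  rw [lintegral_lintegral_swap]
  · refine lintegral_congr fun θ' => ?_
    rw [pairKernel, ← lintegral_const_mul]
    · refine lintegral_congr fun s => ?_
      rw [lintegral_const_mul]
      exact measurable_pairIntegrand measurable_const measurable_const measurable_const
        (measurable_const.prodMk measurable_id)
    · refine Measurable.lintegral_prod_right (f := fun s t =>
        pairIntegrand lamp d Rcs Rtx x (θ, s) y (θ', t)) ?_
      exact measurable_pairIntegrand measurable_const (measurable_const.prodMk measurable_fst)
        measurable_const (measurable_const.prodMk measurable_snd)
  · refine Measurable.aemeasurable ?_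
    refine Measurable.lintegral_prod_right (f := fun (q : ℝ × ℝ) t =>
      g θ * pairIntegrand lamp d Rcs Rtx x (θ, q.1) y (q.2, t)) ?_
    exact measurable_const.mul (measurable_pairIntegrand measurable_const
      (measurable_const.prodMk measurable_fst.fst) measurable_const
      (measurable_fst.snd.prodMk measurable_snd))

lemma lintegral_markLaw_pairIntegrand {f : Plane → ℝ → Plane → ℝ≥0∞}
    (hf : Measurable fun q : Plane × ℝ × Plane => f q.1 q.2.1 q.2.2) :
    ∫⁻ w, (∫⁻ x, ∫⁻ y, f x w.1.1 y * pairIntegrand lamp d Rcs Rtx x w.1 y w.2)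
        ∂(markLaw.prod markLaw) =
      ∫⁻ x, ∫⁻ y, ∫⁻ θ, ∫⁻ θ', f x θ y * pairKernel lamp d Rcs Rtx x θ y θ'
        ∂angleLaw ∂angleLaw := by
  have hm : Measurable fun q : ((ℝ × ℝ) × (ℝ × ℝ)) × (Plane × Plane) =>
      f q.2.1 q.1.1.1 q.2.2 * pairIntegrand lamp d Rcs Rtx q.2.1 q.1.1 q.2.2 q.1.2 :=
    (hf.comp (measurable_snd.fst.prodMk (measurable_fst.fst.fst.prodMk measurable_snd.snd))).mul
      (measurable_pairIntegrand measurable_snd.fst measurable_fst.fst measurable_snd.snd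
        measurable_fst.snd)
  have h1 : ∀ w : (ℝ × ℝ) × (ℝ × ℝ),
      ∫⁻ x, ∫⁻ y, f x w.1.1 y * pairIntegrand lamp d Rcs Rtx x w.1 y w.2 =
      ∫⁻ p : Plane × Plane, f p.1 w.1.1 p.2 * pairIntegrand lamp d Rcs Rtx p.1 w.1 p.2 w.2 :=
    fun w => (lintegral_prod _ (hm.comp measurable_prodMk_left).aemeasurable).symm
  simp only [h1]
  have h2 : Measurable fun p : Plane × Plane => ∫⁻ w,
      f p.1 w.1.1 p.2 * pairIntegrand lamp d Rcs Rtx p.1 w.1 p.2 w.2 ∂(markLaw.prod markLaw) :=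
    (hm.comp measurable_swap).lintegral_prod_right'
  rw [lintegral_lintegral_swap hm.aemeasurable, Measure.volume_eq_prod,
    lintegral_prod _ h2.aemeasurable]
  refine lintegral_congr fun x => lintegral_congr fun y => ?_
  exact lintegral_pairIntegrand x y (hf.comp
    (measurable_const.prodMk (measurable_id.prodMk measurable_const)))

/-- Substitute `y = rigidMotion x θ v`. By invariance `θ'` enters only as `θ' - θ`, and this shift
disappears over a full period. The result is free of `x` and `θ`. -/
lemma lintegral_rotate_sub_mul_pairKernel (x : Plane) (θ : ℝ) {h : Plane → ℝ≥0∞}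
    (hh : Measurable h) :
    ∫⁻ y, ∫⁻ θ', h (rotate (-θ) (y - x)) * pairKernel lamp d Rcs Rtx x θ y θ'
        ∂angleLaw =
      (ENNReal.ofReal (2 * Real.pi))⁻¹ * ∫⁻ v, h v *
        ∫⁻ ϑ in Icc 0 (2 * Real.pi), pairKernel lamp d Rcs Rtx 0 0 v ϑ := by
  have hrot : Measurable fun y : Plane => rotate (-θ) (y - x) :=
    measurable_const.rotate (measurable_id.sub_const x)
  have hm : Measurable fun y => ∫⁻ θ', h (rotate (-θ) (y - x)) *
      pairKernel lamp d Rcs Rtx x θ y θ' ∂angleLaw := by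
    refine Measurable.lintegral_prod_right (f := fun y θ' => h (rotate (-θ) (y - x)) *
      pairKernel lamp d Rcs Rtx x θ y θ') ?_
    exact (hh.comp (hrot.comp measurable_fst)).mul
      (measurable_pairKernel measurable_const measurable_const measurable_fst measurable_snd)
  rw [← (measurePreserving_rigidMotion x θ).lintegral_comp hm, ← lintegral_const_mul']
  · refine lintegral_congr fun v => ?_
    have hk : ∀ θ', pairKernel lamp d Rcs Rtx x θ (rigidMotion x θ v) θ' =
        pairKernel lamp d Rcs Rtx 0 0 v (θ' - θ) := fun θ' => by
      have := pairKernel_rigidMotion (lamp := lamp) (d := d) (Rcs := Rcs) (Rtx := Rtx) x θ 0 0 v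
        (θ' - θ)
      rwa [rigidMotion_zero, add_zero, add_sub_cancel] at this
    have hv : rotate (-θ) (rigidMotion x θ v - x) = v := (rigidMotion x θ).symm_apply_apply v
    simp only [hk, hv]
    rw [lintegral_const_mul, lintegral_angleLaw,
      setLIntegral_Icc_sub_of_periodic Real.two_pi_pos (pairKernel_periodic 0 0 v), mul_left_comm]
    exact measurable_pairKernel measurable_const measurable_const measurable_const
      (measurable_id.sub_const θ)
  · exact ENNReal.inv_ne_top.2 (ENNReal.ofReal_pos.2 Real.two_pi_pos).ne'

/-- The inner integral does not depend on the reference pair, so averaging over the window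
multiplies it by `|B|` and by the probability of `L` under the uniform orientation law. -/
lemma lintegral_window_pairKernel {B : Set Plane} (hB : MeasurableSet B) {L : Set ℝ}
    (hL : MeasurableSet L) (hL' : L ⊆ Icc 0 (2 * Real.pi)) {h : Plane → ℝ≥0∞}
    (hh : Measurable h) :
    ∫⁻ x, ∫⁻ y, ∫⁻ θ, ∫⁻ θ', B.indicator 1 x * L.indicator 1 θ * h (rotate (-θ) (y - x)) *
        pairKernel lamp d Rcs Rtx x θ y θ'
        ∂angleLaw ∂angleLaw =
      volume B * (volume L / ENNReal.ofReal (2 * Real.pi)) *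
        ((ENNReal.ofReal (2 * Real.pi))⁻¹ * ∫⁻ v, h v *
          ∫⁻ ϑ in Icc 0 (2 * Real.pi), pairKernel lamp d Rcs Rtx 0 0 v ϑ) := by
  set I := (ENNReal.ofReal (2 * Real.pi))⁻¹ * ∫⁻ v, h v *
    ∫⁻ ϑ in Icc 0 (2 * Real.pi), pairKernel lamp d Rcs Rtx 0 0 v ϑ
  have hrot : Measurable fun q : (Plane × Plane) × ℝ => rotate (-q.2) (q.1.2 - q.1.1) :=
    measurable_snd.neg.rotate (measurable_fst.snd.sub measurable_fst.fst)
  have hx : ∀ x, ∫⁻ y, ∫⁻ θ, ∫⁻ θ', B.indicator 1 x * L.indicator 1 θ *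
        h (rotate (-θ) (y - x)) * pairKernel lamp d Rcs Rtx x θ y θ'
        ∂angleLaw ∂angleLaw =
      B.indicator 1 x * ((volume L / ENNReal.ofReal (2 * Real.pi)) * I) := fun x => by
    rw [lintegral_lintegral_swap]
    · have hθ : ∀ θ, ∫⁻ y, ∫⁻ θ', B.indicator 1 x * L.indicator 1 θ *
          h (rotate (-θ) (y - x)) * pairKernel lamp d Rcs Rtx x θ y θ'
          ∂angleLaw = L.indicator 1 θ * (B.indicator 1 x * I) :=
        fun θ => by
          have hc : B.indicator (1 : Plane → ℝ≥0∞) x * L.indicator (1 : ℝ → ℝ≥0∞) θ ≠ ∞ := by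
            by_cases h1 : x ∈ B <;> by_cases h2 : θ ∈ L <;> simp [h1, h2]
          simp only [mul_assoc (B.indicator (1 : Plane → ℝ≥0∞) x * L.indicator 1 θ)]
          simp only [lintegral_const_mul' _ _ hc]
          rw [lintegral_rotate_sub_mul_pairKernel x θ hh, mul_comm (B.indicator 1 x), mul_assoc]
      simp only [hθ]
      rw [lintegral_mul_const _ (measurable_one.indicator hL), lintegral_indicator_one hL,
        angleLaw, cond_apply measurableSet_Icc, inter_eq_self_of_subset_right hL', Real.volume_Icc, sub_zero,
        ENNReal.div_eq_inv_mul]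
      ring
    · refine Measurable.aemeasurable ?_
      refine Measurable.lintegral_prod_right (f := fun (q : Plane × ℝ) θ' =>
        B.indicator 1 x * L.indicator 1 q.2 * h (rotate (-q.2) (q.1 - x)) *
          pairKernel lamp d Rcs Rtx x q.2 q.1 θ') ?_
      refine ((measurable_const.mul ((measurable_one.indicator hL).comp measurable_fst.snd)).mul
        (hh.comp (hrot.comp ((measurable_const.prodMk measurable_fst.fst).prodMk
          measurable_fst.snd)))).mul ?_
      exact measurable_pairKernel measurable_const measurable_fst.snd measurable_fst.fst
        measurable_snd
  simp only [hx]
  rw [lintegral_mul_const _ (measurable_one.indicator hB), lintegral_indicator_one hB, mul_assoc]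

lemma lintegral_mul_pairKernel_eq_polar (hl : 0 < lamp) (hd : 0 ≤ d) (hRtx : 0 ≤ Rtx)
    (hR : Rtx < Rcs) {l : ℝ → ℝ≥0∞} (hlm : Measurable l) :
    ∫⁻ v, l (dist v (receiver d 0 0)) *
        ∫⁻ ϑ in Icc 0 (2 * Real.pi), pairKernel lamp d Rcs Rtx 0 0 v ϑ =
      ∫⁻ r in Ioi (0 : ℝ), ∫⁻ φ in Icc (0 : ℝ) (2 * Real.pi),
        ∫⁻ ϑ in Icc (0 : ℝ) (2 * Real.pi),
          l (Real.sqrt (r ^ 2 - 2 * r * d * Real.cos φ + d ^ 2)) *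
            ENNReal.ofReal (kFun lamp d Rcs Rtx r φ ϑ) * ENNReal.ofReal r := by
  have hpk : ∀ v, Measurable fun ϑ => pairKernel lamp d Rcs Rtx 0 0 v ϑ := fun v =>
    measurable_pairKernel measurable_const measurable_const measurable_const measurable_id
  rw [lintegral_plane_eq_polar]
  · refine setLIntegral_congr_fun measurableSet_Ioi fun r hr => lintegral_congr fun φ => ?_
    have hr0 : 0 ≤ r := le_of_lt hr
    rw [← dist_polarPoint_receiver, Real.sqrt_sq dist_nonneg, ← lintegral_const_mul _ (hpk _),
      ← lintegral_mul_const (f := fun ϑ => l (dist (polarPoint r φ) (receiver d 0 0)) *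
        pairKernel lamp d Rcs Rtx 0 0 (polarPoint r φ) ϑ) _ (measurable_const.mul (hpk _))]
    refine lintegral_congr fun ϑ => ?_
    rw [pairKernel_polarPoint hl hd hRtx hR hr0]
  · refine (hlm.comp (measurable_id.dist measurable_const)).mul ?_
    refine Measurable.lintegral_prod_right (f := fun v ϑ =>
      pairKernel lamp d Rcs Rtx 0 0 v ϑ) ?_
    exact measurable_pairKernel measurable_const measurable_const measurable_fst measurable_snd

lemma lintegral_markLaw_zone (hl : 0 < lamp) (hd : 0 ≤ d) (hRcs : 0 < Rcs) (hR : Rtx ≤ Rcs)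
    {B : Set Plane} (hB : MeasurableSet B) :
    ∫⁻ u, (ENNReal.ofReal lamp * ∫⁻ x, B.indicator 1 x * ENNReal.ofReal (Real.exp
        (-lamp * (u.2 * volume.real (exclusionZone d Rcs Rtx x u.1))))) ∂markLaw =
      ENNReal.ofReal ((1 - Real.exp (-lamp * zoneArea d Rcs Rtx)) / zoneArea d Rcs Rtx) *
        volume B := by
  have hV := zoneArea_pos hd hR hRcs
  simp only [volume_real_exclusionZone]
  have hu : ∀ u : ℝ × ℝ, ENNReal.ofReal lamp * ∫⁻ x, B.indicator 1 x * ENNReal.ofReal (Real.exp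
        (-lamp * (u.2 * zoneArea d Rcs Rtx))) = (ENNReal.ofReal lamp * volume B) *
      ENNReal.ofReal (Real.exp (-(lamp * zoneArea d Rcs Rtx * u.2))) := fun u => by
    rw [lintegral_mul_const _ (measurable_one.indicator hB), lintegral_indicator_one hB, mul_assoc,
      show -lamp * (u.2 * zoneArea d Rcs Rtx) = -(lamp * zoneArea d Rcs Rtx * u.2) by ring]
  simp only [hu]
  rw [lintegral_const_mul _ (by fun_prop), markLaw, lintegral_prod _ (by fun_prop)]
  simp only
  rw [lintegral_const, measure_univ, mul_one,
    setLIntegral_exp_neg_mul (mul_pos hl hV) zero_le_one, mul_right_comm,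
    ← ENNReal.ofReal_mul hl.le]
  congr 2
  rw [show -(lamp * zoneArea d Rcs Rtx * 1) = -lamp * zoneArea d Rcs Rtx by ring]
  field_simp

end

/-! ### Intensity and reduced Palm expectation. -/

lemma measurableSet_unitSquare : MeasurableSet unitSquare := by
  simp only [unitSquare, ofPred_forall]
  exact MeasurableSet.iInter fun i =>
    measurableSet_Icc.preimage (PiLp.continuous_apply 2 (fun _ : Fin 2 => ℝ) i).measurable

lemma volume_unitSquare : volume unitSquare = 1 := by
  have h : unitSquare = WithLp.ofLp ⁻¹' Icc (0 : Fin 2 → ℝ) 1 := by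
    ext x
    simp [unitSquare, Pi.le_def, forall_and]
  rw [h, (PiLp.volume_preserving_ofLp (Fin 2)).measure_preimage measurableSet_Icc.nullMeasurableSet,
    Real.volume_Icc_pi]
  simp

open Classical in
lemma encard_image_inter_eq_tsum {α : Type*} {x : ℕ → α} (hx : Function.Injective x) (I : Set ℕ)
    (B : Set α) : ((x '' I ∩ B).encard : ℝ≥0∞) =
      ∑' i, B.indicator 1 (x i) * (if i ∈ I then 1 else 0) := by
  rw [← image_inter_preimage, hx.injOn.encard_image, ← ENNReal.tsum_set_one,
    tsum_subtype (I ∩ x ⁻¹' B) (fun _ => (1 : ℝ≥0∞))]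
  refine tsum_congr fun i => ?_
  by_cases h1 : i ∈ I <;> by_cases h2 : x i ∈ B <;> simp [h1, h2]

-- Turns the sum over a set of pairs, as in the Palm expectation, into a sum over indices. Distinct
-- locations ensure that no term is counted twice or lost, and removing the reference pair becomes
-- `i ≠ j`.
open Classical in
lemma tsum_interference_viewFrom {x : ℕ → Plane} (hx : Function.Injective x) (t : ℕ → ℝ)
    (I : Set ℕ) (B : Set Plane) (L : Set ℝ) (Pt : ℝ) (l : ℝ → ℝ≥0∞) (z : Plane) :
    ∑' p : ↥((fun i => (x i, t i)) '' I ∩ B ×ˢ L),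
        interference Pt l z (viewFrom p '' ((fun i => (x i, t i)) '' I \ {(p : Plane × ℝ)})) =
      ∑' i, ∑' j, if i ≠ j ∧ i ∈ I ∧ j ∈ I then
        B.indicator 1 (x i) * L.indicator 1 (t i) *
          (ENNReal.ofReal Pt * l (dist (rotate (-t i) (x j - x i)) z)) else 0 := by
  set e : ℕ → Plane × ℝ := fun i => (x i, t i)
  have he : Function.Injective e := fun i j h => hx (congrArg Prod.fst h)
  rw [← image_inter_preimage,
    tsum_image (fun p => interference Pt l z (viewFrom p '' (e '' I \ {p}))) he.injOn,
    tsum_subtype (I ∩ e ⁻¹' B ×ˢ L)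
      (fun i => interference Pt l z (viewFrom (e i) '' (e '' I \ {e i})))]
  refine tsum_congr fun i => ?_
  by_cases hi : i ∈ I ∩ e ⁻¹' B ×ˢ L
  · have hB : x i ∈ B := hi.2.1
    have hL : t i ∈ L := hi.2.2
    -- The location alone suffices for this; the orientation, reduced modulo `2 * π`, is not needed.
    have hv : Function.Injective fun j => viewFrom (e i) (e j) := fun j k h => by
      have h1 : rotate (-t i) (x j - x i) = rotate (-t i) (x k - x i) := congrArg Prod.fst h
      have h2 := congrArg (rotate (- -t i)) h1
      rw [rotate_neg_rotate, rotate_neg_rotate] at h2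
      exact hx (sub_left_injective h2)
    rw [indicator_of_mem hi, ← image_singleton, ← image_sdiff he, image_image, interference,
      tsum_image (fun q : Plane × ℝ => ENNReal.ofReal Pt * l (dist q.1 z)) hv.injOn,
      tsum_subtype (I \ {i})
        (fun j => ENNReal.ofReal Pt * l (dist (viewFrom (e i) (e j)).1 z))]
    refine tsum_congr fun j => ?_
    by_cases hj : j ∈ I <;> by_cases hij : i = j
    all_goals simp [hB, hL, hj, hij, hi.1, eq_comm, viewFrom, e]
  · rw [indicator_of_notMem hi]
    symm
    rw [ENNReal.tsum_eq_zero]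
    intro j
    by_cases h : i ∈ I
    · by_cases hB : x i ∈ B
      · have hL : t i ∉ L := fun hL => hi ⟨h, hB, hL⟩
        simp [hL]
      · simp [hB]
    · simp [h]

lemma retainedPairs_eq_image {Ω : Type*} (d Rcs Rtx : ℝ) (X : ℕ → Ω → Plane) (θ m : ℕ → Ω → ℝ)
    (ω : Ω) : retainedPairs d Rcs Rtx X θ m ω =
      (fun i => (X i ω, θ i ω)) '' {i | Retained d Rcs Rtx X θ m i ω} := by
  ext p
  simp [retainedPairs, eq_comm]

lemma retainedTransmitters_eq_image {Ω : Type*} (d Rcs Rtx : ℝ) (X : ℕ → Ω → Plane)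
    (θ m : ℕ → Ω → ℝ) (ω : Ω) : retainedTransmitters d Rcs Rtx X θ m ω =
      (fun i => X i ω) '' {i | Retained d Rcs Rtx X θ m i ω} := by
  rw [retainedTransmitters, retainedPairs_eq_image, image_image]

namespace IsMarkedPoissonProcess

variable {d Rcs Rtx : ℝ} {Ω : Type*} [MeasurableSpace Ω] {P : Measure Ω} [IsProbabilityMeasure P]
  {lamp : ℝ} {X : ℕ → Ω → Plane} {θ m : ℕ → Ω → ℝ}

/-- The retained transmitters have intensity `(1 - exp (-λ V)) / V`. -/
lemma meanCount_retainedTransmitters (hX : IsMarkedPoissonProcess P lamp X θ m) (hl : 0 < lamp)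
    (hd : 0 ≤ d) (hRcs : 0 < Rcs) (hR : Rtx ≤ Rcs) {B : Set Plane} (hB : MeasurableSet B) :
    meanCount P (retainedTransmitters d Rcs Rtx X θ m) B =
      ENNReal.ofReal ((1 - Real.exp (-lamp * zoneArea d Rcs Rtx)) / zoneArea d Rcs Rtx) *
        volume B := by
  classical
  rw [← lintegral_markLaw_zone hl hd hRcs hR hB,
    ← hX.lintegral_tsum_retained hl.le hd hR (measurable_one.indicator hB), meanCount]
  refine lintegral_congr_ae ?_
  filter_upwards [hX.poisson.ae_injective hl.le] with ω hω
  rw [retainedTransmitters_eq_image, encard_image_inter_eq_tsum hω]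
  rfl

/-- The numerator of the reduced Palm expectation of the interference. -/
lemma lintegral_tsum_interference (hX : IsMarkedPoissonProcess P lamp X θ m) (hl : 0 < lamp)
    (hd : 0 ≤ d) (hRtx : 0 ≤ Rtx) (hR : Rtx < Rcs) (Pt : ℝ) {l : ℝ → ℝ≥0∞} (hlm : Measurable l)
    {B : Set Plane} (hB : MeasurableSet B) {L : Set ℝ} (hL : MeasurableSet L)
    (hL' : L ⊆ Icc 0 (2 * Real.pi)) :
    ∫⁻ ω, ∑' p : ↥(retainedPairs d Rcs Rtx X θ m ω ∩ B ×ˢ L),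
        interference Pt l (receiver d 0 0)
          (viewFrom p '' (retainedPairs d Rcs Rtx X θ m ω \ {(p : Plane × ℝ)})) ∂P =
      ENNReal.ofReal lamp ^ 2 * (volume B * (volume L / ENNReal.ofReal (2 * Real.pi)) *
        ((ENNReal.ofReal (2 * Real.pi))⁻¹ * (ENNReal.ofReal Pt *
          ∫⁻ r in Ioi (0 : ℝ), ∫⁻ φ in Icc (0 : ℝ) (2 * Real.pi),
            ∫⁻ ϑ in Icc (0 : ℝ) (2 * Real.pi),
              l (Real.sqrt (r ^ 2 - 2 * r * d * Real.cos φ + d ^ 2)) *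
                ENNReal.ofReal (kFun lamp d Rcs Rtx r φ ϑ) * ENNReal.ofReal r))) := by
  classical
  have hh : Measurable fun v : Plane => ENNReal.ofReal Pt * l (dist v (receiver d 0 0)) :=
    measurable_const.mul (hlm.comp (measurable_id.dist measurable_const))
  have hf : Measurable fun q : Plane × ℝ × Plane => B.indicator 1 q.1 * L.indicator 1 q.2.1 *
      (ENNReal.ofReal Pt * l (dist (rotate (-q.2.1) (q.2.2 - q.1)) (receiver d 0 0))) :=
    (((measurable_one.indicator hB).comp measurable_fst).mul
      ((measurable_one.indicator hL).comp measurable_snd.fst)).mul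
      (hh.comp (measurable_snd.fst.neg.rotate (measurable_snd.snd.sub measurable_fst)))
  have h1 := hX.lintegral_tsum_retained_pairs hl.le hd hR.le
    (f := fun x θ y => B.indicator 1 x * L.indicator 1 θ *
      (ENNReal.ofReal Pt * l (dist (rotate (-θ) (y - x)) (receiver d 0 0)))) hf
  have h2 := lintegral_markLaw_pairIntegrand (lamp := lamp) (d := d) (Rcs := Rcs) (Rtx := Rtx)
    (f := fun x θ y => B.indicator 1 x * L.indicator 1 θ *
      (ENNReal.ofReal Pt * l (dist (rotate (-θ) (y - x)) (receiver d 0 0)))) hf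
  have h3 := lintegral_window_pairKernel (lamp := lamp) (d := d) (Rcs := Rcs) (Rtx := Rtx)
    hB hL hL' hh
  rw [lintegral_const_mul' _ _ (ENNReal.pow_ne_top ENNReal.ofReal_ne_top)] at h1
  simp only [pairIntegrand, ← mul_assoc] at h2
  simp only [← mul_assoc] at h1
  rw [h2] at h1
  simp only [← mul_assoc] at h3
  rw [h3] at h1
  simp only [mul_assoc (ENNReal.ofReal Pt)] at h1
  rw [lintegral_const_mul' _ _ ENNReal.ofReal_ne_top,
    lintegral_mul_pairKernel_eq_polar hl hd hRtx hR hlm] at h1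
  simp only [← mul_assoc]
  simp only [← mul_assoc] at h1
  rw [← h1]
  refine lintegral_congr_ae ?_
  filter_upwards [hX.poisson.ae_injective hl.le] with ω hω
  rw [retainedPairs_eq_image, tsum_interference_viewFrom hω]
  simp only [← mul_assoc]
  rfl

end IsMarkedPoissonProcess

theorem theorem2 {Ω : Type*} [MeasurableSpace Ω] (P : Measure Ω) [IsProbabilityMeasure P]
    (lamp d Rcs Rtx Pt : ℝ) (hlamp : 0 < lamp) (hd : 0 < d) (hRtx : 0 < Rtx) (hR : Rtx < Rcs)
    (hPt : 0 < Pt) (l : ℝ → ℝ≥0∞) (hl : Measurable l)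
    (X : ℕ → Ω → Plane) (θ m : ℕ → Ω → ℝ) (hX : IsMarkedPoissonProcess P lamp X θ m)
    (lam : ℝ≥0∞) (hlam : lam = intensity P (retainedTransmitters d Rcs Rtx X θ m)) :
    (∀ B : Set Plane, MeasurableSet B →
      meanCount P (retainedTransmitters d Rcs Rtx X θ m) B = lam * volume B) ∧
    lam = ENNReal.ofReal
      ((1 - Real.exp (-lamp * zoneArea d Rcs Rtx)) / zoneArea d Rcs Rtx) ∧
    ∀ (B : Set Plane) (L : Set ℝ), MeasurableSet B → volume B ≠ 0 → volume B ≠ ∞ →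
      MeasurableSet L → L ⊆ Icc 0 (2 * Real.pi) → volume L ≠ 0 →
      reducedPalmExpectation P (retainedPairs d Rcs Rtx X θ m) B L
          (interference Pt l (receiver d 0 0)) =
        ENNReal.ofReal (lamp ^ 2 * Pt / (2 * Real.pi * lam.toReal)) *
          ∫⁻ r in Ioi (0 : ℝ), ∫⁻ φ in Icc (0 : ℝ) (2 * Real.pi),
            ∫⁻ ϑ in Icc (0 : ℝ) (2 * Real.pi),
              l (Real.sqrt (r ^ 2 - 2 * r * d * Real.cos φ + d ^ 2)) *
                ENNReal.ofReal (kFun lamp d Rcs Rtx r φ ϑ) * ENNReal.ofReal r := by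
  have hV := zoneArea_pos hd.le hR.le (hRtx.trans hR)
  have hcount : ∀ B : Set Plane, MeasurableSet B → _ := fun B hB =>
    hX.meanCount_retainedTransmitters hlamp hd.le (hRtx.trans hR) hR.le hB
  have hlam' : lam = ENNReal.ofReal
      ((1 - Real.exp (-lamp * zoneArea d Rcs Rtx)) / zoneArea d Rcs Rtx) := by
    rw [hlam, intensity, hcount _ measurableSet_unitSquare, volume_unitSquare, mul_one]
  refine ⟨fun B hB => by rw [hcount B hB, hlam'], hlam', fun B L hB hB0 hB1 hL hL' hL0 => ?_⟩
  rw [reducedPalmExpectation,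
    hX.lintegral_tsum_interference hlamp hd.le hRtx.le hR Pt hl hB hL hL',
    show intensity P (fun ω => Prod.fst '' retainedPairs d Rcs Rtx X θ m ω) = lam from hlam.symm]
  set J := ∫⁻ r in Ioi (0 : ℝ), ∫⁻ φ in Icc (0 : ℝ) (2 * Real.pi),
    ∫⁻ ϑ in Icc (0 : ℝ) (2 * Real.pi),
      l (Real.sqrt (r ^ 2 - 2 * r * d * Real.cos φ + d ^ 2)) *
        ENNReal.ofReal (kFun lamp d Rcs Rtx r φ ϑ) * ENNReal.ofReal r
  have hq : 0 < (1 - Real.exp (-lamp * zoneArea d Rcs Rtx)) / zoneArea d Rcs Rtx := by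
    refine div_pos (sub_pos.2 (Real.exp_lt_one_iff.2 ?_)) hV
    rw [neg_mul]
    exact neg_lt_zero.2 (mul_pos hlamp hV)
  set q := (1 - Real.exp (-lamp * zoneArea d Rcs Rtx)) / zoneArea d Rcs Rtx
  have hpi : ENNReal.ofReal (2 * Real.pi) ≠ 0 := (ENNReal.ofReal_pos.2 Real.two_pi_pos).ne'
  have hLtop : volume L ≠ ∞ := by
    refine ((measure_mono hL').trans_lt ?_).ne
    rw [Real.volume_Icc]
    exact ENNReal.ofReal_lt_top
  -- The window factor is neither `0` nor `∞`, so it cancels in `ℝ≥0∞`.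
  have hk0 : volume B * (volume L / ENNReal.ofReal (2 * Real.pi)) ≠ 0 :=
    mul_ne_zero hB0 (ENNReal.div_ne_zero.2 ⟨hL0, ENNReal.ofReal_ne_top⟩)
  have hk1 : volume B * (volume L / ENNReal.ofReal (2 * Real.pi)) ≠ ∞ :=
    ENNReal.mul_ne_top hB1 (ENNReal.div_ne_top hLtop hpi)
  rw [mul_assoc lam, mul_left_comm, mul_comm (volume B * _), ENNReal.mul_div_mul_right _ _ hk0 hk1,
    hlam', ENNReal.toReal_ofReal hq.le, ENNReal.ofReal_div_of_pos (mul_pos Real.two_pi_pos hq),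
    ENNReal.ofReal_mul (sq_nonneg lamp),
    ENNReal.ofReal_mul (p := 2 * Real.pi) (q := q) Real.two_pi_pos.le,
    ENNReal.ofReal_pow hlamp.le, div_eq_mul_inv, div_eq_mul_inv,
    ENNReal.mul_inv (Or.inl hpi) (Or.inl ENNReal.ofReal_ne_top)]
  ring
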